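/- **Conventions.** Let $k$ be a field; $\otimes=\otimes_k$, algebras are associative unital $k$-algebras, and summation is understood in all formulas with components. A *quasi-bialgebra* is an algebra $H$ with algebra maps $\Delta:H\to H\otimes H$, $\Delta(h)=h_1\otimes h_2$, and $\varepsilon:H\to k$, and an invertible $\Phi=X^1\otimes X^2\otimes X^3\in H^{\otimes 3}$, $\Phi^{-1}=x^1\otimes x^2\otimes x^3$, such that $(id\otimes\Delta)\Delta(h)=\Phi\,(\Delta\otimes id)\Delta(h)\,\Phi^{-1}$, $(id\otimes\varepsilon)\Delta(h)=h=(\varepsilon\otimes id)\Delta(h)$, $(1\otimes\Phi)(id\otimes\Delta\otimes id)(\Phi)(\Phi\otimes1)=(id\otimes id\otimes\Delta)(\Phi)(\Delta\otimes id\otimes id)(\Phi)$ and $(id\otimes\varepsilon\otimes id)(\Phi)=1\otimes 1$. It is a *quasi-Hopf algebra* if there are an anti-automorphism $S$ of the algebra $H$ and $\alpha,\beta\in H$ with $S(h_1)\alpha h_2=\varepsilon(h)\alpha$, $h_1\beta S(h_2)=\varepsilon(h)\beta$, $X^1\beta S(X^2)\alpha X^3=1=S(x^1)\alpha x^2\beta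 S(x^3)$, normalized by $\varepsilon(\alpha)=\varepsilon(\beta)=1$. Its *Drinfeld twist* is $$f=f^1\otimes f^2=(S\otimes S)(\Delta^{cop}(x^1))\,\gamma\,\Delta(x^2\beta S(x^3)),\qquad \gamma=S(A^2)\alpha A^3\otimes S(A^1)\alpha A^4,$$ where $A^1\otimes A^2\otimes A^3\otimes A^4=(\Phi\otimes1)(\Delta\otimes id\otimes id)(\Phi^{-1})$. The algebra $H^{op}\otimes H$ is a quasi-bialgebra with the componentwise comultiplication and counit and reassociator $(x^1\otimes Y^1)\otimes(x^2\otimes Y^2)\otimes(x^3\otimes Y^3)$, where $Y^1\otimes Y^2\otimes Y^3$ is a second copy of $\Phi$. An *$H$-bicomodule algebra* is an algebra $A$ with algebra maps $\lambda:A\to H\otimes A$, $\lambda(u)=u_{[-1]}\otimes u_{[0]}$, and $\rho:A\to A\otimes H$, $\rho(u)=u_{<0>}\otimes u_{<1>}$, and invertible elements $\Phi_\lambda\in H\otimes H\otimes A$, $\Phi_\rho\in A\otimes H\otimes H$, $\Phi_{\lambda,\rho}\in H\otimes A\otimes H$ such that, for all $u\in A$: * $(id\otimes\lambda)(\lambda(u))\Phi_\lambda=\Phi_\lambda(\Delta\otimes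 id)(\lambda(u))$, $(1\otimes\Phi_\lambda)(id\otimes\Delta\otimes id)(\Phi_\lambda)(\Phi\otimes1)=(id\otimes id\otimes\lambda)(\Phi_\lambda)(\Delta\otimes id\otimes id)(\Phi_\lambda)$, $(\varepsilon\otimes id)\lambda=id$, $(id\otimes\varepsilon\otimes id)(\Phi_\lambda)=1=(\varepsilon\otimes id\otimes id)(\Phi_\lambda)$; * $\Phi_\rho(\rho\otimes id)(\rho(u))=(id\otimes\Delta)(\rho(u))\Phi_\rho$, $(1\otimes\Phi)(id\otimes\Delta\otimes id)(\Phi_\rho)(\Phi_\rho\otimes1)=(id\otimes id\otimes\Delta)(\Phi_\rho)(\rho\otimes id\otimes id)(\Phi_\rho)$, $(id\otimes\varepsilon)\rho=id$, $(id\otimes\varepsilon\otimes id)(\Phi_\rho)=1=(id\otimes id\otimes\varepsilon)(\Phi_\rho)$; * $\Phi_{\lambda,\rho}(\lambda\otimes id)(\rho(u))=(id\otimes\rho)(\lambda(u))\Phi_{\lambda,\rho}$, $(1\otimes\Phi_{\lambda,\rho})(id\otimes\lambda\otimes id)(\Phi_{\lambda,\rho})(\Phi_\lambda\otimes1)=(id\otimes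 id\otimes\rho)(\Phi_\lambda)(\Delta\otimes id\otimes id)(\Phi_{\lambda,\rho})$ and $(1\otimes\Phi_\rho)(id\otimes\rho\otimes id)(\Phi_{\lambda,\rho})(\Phi_{\lambda,\rho}\otimes1)=(id\otimes id\otimes\Delta)(\Phi_{\lambda,\rho})(\lambda\otimes id\otimes id)(\Phi_\rho)$. Write $\Phi_\lambda=\tilde X^1_\lambda\otimes\tilde X^2_\lambda\otimes\tilde X^3_\lambda$, $\Phi_\lambda^{-1}=\tilde x^1_\lambda\otimes\tilde x^2_\lambda\otimes\tilde x^3_\lambda$, similarly $\Phi_\rho^{\pm1}$ with index $\rho$, and $\Phi_{\lambda,\rho}=\Theta^1\otimes\Theta^2\otimes\Theta^3$, $\Phi_{\lambda,\rho}^{-1}=\theta^1\otimes\theta^2\otimes\theta^3$. An *$H$-bimodule coalgebra* is an $H$-bimodule $C$ with linear maps $\underline\Delta:C\to C\otimes C$, $\underline\Delta(c)=c_{\underline1}\otimes c_{\underline2}$, and $\underline\varepsilon:C\to k$ such that $\Phi\cdot(\underline\Delta\otimes id)(\underline\Delta(c))\cdot\Phi^{-1}=(id\otimes\underline\Delta)(\underline\Delta(c))$,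 $(\underline\varepsilon\otimes id)\underline\Delta=id=(id\otimes\underline\varepsilon)\underline\Delta$, $\underline\Delta(h\cdot c\cdot h')=h_1\cdot c_{\underline1}\cdot h'_1\otimes h_2\cdot c_{\underline2}\cdot h'_2$ and $\underline\varepsilon(h\cdot c\cdot h')=\varepsilon(h)\underline\varepsilon(c)\varepsilon(h')$. It is a left $H^{op}\otimes H$-module coalgebra (a coalgebra in the monoidal category of left $H^{op}\otimes H$-modules) through $(h\otimes h')\cdot c=h'\cdot c\cdot h$. **The categories.** Let $H$ be a quasi-Hopf algebra, $A$ an $H$-bicomodule algebra and $C$ an $H$-bimodule coalgebra. The objects of $_A\mathcal{YD}(H)^C$ are the left $A$-modules $M$ with a linear map $\rho_M:M\to M\otimes C$, $\rho_M(m)=m_{(0)}\otimes m_{(1)}$, such that for all $m\in M$, $u\in A$: $\underline\varepsilon(m_{(1)})m_{(0)}=m$, $$(\theta^2\cdot m_{(0)})_{(0)}\otimes(\theta^2\cdot m_{(0)})_{(1)}\cdot\theta^1\otimes\theta^3\cdot m_{(1)}=\tilde x^1_\rho\cdot(\tilde x^3_\lambda\cdot m)_{(0)}\otimes\tilde x^2_\rho\cdot(\tilde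 x^3_\lambda\cdot m)_{(1)_{\underline1}}\cdot\tilde x^1_\lambda\otimes\tilde x^3_\rho\cdot(\tilde x^3_\lambda\cdot m)_{(1)_{\underline2}}\cdot\tilde x^2_\lambda,$$ $$u_{<0>}\cdot m_{(0)}\otimes u_{<1>}\cdot m_{(1)}=(u_{[0]}\cdot m)_{(0)}\otimes(u_{[0]}\cdot m)_{(1)}\cdot u_{[-1]}.$$ Let $A^2$ be the algebra $A$ with $\rho_2:A\to A\otimes(H^{op}\otimes H)$, $\rho_2(u)=u_{[0]_{<0>}}\otimes(S^{-1}(u_{[-1]})\otimes u_{[0]_{<1>}})$, and $$\Phi_{\rho_2}=(\tilde x^3_\lambda)_{<0>}\tilde X^1_\rho\Theta^2_{<0>}\otimes\big(S^{-1}(f^2\tilde x^2_\lambda\Theta^1)\otimes(\tilde x^3_\lambda)_{<1>_1}\tilde X^2_\rho\Theta^2_{<1>}\big)\otimes\big(S^{-1}(f^1\tilde x^1_\lambda)\otimes(\tilde x^3_\lambda)_{<1>_2}\tilde X^3_\rho\Theta^3\big),$$ in $A\otimes(H^{op}\otimes H)\otimes(H^{op}\otimes H)$, where the products are those of $A$ and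 $H$. The objects of the Doi-Hopf module category $_{A^2}\mathcal M(H^{op}\otimes H)^C$ are the left $A$-modules $M$ with a linear map $\rho_M:M\to M\otimes C$ such that for all $m\in M$, $u\in A$: $(id\otimes\underline\varepsilon)(\rho_M(m))=m$, $\Phi_{\rho_2}\cdot(\rho_M\otimes id)(\rho_M(m))=(id\otimes\underline\Delta)(\rho_M(m))$ and $\rho_M(u\cdot m)=\rho_2(u)\cdot\rho_M(m)$. In both categories the morphisms are the $A$-linear maps that are compatible with the maps $\rho_M$. **Theorem.** Put $\tilde p_\lambda=\tilde p^1_\lambda\otimes\tilde p^2_\lambda=\tilde X^2_\lambda S^{-1}(\tilde X^1_\lambda\beta)\otimes\tilde X^3_\lambda$ and $\tilde q_\lambda=\tilde q^1_\lambda\otimes\tilde q^2_\lambda=S(\tilde x^1_\lambda)\alpha\tilde x^2_\lambda\otimes\tilde x^3_\lambda$ in $H\otimes A$. Leaving the $A$-modules and the morphisms unchanged and replacing the map $\rho_M$, respectively, by $$m\mapsto(\tilde p^2_\lambda\cdot m)_{(0)}\otimes(\tilde p^2_\lambda\cdot m)_{(1)}\cdot\tilde p^1_\lambda\qquad\text{and}\qquad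 m\mapsto(\tilde q^2_\lambda)_{<0>}\cdot m_{(0)}\otimes(\tilde q^2_\lambda)_{<1>}\cdot m_{(1)}\cdot S^{-1}(\tilde q^1_\lambda)$$ defines functors $F:{}_A\mathcal{YD}(H)^C\to{}_{A^2}\mathcal M(H^{op}\otimes H)^C$ and $G:{}_{A^2}\mathcal M(H^{op}\otimes H)^C\to{}_A\mathcal{YD}(H)^C$, and $G\circ F$ and $F\circ G$ are the identity functors. So the two categories are isomorphic. In particular, $_A\mathcal{YD}(H)^C$ is a Grothendieck category, and it has enough injective objects. -/

import Mathlib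

open scoped TensorProduct

open CategoryTheory

set_option maxSynthPendingDepth 12

universe u

namespace QHopf

/-! ### The opposite algebra -/

/-- The opposite algebra `H^op`: the type `Hᵐᵒᵖ` with its ring structure and `k`-algebra
structure. -/
def Op (H : Type*) : Type _ := Hᵐᵒᵖ

noncomputable instance (H : Type*) [Ring H] : Ring (Op H) := inferInstanceAs (Ring Hᵐᵒᵖ)

noncomputable instance (k H : Type*) [Field k] [Ring H] [Algebra k H] : Algebra k (Op H) :=
  inferInstanceAs (Algebra k Hᵐᵒᵖ)

/-- The identity map `H → H^op`. -/
noncomputable def toOp (k H : Type*) [Field k] [Ring H] [Algebra k H] : H ≃ₗ[k] Op H :=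
  MulOpposite.opLinearEquiv k

theorem toOp_mul {k H : Type*} [Field k] [Ring H] [Algebra k H] (x y : H) :
    toOp k H (x * y) = toOp k H y * toOp k H x := rfl

theorem toOp_one {k H : Type*} [Field k] [Ring H] [Algebra k H] : toOp k H 1 = 1 := rfl

theorem toOp_symm_mul {k H : Type*} [Field k] [Ring H] [Algebra k H] (x y : Op H) :
    (toOp k H).symm (x * y) = (toOp k H).symm y * (toOp k H).symm x := rfl

theorem toOp_symm_one {k H : Type*} [Field k] [Ring H] [Algebra k H] :
    (toOp k H).symm 1 = 1 := rfl

/-! ### Tensor bookkeeping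

All iterated tensor products are bracketed to the right: `X ⊗ (Y ⊗ (Z ⊗ W))`. -/

section Tensor

variable {k : Type*} [Field k]
variable {X X' Y Y' Z W : Type*}
variable [Ring X] [Algebra k X] [Ring X'] [Algebra k X'] [Ring Y] [Algebra k Y]
variable [Ring Y'] [Algebra k Y'] [Ring Z] [Algebra k Z] [Ring W] [Algebra k W]

/-- `id ⊗ f`. -/
noncomputable abbrev onSnd (X : Type*) [Ring X] [Algebra k X] (f : Y →ₐ[k] Y') :
    X ⊗[k] Y →ₐ[k] X ⊗[k] Y' :=
  Algebra.TensorProduct.map (AlgHom.id k X) f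

/-- `f ⊗ id` for `f : X → Y ⊗ Z`, rebracketed: `x ⊗ w ↦ y ⊗ (z ⊗ w)` where `f x = y ⊗ z`. -/
noncomputable def splitFst (W : Type*) [Ring W] [Algebra k W] (f : X →ₐ[k] Y ⊗[k] Z) :
    X ⊗[k] W →ₐ[k] Y ⊗[k] (Z ⊗[k] W) :=
  (Algebra.TensorProduct.assoc k k k Y Z W).toAlgHom.comp
    (Algebra.TensorProduct.map f (AlgHom.id k W))

/-- `e ⊗ id : X ⊗ W → k ⊗ W = W`. -/
noncomputable def dropFst (W : Type*) [Ring W] [Algebra k W] (e : X →ₐ[k] k) :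
    X ⊗[k] W →ₐ[k] W :=
  (Algebra.TensorProduct.lid k W).toAlgHom.comp
    (Algebra.TensorProduct.map e (AlgHom.id k W))

/-- `id ⊗ e : W ⊗ X → W ⊗ k = W`. -/
noncomputable def dropSnd (W : Type*) [Ring W] [Algebra k W] (e : X →ₐ[k] k) :
    W ⊗[k] X →ₐ[k] W :=
  (Algebra.TensorProduct.rid k k W).toAlgHom.comp
    (Algebra.TensorProduct.map (AlgHom.id k W) e)

/-- `t ↦ t ⊗ 1_W`, for `t` in a triple tensor product. -/
noncomputable def padRight (W : Type*) [Ring W] [Algebra k W] :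
    X ⊗[k] (Y ⊗[k] Z) →ₐ[k] X ⊗[k] (Y ⊗[k] (Z ⊗[k] W)) :=
  onSnd X (onSnd Y (Algebra.TensorProduct.includeLeft))

/-- `t ↦ 1_W ⊗ t`. -/
noncomputable abbrev padLeft (W : Type*) [Ring W] [Algebra k W] : X →ₐ[k] W ⊗[k] X :=
  Algebra.TensorProduct.includeRight

end Tensor

section LinearTensor

variable {k : Type*} [Field k]
variable {P Q V W M N : Type*}
variable [AddCommGroup P] [Module k P] [AddCommGroup Q] [Module k Q]
variable [AddCommGroup V] [Module k V] [AddCommGroup W] [Module k W]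
variable [AddCommGroup M] [Module k M] [AddCommGroup N] [Module k N]

/-- The tensor product of two families of linear maps:
`p ⊗ q` is sent to `f p ⊗ g q : V ⊗ W → M ⊗ N`. For actions `f` on `V` and `g` on `W`, this is
the componentwise action of `P ⊗ Q` on `V ⊗ W`. -/
noncomputable def tensorAct (f : P →ₗ[k] (V →ₗ[k] M)) (g : Q →ₗ[k] (W →ₗ[k] N)) :
    P ⊗[k] Q →ₗ[k] (V ⊗[k] W →ₗ[k] M ⊗[k] N) :=
  TensorProduct.homTensorHomMap (RingHom.id k) V W M N ∘ₗ TensorProduct.map f g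

/-- `p ⊗ q ↦ f p ∘ T ∘ g q`. -/
noncomputable def conjAct (f : P →ₗ[k] (V →ₗ[k] W)) (T : M →ₗ[k] V)
    (g : Q →ₗ[k] (N →ₗ[k] M)) : P ⊗[k] Q →ₗ[k] (N →ₗ[k] W) :=
  TensorProduct.lift (LinearMap.mk₂ k (fun p q => f p ∘ₗ T ∘ₗ g q)
    (fun _ _ _ => by ext; simp) (fun _ _ _ => by ext; simp)
    (fun _ _ _ => by ext; simp) (fun _ _ _ => by ext; simp))

/-- `f ⊗ id` for `f : V → M ⊗ N`, rebracketed to `V ⊗ W → M ⊗ (N ⊗ W)`. -/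
noncomputable def splitFstLin (W : Type*) [AddCommGroup W] [Module k W]
    (f : V →ₗ[k] M ⊗[k] N) : V ⊗[k] W →ₗ[k] M ⊗[k] (N ⊗[k] W) :=
  (TensorProduct.assoc k M N W).toLinearMap ∘ₗ TensorProduct.map f LinearMap.id

@[simp] theorem tensorAct_tmul (f : P →ₗ[k] (V →ₗ[k] M)) (g : Q →ₗ[k] (W →ₗ[k] N)) (p : P)
    (q : Q) : tensorAct f g (p ⊗ₜ q) = TensorProduct.map (f p) (g q) := rfl

@[simp] theorem conjAct_tmul (f : P →ₗ[k] (V →ₗ[k] W)) (T : M →ₗ[k] V)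
    (g : Q →ₗ[k] (N →ₗ[k] M)) (p : P) (q : Q) :
    conjAct f T g (p ⊗ₜ q) = f p ∘ₗ T ∘ₗ g q := rfl

end LinearTensor

/-! ### Quasi-bialgebras and quasi-Hopf algebras -/

/-- Quasi-bialgebra structures on the `k`-algebra `H`. -/
structure QuasiBialgebra (k H : Type*) [Field k] [Ring H] [Algebra k H] where
  /-- the comultiplication -/
  Δ : H →ₐ[k] H ⊗[k] H
  /-- the counit -/
  ε : H →ₐ[k] k
  /-- the reassociator -/
  Φ : (H ⊗[k] (H ⊗[k] H))ˣ
  coassoc : ∀ h : H, onSnd H Δ (Δ h) = Φ * splitFst H Δ (Δ h) * (↑Φ⁻¹ : H ⊗[k] (H ⊗[k] H))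
  counit_right : ∀ h : H, dropSnd H ε (Δ h) = h
  counit_left : ∀ h : H, dropFst H ε (Δ h) = h
  /-- `(1 ⊗ Φ)(id ⊗ Δ ⊗ id)(Φ)(Φ ⊗ 1) = (id ⊗ id ⊗ Δ)(Φ)(Δ ⊗ id ⊗ id)(Φ)` -/
  pentagon :
    padLeft H (Φ : H ⊗[k] (H ⊗[k] H)) * onSnd H (splitFst H Δ) (Φ : H ⊗[k] (H ⊗[k] H))
        * padRight H (Φ : H ⊗[k] (H ⊗[k] H))
      = onSnd H (onSnd H Δ) (Φ : H ⊗[k] (H ⊗[k] H)) * splitFst (H ⊗[k] H) Δ (Φ : H ⊗[k] (H ⊗[k] H))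
  /-- `(id ⊗ ε ⊗ id)(Φ) = 1 ⊗ 1` -/
  Φ_counit : onSnd H (dropFst H ε) (Φ : H ⊗[k] (H ⊗[k] H)) = 1

section Sandwich

variable {k H : Type*} [Field k] [Ring H] [Algebra k H]

/-- `x ⊗ y ↦ S(x) a y`. -/
noncomputable def sandL (S : H →ₗ[k] H) (a : H) : H ⊗[k] H →ₗ[k] H :=
  LinearMap.mul' k H ∘ₗ TensorProduct.map (LinearMap.mulRight k a ∘ₗ S) LinearMap.id

/-- `x ⊗ y ↦ x b S(y)`. -/
noncomputable def sandR (S : H →ₗ[k] H) (b : H) : H ⊗[k] H →ₗ[k] H :=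
  LinearMap.mul' k H ∘ₗ TensorProduct.map (LinearMap.mulRight k b) S

/-- `x ⊗ y ⊗ z ↦ x b S(y) a z`. -/
noncomputable def sandRL (S : H →ₗ[k] H) (b a : H) : H ⊗[k] (H ⊗[k] H) →ₗ[k] H :=
  LinearMap.mul' k H ∘ₗ TensorProduct.map (LinearMap.mulRight k b) (sandL S a)

/-- `x ⊗ y ⊗ z ↦ S(x) a y b S(z)`. -/
noncomputable def sandLR (S : H →ₗ[k] H) (a b : H) : H ⊗[k] (H ⊗[k] H) →ₗ[k] H :=
  LinearMap.mul' k H ∘ₗ TensorProduct.map (LinearMap.mulRight k a ∘ₗ S) (sandR S b)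

end Sandwich

/-- Quasi-Hopf algebra structures on the `k`-algebra `H`: a quasi-bialgebra with a bijective
antipode (an anti-automorphism of the algebra) and elements `α`, `β`, normalized by
`ε(α) = ε(β) = 1`. -/
structure QuasiHopfAlgebra (k H : Type*) [Field k] [Ring H] [Algebra k H] extends
    QuasiBialgebra k H where
  /-- the antipode -/
  S : H ≃ₗ[k] H
  α : H
  β : H
  S_one : S 1 = 1
  S_mul : ∀ x y : H, S (x * y) = S y * S x
  antipode_left : ∀ h : H, sandL S.toLinearMap α (Δ h) = ε h • α
  antipode_right : ∀ h : H, sandR S.toLinearMap β (Δ h) = ε h • β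
  /-- `X¹ β S(X²) α X³ = 1` -/
  antipode_Φ : sandRL S.toLinearMap β α (Φ : H ⊗[k] (H ⊗[k] H)) = 1
  /-- `S(x¹) α x² β S(x³) = 1` -/
  antipode_Φ_inv : sandLR S.toLinearMap α β (↑Φ⁻¹ : H ⊗[k] (H ⊗[k] H)) = 1
  ε_α : ε α = 1
  ε_β : ε β = 1

namespace QuasiHopfAlgebra

variable {k H : Type*} [Field k] [Ring H] [Algebra k H] (Q : QuasiHopfAlgebra k H)

/-- The inverse antipode, as an algebra morphism `H → H^op`. -/
noncomputable def SinvOp : H →ₐ[k] Op H :=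
  AlgHom.ofLinearMap ((toOp k H).toLinearMap ∘ₗ Q.S.symm.toLinearMap)
    (by
      have h : Q.S.symm 1 = 1 := by rw [LinearEquiv.symm_apply_eq, Q.S_one]
      simp [h, toOp_one])
    (by
      intro x y
      have h : Q.S.symm (x * y) = Q.S.symm y * Q.S.symm x := by
        rw [LinearEquiv.symm_apply_eq, Q.S_mul]; simp
      simp [h, toOp_mul])

/-- `a ⊗ b ⊗ c ⊗ d ↦ S(b) α c ⊗ S(a) α d`. -/
noncomputable def gammaMap : H ⊗[k] (H ⊗[k] (H ⊗[k] H)) →ₗ[k] H ⊗[k] H :=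
  TensorProduct.map (sandL Q.S.toLinearMap Q.α) (sandL Q.S.toLinearMap Q.α) ∘ₗ
    (TensorProduct.tensorTensorTensorComm k H H H H).toLinearMap ∘ₗ
    TensorProduct.map (TensorProduct.comm k H H).toLinearMap LinearMap.id ∘ₗ
    (TensorProduct.assoc k H H (H ⊗[k] H)).symm.toLinearMap

/-- `γ = S(A²) α A³ ⊗ S(A¹) α A⁴`, where `A = (Φ ⊗ 1)(Δ ⊗ id ⊗ id)(Φ⁻¹)`. -/
noncomputable def gamma : H ⊗[k] H :=
  Q.gammaMap (padRight H (Q.Φ : H ⊗[k] (H ⊗[k] H)) *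
    splitFst (H ⊗[k] H) Q.Δ (↑Q.Φ⁻¹ : H ⊗[k] (H ⊗[k] H)))

/-- The Drinfeld twist `f = (S ⊗ S)(Δ^cop(x¹)) γ Δ(x² β S(x³))`,
where `Φ⁻¹ = x¹ ⊗ x² ⊗ x³`. -/
noncomputable def drinfeldTwist : H ⊗[k] H :=
  (LinearMap.mul' k (H ⊗[k] H) ∘ₗ
    TensorProduct.map
      (LinearMap.mulRight k Q.gamma ∘ₗ
        TensorProduct.map Q.S.toLinearMap Q.S.toLinearMap ∘ₗ
        (TensorProduct.comm k H H).toLinearMap ∘ₗ Q.Δ.toLinearMap)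
      (Q.Δ.toLinearMap ∘ₗ sandR Q.S.toLinearMap Q.β))
    (↑Q.Φ⁻¹ : H ⊗[k] (H ⊗[k] H))

end QuasiHopfAlgebra

/-! ### The quasi-bialgebra `H^op ⊗ H` -/

section OpTensor

variable {k : Type*} [Field k]

section Transfer

variable {X T : Type*} [Ring X] [Algebra k X] [Ring T] [Algebra k T]

/-- `τ ⊗ τ`. -/
noncomputable def lift₂ (τ : X →ₗ[k] T) : X ⊗[k] X →ₗ[k] T ⊗[k] T := TensorProduct.map τ τ

/-- `τ ⊗ τ ⊗ τ`. -/
noncomputable def lift₃ (τ : X →ₗ[k] T) :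
    X ⊗[k] (X ⊗[k] X) →ₗ[k] T ⊗[k] (T ⊗[k] T) := TensorProduct.map τ (lift₂ τ)

/-- `τ ⊗ τ ⊗ τ ⊗ τ`. -/
noncomputable def lift₄ (τ : X →ₗ[k] T) :
    X ⊗[k] (X ⊗[k] (X ⊗[k] X)) →ₗ[k] T ⊗[k] (T ⊗[k] (T ⊗[k] T)) := TensorProduct.map τ (lift₃ τ)

variable {τ : X →ₗ[k] T} {D : X →ₐ[k] X ⊗[k] X} {D' : T →ₐ[k] T ⊗[k] T}
  {e : X →ₐ[k] k} {e' : T →ₐ[k] k}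

theorem lift_onSnd (h : ∀ x, D' (τ x) = lift₂ τ (D x)) (t : X ⊗[k] X) :
    onSnd T D' (lift₂ τ t) = lift₃ τ (onSnd X D t) := by
  induction t with
  | zero => simp
  | add a b ha hb => simp only [map_add, ha, hb]
  | tmul a b =>
    change τ a ⊗ₜ D' (τ b) = τ a ⊗ₜ lift₂ τ (D b)
    rw [h]

theorem lift_splitFst (h : ∀ x, D' (τ x) = lift₂ τ (D x)) (t : X ⊗[k] X) :
    splitFst T D' (lift₂ τ t) = lift₃ τ (splitFst X D t) := by
  induction t with
  | zero => simp
  | add a b ha hb => simp only [map_add, ha, hb]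
  | tmul a b =>
    change (TensorProduct.assoc k _ _ _) (D' (τ a) ⊗ₜ τ b)
      = lift₃ τ ((TensorProduct.assoc k _ _ _) (D a ⊗ₜ b))
    rw [h]
    induction D a with
    | zero => simp
    | add a b ha hb => simp only [map_add, TensorProduct.add_tmul, ha, hb]
    | tmul a b => rfl

theorem lift_dropFst (h : ∀ x, e' (τ x) = e x) (t : X ⊗[k] X) :
    dropFst T e' (lift₂ τ t) = τ (dropFst X e t) := by
  induction t with
  | zero => simp
  | add a b ha hb => simp only [map_add, ha, hb]
  | tmul a b =>
    change e' (τ a) • τ b = τ (e a • b)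
    rw [h, map_smul]

theorem lift_dropSnd (h : ∀ x, e' (τ x) = e x) (t : X ⊗[k] X) :
    dropSnd T e' (lift₂ τ t) = τ (dropSnd X e t) := by
  induction t with
  | zero => simp
  | add a b ha hb => simp only [map_add, ha, hb]
  | tmul a b =>
    change e' (τ b) • τ a = τ (e b • a)
    rw [h, map_smul]

theorem lift_onSnd_splitFst (h : ∀ x, D' (τ x) = lift₂ τ (D x)) (t : X ⊗[k] (X ⊗[k] X)) :
    onSnd T (splitFst T D') (lift₃ τ t) = lift₄ τ (onSnd X (splitFst X D) t) := by
  induction t with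
  | zero => simp
  | add a b ha hb => simp only [map_add, ha, hb]
  | tmul a b =>
    change τ a ⊗ₜ splitFst T D' (lift₂ τ b) = τ a ⊗ₜ lift₃ τ (splitFst X D b)
    rw [lift_splitFst h]

theorem lift_onSnd_onSnd (h : ∀ x, D' (τ x) = lift₂ τ (D x)) (t : X ⊗[k] (X ⊗[k] X)) :
    onSnd T (onSnd T D') (lift₃ τ t) = lift₄ τ (onSnd X (onSnd X D) t) := by
  induction t with
  | zero => simp
  | add a b ha hb => simp only [map_add, ha, hb]
  | tmul a b =>
    change τ a ⊗ₜ onSnd T D' (lift₂ τ b) = τ a ⊗ₜ lift₃ τ (onSnd X D b)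
    rw [lift_onSnd h]

theorem lift_splitFst₃ (h : ∀ x, D' (τ x) = lift₂ τ (D x)) (t : X ⊗[k] (X ⊗[k] X)) :
    splitFst (T ⊗[k] T) D' (lift₃ τ t) = lift₄ τ (splitFst (X ⊗[k] X) D t) := by
  induction t with
  | zero => simp
  | add a b ha hb => simp only [map_add, ha, hb]
  | tmul a b =>
    change (TensorProduct.assoc k _ _ _) (D' (τ a) ⊗ₜ lift₂ τ b)
      = lift₄ τ ((TensorProduct.assoc k _ _ _) (D a ⊗ₜ b))
    rw [h]
    induction D a with
    | zero => simp
    | add a b ha hb => simp only [map_add, TensorProduct.add_tmul, ha, hb]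
    | tmul a b => rfl

theorem lift_padRight (h : τ 1 = 1) (t : X ⊗[k] (X ⊗[k] X)) :
    padRight T (lift₃ τ t) = lift₄ τ (padRight X t) := by
  induction t with
  | zero => simp
  | add a b ha hb => simp only [map_add, ha, hb]
  | tmul a b =>
    induction b with
    | zero => simp
    | add a b ha hb => simp only [map_add, TensorProduct.tmul_add, ha, hb]
    | tmul b c =>
      change τ a ⊗ₜ (τ b ⊗ₜ (τ c ⊗ₜ 1)) = τ a ⊗ₜ (τ b ⊗ₜ (τ c ⊗ₜ τ 1))
      rw [h]

theorem lift_padLeft (h : τ 1 = 1) (t : X ⊗[k] (X ⊗[k] X)) :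
    padLeft T (lift₃ τ t) = lift₄ τ (padLeft X t) := by
  change 1 ⊗ₜ lift₃ τ t = τ 1 ⊗ₜ lift₃ τ t
  rw [h]

theorem lift_onSnd_dropFst (h : ∀ x, e' (τ x) = e x) (t : X ⊗[k] (X ⊗[k] X)) :
    onSnd T (dropFst T e') (lift₃ τ t) = lift₂ τ (onSnd X (dropFst X e) t) := by
  induction t with
  | zero => simp
  | add a b ha hb => simp only [map_add, ha, hb]
  | tmul a b =>
    change τ a ⊗ₜ dropFst T e' (lift₂ τ b) = τ a ⊗ₜ τ (dropFst X e b)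
    rw [lift_dropFst h]

theorem lift₃_one (h : τ 1 = 1) : lift₃ τ 1 = 1 := by
  change τ 1 ⊗ₜ (τ 1 ⊗ₜ τ 1) = (1 : T) ⊗ₜ[k] ((1 : T) ⊗ₜ[k] (1 : T))
  rw [h]

theorem lift₂_one (h : τ 1 = 1) : lift₂ τ 1 = 1 := by
  change τ 1 ⊗ₜ τ 1 = (1 : T) ⊗ₜ[k] (1 : T)
  rw [h]

end Transfer

section MapMul

variable {X Y X' Y' : Type*}
variable [Ring X] [Algebra k X] [Ring Y] [Algebra k Y]
variable [Ring X'] [Algebra k X'] [Ring Y'] [Algebra k Y']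

theorem map_antimul (f : X →ₗ[k] X') (g : Y →ₗ[k] Y')
    (hf : ∀ a b, f (a * b) = f b * f a) (hg : ∀ a b, g (a * b) = g b * g a)
    (s t : X ⊗[k] Y) :
    TensorProduct.map f g (s * t) = TensorProduct.map f g t * TensorProduct.map f g s := by
  induction s with
  | zero => simp
  | add a b ha hb => rw [add_mul, map_add, ha, hb, map_add, mul_add]
  | tmul a b =>
    induction t with
    | zero => simp
    | add c d hc hd => rw [mul_add, map_add, hc, hd, map_add, add_mul]
    | tmul c d => simp [hf, hg]

theorem map_mul' (f : X →ₗ[k] X') (g : Y →ₗ[k] Y')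
    (hf : ∀ a b, f (a * b) = f a * f b) (hg : ∀ a b, g (a * b) = g a * g b)
    (s t : X ⊗[k] Y) :
    TensorProduct.map f g (s * t) = TensorProduct.map f g s * TensorProduct.map f g t := by
  induction s with
  | zero => simp
  | add a b ha hb => rw [add_mul, map_add, ha, hb, map_add, add_mul]
  | tmul a b =>
    induction t with
    | zero => simp
    | add c d hc hd => rw [mul_add, map_add, hc, hd, map_add, mul_add]
    | tmul c d => simp [hf, hg]

theorem map_comm {Z W : Type*} [Ring Z] [Algebra k Z] [Ring W] [Algebra k W]
    (f : X →ₗ[k] Z) (g : Y →ₗ[k] W) (f' : X' →ₗ[k] Z) (g' : Y' →ₗ[k] W)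
    (hf : ∀ a b, f a * f' b = f' b * f a) (hg : ∀ a b, g a * g' b = g' b * g a)
    (s : X ⊗[k] Y) (t : X' ⊗[k] Y') :
    TensorProduct.map f g s * TensorProduct.map f' g' t
      = TensorProduct.map f' g' t * TensorProduct.map f g s := by
  induction s with
  | zero => simp
  | add a b ha hb => rw [map_add, add_mul, ha, hb, mul_add]
  | tmul a b =>
    induction t with
    | zero => simp
    | add c d hc hd => rw [map_add, mul_add, hc, hd, add_mul]
    | tmul c d => simp [hf, hg]

end MapMul

/-- The inverse form of the pentagon. -/
theorem QuasiBialgebra.pentagon_inv {H : Type*} [Ring H] [Algebra k H]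
    (Q : QuasiBialgebra k H) :
    padRight H (↑Q.Φ⁻¹ : H ⊗[k] (H ⊗[k] H)) * (onSnd H (splitFst H Q.Δ)
        (↑Q.Φ⁻¹ : H ⊗[k] (H ⊗[k] H)) * padLeft H (↑Q.Φ⁻¹ : H ⊗[k] (H ⊗[k] H)))
      = splitFst (H ⊗[k] H) Q.Δ (↑Q.Φ⁻¹ : H ⊗[k] (H ⊗[k] H)) *
        onSnd H (onSnd H Q.Δ) (↑Q.Φ⁻¹ : H ⊗[k] (H ⊗[k] H)) := by
  have h := congrArg Units.inv
    (show Units.map (padLeft (k := k) H : _ →ₐ[k] _).toMonoidHom Q.Φ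
        * Units.map (onSnd H (splitFst H Q.Δ)).toMonoidHom Q.Φ
        * Units.map (padRight H).toMonoidHom Q.Φ
      = Units.map (onSnd H (onSnd H Q.Δ)).toMonoidHom Q.Φ
        * Units.map (splitFst (H ⊗[k] H) Q.Δ).toMonoidHom Q.Φ from Units.ext Q.pentagon)
  simpa [mul_assoc] using h

theorem QuasiBialgebra.Φ_inv_counit {H : Type*} [Ring H] [Algebra k H]
    (Q : QuasiBialgebra k H) :
    onSnd H (dropFst H Q.ε) (↑Q.Φ⁻¹ : H ⊗[k] (H ⊗[k] H)) = 1 := by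
  have h1 := congrArg (onSnd H (dropFst H Q.ε)) Q.Φ.mul_inv
  rwa [map_mul, Q.Φ_counit, one_mul, map_one] at h1

section Opposite

variable {X : Type*} [Ring X] [Algebra k X]

variable (k) in
/-- The identity `X → X^op`, as a linear map. -/
noncomputable abbrev opL (X : Type*) [Ring X] [Algebra k X] : X →ₗ[k] Op X :=
  (toOp k X).toLinearMap

theorem op₂_mul (a b : X ⊗[k] X) :
    lift₂ (opL k X) (a * b) = lift₂ (opL k X) b * lift₂ (opL k X) a :=
  map_antimul _ _ toOp_mul toOp_mul a b

theorem op₃_mul (a b : X ⊗[k] (X ⊗[k] X)) :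
    lift₃ (opL k X) (a * b) = lift₃ (opL k X) b * lift₃ (opL k X) a :=
  map_antimul _ _ toOp_mul op₂_mul a b

theorem op₄_mul (a b : X ⊗[k] (X ⊗[k] (X ⊗[k] X))) :
    lift₄ (opL k X) (a * b) = lift₄ (opL k X) b * lift₄ (opL k X) a :=
  map_antimul _ _ toOp_mul op₃_mul a b

/-- The algebra morphism `X^op → X^op ⊗ X^op` with the same underlying linear map as
`D : X → X ⊗ X`. -/
noncomputable def opComul (D : X →ₐ[k] X ⊗[k] X) : Op X →ₐ[k] Op X ⊗[k] Op X :=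
  AlgHom.ofLinearMap (lift₂ (opL k X) ∘ₗ D.toLinearMap ∘ₗ (toOp k X).symm.toLinearMap)
    (by
      change lift₂ (opL k X) (D ((toOp k X).symm 1)) = 1
      rw [toOp_symm_one, map_one, lift₂_one toOp_one])
    (by intro x y; simp [op₂_mul, toOp_symm_mul])

/-- The algebra morphism `X^op → k` with the same underlying linear map as `e : X → k`. -/
noncomputable def opCounit (e : X →ₐ[k] k) : Op X →ₐ[k] k :=
  AlgHom.ofLinearMap (e.toLinearMap ∘ₗ (toOp k X).symm.toLinearMap)
    (by simp [toOp_symm_one]) (by intro x y; simp [toOp_symm_mul, mul_comm])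

theorem opComul_op (D : X →ₐ[k] X ⊗[k] X) (x : X) :
    opComul D (opL k X x) = lift₂ (opL k X) (D x) := rfl

theorem opCounit_op (e : X →ₐ[k] k) (x : X) : opCounit e (opL k X x) = e x := rfl

end Opposite

/-- The quasi-bialgebra `H^op`: opposite multiplication, and `Φ_op = Φ⁻¹`. -/
noncomputable def QuasiBialgebra.op {H : Type*} [Ring H] [Algebra k H]
    (Q : QuasiBialgebra k H) : QuasiBialgebra k (Op H) where
  Δ := opComul Q.Δ
  ε := opCounit Q.ε
  Φ :=
    { val := lift₃ (opL k H) (↑Q.Φ⁻¹ : H ⊗[k] (H ⊗[k] H))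
      inv := lift₃ (opL k H) (Q.Φ : H ⊗[k] (H ⊗[k] H))
      val_inv := by rw [← op₃_mul, Units.mul_inv, lift₃_one toOp_one]
      inv_val := by rw [← op₃_mul, Units.inv_mul, lift₃_one toOp_one] }
  coassoc := by
    intro h
    obtain ⟨h, rfl⟩ : ∃ x, h = opL k H x := ⟨(toOp k H).symm h, rfl⟩
    change _ = lift₃ (opL k H) _ * _ * lift₃ (opL k H) _
    rw [opComul_op, lift_onSnd (opComul_op _), lift_splitFst (opComul_op _), Q.coassoc, op₃_mul,
      op₃_mul, mul_assoc]
  counit_right := by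
    intro h
    obtain ⟨h, rfl⟩ : ∃ x, h = opL k H x := ⟨(toOp k H).symm h, rfl⟩
    rw [opComul_op, lift_dropSnd (opCounit_op _), Q.counit_right]
  counit_left := by
    intro h
    obtain ⟨h, rfl⟩ : ∃ x, h = opL k H x := ⟨(toOp k H).symm h, rfl⟩
    rw [opComul_op, lift_dropFst (opCounit_op _), Q.counit_left]
  pentagon := by
    change padLeft (Op H) (lift₃ (opL k H) (↑Q.Φ⁻¹ : H ⊗[k] (H ⊗[k] H))) * _ * _ = _
    rw [lift_padLeft toOp_one, lift_padRight toOp_one, lift_onSnd_splitFst (opComul_op _),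
      lift_onSnd_onSnd (opComul_op _), lift_splitFst₃ (opComul_op _), ← op₄_mul, ← op₄_mul,
      ← op₄_mul, Q.pentagon_inv]
  Φ_counit := by
    change onSnd (Op H) (dropFst (Op H) (opCounit Q.ε))
      (lift₃ (opL k H) (↑Q.Φ⁻¹ : H ⊗[k] (H ⊗[k] H))) = 1
    rw [lift_onSnd_dropFst (opCounit_op _), Q.Φ_inv_counit, lift₂_one toOp_one]

theorem mul_swap {R : Type*} [Ring R] (a b c d : R) (h : b * c = c * b) :
    a * b * (c * d) = a * c * (b * d) := by
  rw [mul_assoc, ← mul_assoc b, h, mul_assoc, mul_assoc]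

section TensorQuasi

variable {H K : Type*} [Ring H] [Algebra k H] [Ring K] [Algebra k K]

/-- The comultiplication `h ⊗ l ↦ (h₁ ⊗ l₁) ⊗ (h₂ ⊗ l₂)` of the tensor product. -/
noncomputable def tensorComul (D : H →ₐ[k] H ⊗[k] H) (E : K →ₐ[k] K ⊗[k] K) :
    H ⊗[k] K →ₐ[k] (H ⊗[k] K) ⊗[k] (H ⊗[k] K) :=
  (Algebra.TensorProduct.tensorTensorTensorComm k k k k H H K K).toAlgHom.comp
    (Algebra.TensorProduct.map D E)

/-- The counit `h ⊗ l ↦ ε(h) ε(l)` of the tensor product. -/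
noncomputable def tensorCounit (d : H →ₐ[k] k) (e : K →ₐ[k] k) : H ⊗[k] K →ₐ[k] k :=
  (Algebra.TensorProduct.lid k k).toAlgHom.comp (Algebra.TensorProduct.map d e)

variable (k H K) in
/-- `h ↦ h ⊗ 1`. -/
noncomputable abbrev inl : H →ₗ[k] H ⊗[k] K :=
  (Algebra.TensorProduct.includeLeft : H →ₐ[k] H ⊗[k] K).toLinearMap

variable (k H K) in
/-- `l ↦ 1 ⊗ l`. -/
noncomputable abbrev inr : K →ₗ[k] H ⊗[k] K :=
  (Algebra.TensorProduct.includeRight : K →ₐ[k] H ⊗[k] K).toLinearMap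

/-- The quasi-bialgebra structure on an algebra `T` that is generated by the images of two
commuting morphisms `i : H → T` and `j : K → T` compatible with the comultiplications and
counits; its reassociator is `i(X¹) j(Y¹) ⊗ i(X²) j(Y²) ⊗ i(X³) j(Y³)`. -/
noncomputable def QuasiBialgebra.ofCommuting {T : Type*} [Ring T] [Algebra k T]
    (Q : QuasiBialgebra k H) (R : QuasiBialgebra k K) (i : H →ₗ[k] T) (j : K →ₗ[k] T)
    (hi1 : i 1 = 1) (hj1 : j 1 = 1) (hi : ∀ a b, i (a * b) = i a * i b)
    (hj : ∀ a b, j (a * b) = j a * j b) (hij : ∀ a b, i a * j b = j b * i a)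
    (D : T →ₐ[k] T ⊗[k] T) (e : T →ₐ[k] k)
    (hDi : ∀ a, D (i a) = lift₂ i (Q.Δ a)) (hDj : ∀ a, D (j a) = lift₂ j (R.Δ a))
    (hei : ∀ a, e (i a) = Q.ε a) (hej : ∀ a, e (j a) = R.ε a)
    (ind : ∀ P : T → Prop, P 0 → (∀ a b, P a → P b → P (a + b)) →
      (∀ a b, P (i a * j b)) → ∀ t, P t) : QuasiBialgebra k T :=
  have hi₂ : ∀ a b, lift₂ i (a * b) = lift₂ i a * lift₂ i b := map_mul' _ _ hi hi
  have hi₃ : ∀ a b, lift₃ i (a * b) = lift₃ i a * lift₃ i b := map_mul' _ _ hi hi₂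
  have hi₄ : ∀ a b, lift₄ i (a * b) = lift₄ i a * lift₄ i b := map_mul' _ _ hi hi₃
  have hj₂ : ∀ a b, lift₂ j (a * b) = lift₂ j a * lift₂ j b := map_mul' _ _ hj hj
  have hj₃ : ∀ a b, lift₃ j (a * b) = lift₃ j a * lift₃ j b := map_mul' _ _ hj hj₂
  have hj₄ : ∀ a b, lift₄ j (a * b) = lift₄ j a * lift₄ j b := map_mul' _ _ hj hj₃
  have c₂ : ∀ a b, lift₂ i a * lift₂ j b = lift₂ j b * lift₂ i a := map_comm _ _ _ _ hij hij
  have c₃ : ∀ a b, lift₃ i a * lift₃ j b = lift₃ j b * lift₃ i a := map_comm _ _ _ _ hij c₂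
  have c₄ : ∀ a b, lift₄ i a * lift₄ j b = lift₄ j b * lift₄ i a := map_comm _ _ _ _ hij c₃
  { Δ := D
    ε := e
    Φ :=
      { val := lift₃ i (Q.Φ : H ⊗[k] (H ⊗[k] H)) * lift₃ j (R.Φ : K ⊗[k] (K ⊗[k] K))
        inv := lift₃ i (↑Q.Φ⁻¹ : H ⊗[k] (H ⊗[k] H)) * lift₃ j (↑R.Φ⁻¹ : K ⊗[k] (K ⊗[k] K))
        val_inv := by
          rw [mul_assoc, ← mul_assoc (lift₃ j _), ← c₃, mul_assoc, ← hj₃, ← mul_assoc, ← hi₃,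
            Units.mul_inv, Units.mul_inv, lift₃_one hi1, lift₃_one hj1, one_mul]
        inv_val := by
          rw [mul_assoc, ← mul_assoc (lift₃ j _), ← c₃, mul_assoc, ← hj₃, ← mul_assoc, ← hi₃,
            Units.inv_mul, Units.inv_mul, lift₃_one hi1, lift₃_one hj1, one_mul] }
    coassoc := by
      change ∀ t, _ = (lift₃ i _ * lift₃ j _) * _ * (lift₃ i _ * lift₃ j _)
      have key₃ : ∀ a a' b b', (lift₃ i a * lift₃ j b) * (lift₃ i a' * lift₃ j b')
          = lift₃ i (a * a') * lift₃ j (b * b') := by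
        intro a a' b b'
        rw [hi₃, hj₃]
        exact mul_swap _ _ _ _ (c₃ _ _).symm
      refine ind _ ?_ ?_ ?_
      · simp only [map_zero, mul_zero, zero_mul]
      · intro a b ha hb
        rw [map_add, map_add, map_add, mul_add, add_mul, ha, hb]
      · intro a b
        rw [map_mul, map_mul, map_mul, hDi, hDj, lift_onSnd hDi, lift_onSnd hDj,
          lift_splitFst hDi, lift_splitFst hDj, key₃, key₃, ← Q.coassoc,
          ← R.coassoc]
    counit_right := by
      refine ind _ ?_ ?_ ?_
      · simp only [map_zero]
      · intro a b ha hb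
        rw [map_add, map_add, ha, hb]
      · intro a b
        rw [map_mul, map_mul, hDi, hDj, lift_dropSnd hei, lift_dropSnd hej, Q.counit_right,
          R.counit_right]
    counit_left := by
      refine ind _ ?_ ?_ ?_
      · simp only [map_zero]
      · intro a b ha hb
        rw [map_add, map_add, ha, hb]
      · intro a b
        rw [map_mul, map_mul, hDi, hDj, lift_dropFst hei, lift_dropFst hej, Q.counit_left,
          R.counit_left]
    pentagon := by
      change padLeft T (lift₃ i _ * lift₃ j _) * onSnd T _ (lift₃ i _ * lift₃ j _)
        * padRight T (lift₃ i _ * lift₃ j _) = onSnd T _ (lift₃ i _ * lift₃ j _)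
        * splitFst _ _ (lift₃ i _ * lift₃ j _)
      rw [map_mul, map_mul, map_mul, map_mul, map_mul, lift_padLeft hi1, lift_padLeft hj1,
        lift_padRight hi1, lift_padRight hj1, lift_onSnd_splitFst hDi, lift_onSnd_splitFst hDj,
        lift_onSnd_onSnd hDi, lift_onSnd_onSnd hDj, lift_splitFst₃ hDi, lift_splitFst₃ hDj]
      have key : ∀ a a' b b', (lift₄ i a * lift₄ j b) * (lift₄ i a' * lift₄ j b')
          = lift₄ i (a * a') * lift₄ j (b * b') := by
        intro a a' b b'
        rw [hi₄, hj₄]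
        exact mul_swap _ _ _ _ (c₄ _ _).symm
      rw [key, key, key, Q.pentagon, R.pentagon]
    Φ_counit := by
      change onSnd T _ (lift₃ i _ * lift₃ j _) = 1
      rw [map_mul, lift_onSnd_dropFst hei, lift_onSnd_dropFst hej, Q.Φ_counit, R.Φ_counit,
        lift₂_one hi1, lift₂_one hj1, one_mul] }

theorem tensorComul_inl (D : H →ₐ[k] H ⊗[k] H) (E : K →ₐ[k] K ⊗[k] K) (a : H) :
    tensorComul D E (inl k H K a) = lift₂ (inl k H K) (D a) := by
  change (TensorProduct.tensorTensorTensorComm k H H K K) (D a ⊗ₜ E 1) = _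
  rw [map_one]
  induction D a with
  | zero => simp
  | add x y hx hy => simp only [TensorProduct.add_tmul, map_add, hx, hy]
  | tmul x y => rfl

theorem tensorComul_inr (D : H →ₐ[k] H ⊗[k] H) (E : K →ₐ[k] K ⊗[k] K) (a : K) :
    tensorComul D E (inr k H K a) = lift₂ (inr k H K) (E a) := by
  change (TensorProduct.tensorTensorTensorComm k H H K K) (D 1 ⊗ₜ E a) = _
  rw [map_one]
  induction E a with
  | zero => simp
  | add x y hx hy => simp only [TensorProduct.tmul_add, map_add, hx, hy]
  | tmul x y => rfl

/-- The quasi-bialgebra `H ⊗ K`, with reassociator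
`(X¹ ⊗ Y¹) ⊗ (X² ⊗ Y²) ⊗ (X³ ⊗ Y³)`. -/
noncomputable def QuasiBialgebra.tensor (Q : QuasiBialgebra k H) (R : QuasiBialgebra k K) :
    QuasiBialgebra k (H ⊗[k] K) :=
  QuasiBialgebra.ofCommuting Q R (inl k H K) (inr k H K) rfl rfl (by simp) (by simp)
    (by simp) (tensorComul Q.Δ R.Δ) (tensorCounit Q.ε R.ε) (tensorComul_inl _ _)
    (tensorComul_inr _ _) (by intro a; simp [tensorCounit]) (by intro a; simp [tensorCounit])
    (by
      intro P h0 ha h t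
      induction t with
      | zero => exact h0
      | add x y hx hy => exact ha _ _ hx hy
      | tmul x y => simpa using h x y)

end TensorQuasi

end OpTensor

/-! ### Comodule algebras and bicomodule algebras -/

section Comodule

variable {k H : Type*} [Field k] [Ring H] [Algebra k H]

/-- Right `H`-comodule algebra structures on the algebra `A`. -/
structure RightComoduleAlgebra (Q : QuasiBialgebra k H) (A : Type*) [Ring A] [Algebra k A] where
  ρ : A →ₐ[k] A ⊗[k] H
  Φρ : (A ⊗[k] (H ⊗[k] H))ˣ
  /-- `Φ_ρ (ρ ⊗ id)(ρ(a)) = (id ⊗ Δ)(ρ(a)) Φ_ρ` -/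
  coassoc : ∀ a : A,
    (Φρ : A ⊗[k] (H ⊗[k] H)) * splitFst H ρ (ρ a) = onSnd A Q.Δ (ρ a) * (Φρ : A ⊗[k] (H ⊗[k] H))
  /-- `(1 ⊗ Φ)(id ⊗ Δ ⊗ id)(Φ_ρ)(Φ_ρ ⊗ 1) = (id ⊗ id ⊗ Δ)(Φ_ρ)(ρ ⊗ id ⊗ id)(Φ_ρ)` -/
  pentagon :
    padLeft A (Q.Φ : H ⊗[k] (H ⊗[k] H)) * onSnd A (splitFst H Q.Δ) (Φρ : A ⊗[k] (H ⊗[k] H))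
        * padRight H (Φρ : A ⊗[k] (H ⊗[k] H))
      = onSnd A (onSnd H Q.Δ) (Φρ : A ⊗[k] (H ⊗[k] H))
        * splitFst (H ⊗[k] H) ρ (Φρ : A ⊗[k] (H ⊗[k] H))
  counit : ∀ a : A, dropSnd A Q.ε (ρ a) = a
  /-- `(id ⊗ ε ⊗ id)(Φ_ρ) = 1` -/
  Φρ_counit_mid : onSnd A (dropFst H Q.ε) (Φρ : A ⊗[k] (H ⊗[k] H)) = 1
  /-- `(id ⊗ id ⊗ ε)(Φ_ρ) = 1` -/
  Φρ_counit_right : onSnd A (dropSnd H Q.ε) (Φρ : A ⊗[k] (H ⊗[k] H)) = 1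

/-- Left `H`-comodule algebra structures on the algebra `B`. -/
structure LeftComoduleAlgebra (Q : QuasiBialgebra k H) (B : Type*) [Ring B] [Algebra k B] where
  lam : B →ₐ[k] H ⊗[k] B
  Φlam : (H ⊗[k] (H ⊗[k] B))ˣ
  /-- `(id ⊗ λ)(λ(b)) Φ_λ = Φ_λ (Δ ⊗ id)(λ(b))` -/
  coassoc : ∀ b : B,
    onSnd H lam (lam b) * (Φlam : H ⊗[k] (H ⊗[k] B))
      = (Φlam : H ⊗[k] (H ⊗[k] B)) * splitFst B Q.Δ (lam b)
  /-- `(1 ⊗ Φ_λ)(id ⊗ Δ ⊗ id)(Φ_λ)(Φ ⊗ 1) = (id ⊗ id ⊗ λ)(Φ_λ)(Δ ⊗ id ⊗ id)(Φ_λ)` -/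
  pentagon :
    padLeft H (Φlam : H ⊗[k] (H ⊗[k] B)) * onSnd H (splitFst B Q.Δ) (Φlam : H ⊗[k] (H ⊗[k] B))
        * padRight B (Q.Φ : H ⊗[k] (H ⊗[k] H))
      = onSnd H (onSnd H lam) (Φlam : H ⊗[k] (H ⊗[k] B))
        * splitFst (H ⊗[k] B) Q.Δ (Φlam : H ⊗[k] (H ⊗[k] B))
  counit : ∀ b : B, dropFst B Q.ε (lam b) = b
  /-- `(id ⊗ ε ⊗ id)(Φ_λ) = 1` -/
  Φlam_counit_mid : onSnd H (dropFst B Q.ε) (Φlam : H ⊗[k] (H ⊗[k] B)) = 1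
  /-- `(ε ⊗ id ⊗ id)(Φ_λ) = 1` -/
  Φlam_counit_left : dropFst (H ⊗[k] B) Q.ε (Φlam : H ⊗[k] (H ⊗[k] B)) = 1

/-- `H`-bicomodule algebra structures on the algebra `A`. -/
structure BicomoduleAlgebra (Q : QuasiBialgebra k H) (A : Type*) [Ring A] [Algebra k A] where
  left : LeftComoduleAlgebra Q A
  right : RightComoduleAlgebra Q A
  /-- the element `Φ_{λ,ρ} = Θ¹ ⊗ Θ² ⊗ Θ³` -/
  Θ : (H ⊗[k] (A ⊗[k] H))ˣ
  /-- `Φ_{λ,ρ} (λ ⊗ id)(ρ(u)) = (id ⊗ ρ)(λ(u)) Φ_{λ,ρ}` -/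
  compat : ∀ u : A,
    (Θ : H ⊗[k] (A ⊗[k] H)) * splitFst H left.lam (right.ρ u)
      = onSnd H right.ρ (left.lam u) * (Θ : H ⊗[k] (A ⊗[k] H))
  /-- `(1 ⊗ Φ_{λ,ρ})(id ⊗ λ ⊗ id)(Φ_{λ,ρ})(Φ_λ ⊗ 1)
  = (id ⊗ id ⊗ ρ)(Φ_λ)(Δ ⊗ id ⊗ id)(Φ_{λ,ρ})` -/
  pentagon_left :
    padLeft H (Θ : H ⊗[k] (A ⊗[k] H)) * onSnd H (splitFst H left.lam) (Θ : H ⊗[k] (A ⊗[k] H))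
        * padRight H (left.Φlam : H ⊗[k] (H ⊗[k] A))
      = onSnd H (onSnd H right.ρ) (left.Φlam : H ⊗[k] (H ⊗[k] A))
        * splitFst (A ⊗[k] H) Q.Δ (Θ : H ⊗[k] (A ⊗[k] H))
  /-- `(1 ⊗ Φ_ρ)(id ⊗ ρ ⊗ id)(Φ_{λ,ρ})(Φ_{λ,ρ} ⊗ 1)
  = (id ⊗ id ⊗ Δ)(Φ_{λ,ρ})(λ ⊗ id ⊗ id)(Φ_ρ)` -/
  pentagon_right :
    padLeft H (right.Φρ : A ⊗[k] (H ⊗[k] H))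
        * onSnd H (splitFst H right.ρ) (Θ : H ⊗[k] (A ⊗[k] H))
        * padRight H (Θ : H ⊗[k] (A ⊗[k] H))
      = onSnd H (onSnd A Q.Δ) (Θ : H ⊗[k] (A ⊗[k] H))
        * splitFst (H ⊗[k] H) left.lam (right.Φρ : A ⊗[k] (H ⊗[k] H))

end Comodule

/-! ### Module coalgebras and bimodule coalgebras

An action of an algebra `X` on a vector space `V` is an algebra morphism
`X → End_k(V)`; a right action of `H` is a left action of `H^op`. -/

section Coalgebra

variable {k H : Type*} [Field k] [Ring H] [Algebra k H]

/-- Left `H`-module coalgebra structures on the vector space `C`: coalgebras in the monoidal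
category of left `H`-modules. -/
structure LeftModuleCoalgebra (Q : QuasiBialgebra k H) (C : Type*) [AddCommGroup C] [Module k C]
    where
  act : H →ₐ[k] Module.End k C
  Δ : C →ₗ[k] C ⊗[k] C
  ε : C →ₗ[k] k
  /-- `Φ · (Δ ⊗ id)(Δ(c)) = (id ⊗ Δ)(Δ(c))` -/
  coassoc : ∀ c : C,
    tensorAct act.toLinearMap (tensorAct act.toLinearMap act.toLinearMap)
        (Q.Φ : H ⊗[k] (H ⊗[k] H)) (splitFstLin C Δ (Δ c))
      = TensorProduct.map LinearMap.id Δ (Δ c)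
  /-- `Δ(h · c) = h₁ · c₁ ⊗ h₂ · c₂` -/
  Δ_act : ∀ (h : H) (c : C),
    Δ (act h c) = tensorAct act.toLinearMap act.toLinearMap (Q.Δ h) (Δ c)
  ε_act : ∀ (h : H) (c : C), ε (act h c) = Q.ε h * ε c
  counit_left : ∀ c : C, TensorProduct.lid k C (TensorProduct.map ε LinearMap.id (Δ c)) = c
  counit_right : ∀ c : C, TensorProduct.rid k C (TensorProduct.map LinearMap.id ε (Δ c)) = c

/-- `H`-bimodule coalgebra structures on the vector space `C`: coalgebras in the monoidal
category of `H`-bimodules. -/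
structure BimoduleCoalgebra (Q : QuasiBialgebra k H) (C : Type*) [AddCommGroup C] [Module k C]
    where
  /-- the left action `h · c` -/
  lact : H →ₐ[k] Module.End k C
  /-- the right action `c · h` -/
  ractOp : Op H →ₐ[k] Module.End k C
  bimod : ∀ (x : H) (y : Op H), Commute (ractOp y) (lact x)
  Δ : C →ₗ[k] C ⊗[k] C
  ε : C →ₗ[k] k
  /-- `Φ · (Δ ⊗ id)(Δ(c)) · Φ⁻¹ = (id ⊗ Δ)(Δ(c))` -/
  coassoc : ∀ c : C,
    tensorAct lact.toLinearMap (tensorAct lact.toLinearMap lact.toLinearMap)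
        (Q.Φ : H ⊗[k] (H ⊗[k] H))
        (tensorAct (ractOp.toLinearMap ∘ₗ opL k H)
          (tensorAct (ractOp.toLinearMap ∘ₗ opL k H) (ractOp.toLinearMap ∘ₗ opL k H))
          (↑Q.Φ⁻¹ : H ⊗[k] (H ⊗[k] H)) (splitFstLin C Δ (Δ c)))
      = TensorProduct.map LinearMap.id Δ (Δ c)
  /-- `Δ(h · c) = h₁ · c₁ ⊗ h₂ · c₂` -/
  Δ_lact : ∀ (h : H) (c : C),
    Δ (lact h c) = tensorAct lact.toLinearMap lact.toLinearMap (Q.Δ h) (Δ c)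
  /-- `Δ(c · h) = c₁ · h₁ ⊗ c₂ · h₂` -/
  Δ_ract : ∀ (h : H) (c : C),
    Δ (ractOp (toOp k H h) c)
      = tensorAct (ractOp.toLinearMap ∘ₗ opL k H) (ractOp.toLinearMap ∘ₗ opL k H) (Q.Δ h) (Δ c)
  ε_lact : ∀ (h : H) (c : C), ε (lact h c) = Q.ε h * ε c
  ε_ract : ∀ (h : H) (c : C), ε (ractOp (toOp k H h) c) = ε c * Q.ε h
  counit_left : ∀ c : C, TensorProduct.lid k C (TensorProduct.map ε LinearMap.id (Δ c)) = c
  counit_right : ∀ c : C, TensorProduct.rid k C (TensorProduct.map LinearMap.id ε (Δ c)) = c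

theorem tensorAct_map {P Q P' Q' V W M N : Type*}
    [AddCommGroup P] [Module k P] [AddCommGroup Q] [Module k Q]
    [AddCommGroup P'] [Module k P'] [AddCommGroup Q'] [Module k Q']
    [AddCommGroup V] [Module k V] [AddCommGroup W] [Module k W]
    [AddCommGroup M] [Module k M] [AddCommGroup N] [Module k N]
    (f : P →ₗ[k] (V →ₗ[k] M)) (g : Q →ₗ[k] (W →ₗ[k] N)) (τ : P' →ₗ[k] P) (σ : Q' →ₗ[k] Q)
    (t : P' ⊗[k] Q') :
    tensorAct f g (TensorProduct.map τ σ t) = tensorAct (f ∘ₗ τ) (g ∘ₗ σ) t := by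
  induction t with
  | zero => simp
  | add a b ha hb => simp only [map_add, ha, hb]
  | tmul a b => rfl

theorem tensorAct_mul {X Y V W : Type*} [Ring X] [Algebra k X] [Ring Y] [Algebra k Y]
    [AddCommGroup V] [Module k V] [AddCommGroup W] [Module k W]
    (f : X →ₗ[k] Module.End k V) (g : Y →ₗ[k] Module.End k W)
    (hf : ∀ a b, f (a * b) = f a ∘ₗ f b) (hg : ∀ a b, g (a * b) = g a ∘ₗ g b)
    (s t : X ⊗[k] Y) : tensorAct f g (s * t) = tensorAct f g s ∘ₗ tensorAct f g t := by
  induction s with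
  | zero => simp
  | add a b ha hb => rw [add_mul, map_add, ha, hb, map_add, LinearMap.add_comp]
  | tmul a b =>
    induction t with
    | zero => simp
    | add c d hc hd => rw [mul_add, map_add, hc, hd, map_add, LinearMap.comp_add]
    | tmul c d =>
      rw [Algebra.TensorProduct.tmul_mul_tmul, tensorAct_tmul, tensorAct_tmul, tensorAct_tmul,
        hf, hg, TensorProduct.map_comp]

theorem tensorAct_comm {X Y X' Y' V W : Type*} [AddCommGroup X] [Module k X] [AddCommGroup Y]
    [Module k Y] [AddCommGroup X'] [Module k X'] [AddCommGroup Y'] [Module k Y']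
    [AddCommGroup V] [Module k V] [AddCommGroup W] [Module k W]
    (f : X →ₗ[k] Module.End k V) (g : Y →ₗ[k] Module.End k W)
    (f' : X' →ₗ[k] Module.End k V) (g' : Y' →ₗ[k] Module.End k W)
    (hf : ∀ a b, f a ∘ₗ f' b = f' b ∘ₗ f a) (hg : ∀ a b, g a ∘ₗ g' b = g' b ∘ₗ g a)
    (s : X ⊗[k] Y) (t : X' ⊗[k] Y') :
    tensorAct f g s ∘ₗ tensorAct f' g' t = tensorAct f' g' t ∘ₗ tensorAct f g s := by
  induction s with
  | zero => simp
  | add a b ha hb => rw [map_add, LinearMap.add_comp, ha, hb, LinearMap.comp_add]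
  | tmul a b =>
    induction t with
    | zero => simp
    | add c d hc hd => rw [map_add, LinearMap.comp_add, hc, hd, LinearMap.add_comp]
    | tmul c d =>
      rw [tensorAct_tmul, tensorAct_tmul, ← TensorProduct.map_comp, ← TensorProduct.map_comp,
        hf, hg]

namespace BimoduleCoalgebra

variable {Q : QuasiBialgebra k H} {C : Type*} [AddCommGroup C] [Module k C]
  (D : BimoduleCoalgebra Q C)

/-- The right action `h ↦ (c ↦ c · h)`, as a linear map. -/
noncomputable abbrev ract : H →ₗ[k] Module.End k C := D.ractOp.toLinearMap ∘ₗ opL k H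

/-- The left `H^op ⊗ H`-action `(h ⊗ h') · c = h' · c · h`. -/
noncomputable def opTensorAct : Op H ⊗[k] H →ₐ[k] Module.End k C :=
  Algebra.TensorProduct.lift D.ractOp D.lact (fun y x => D.bimod x y)

theorem opTensorAct_comp_inl :
    D.opTensorAct.toLinearMap ∘ₗ inl k (Op H) H ∘ₗ opL k H = D.ract := by
  ext x c
  simp [opTensorAct]

theorem opTensorAct_comp_inr : D.opTensorAct.toLinearMap ∘ₗ inr k (Op H) H
    = D.lact.toLinearMap := by
  ext x c
  simp [opTensorAct]

theorem opTensorAct_inl (x : H) : D.opTensorAct (inl k (Op H) H (opL k H x)) = D.ract x :=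
  LinearMap.congr_fun D.opTensorAct_comp_inl x

theorem opTensorAct_inr (x : H) : D.opTensorAct (inr k (Op H) H x) = D.lact x :=
  LinearMap.congr_fun D.opTensorAct_comp_inr x

theorem op_tensor_ind {P : Op H ⊗[k] H → Prop} (h0 : P 0)
    (ha : ∀ a b, P a → P b → P (a + b))
    (h : ∀ a b : H, P (inl k (Op H) H (opL k H a) * inr k (Op H) H b)) (t : Op H ⊗[k] H) :
    P t := by
  induction t with
  | zero => exact h0
  | add x y hx hy => exact ha _ _ hx hy
  | tmul x y =>
    have := h ((toOp k H).symm x) y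
    simpa using this

theorem opTensor_mul₁ (a b : Op H ⊗[k] H) : D.opTensorAct.toLinearMap (a * b)
    = D.opTensorAct.toLinearMap a ∘ₗ D.opTensorAct.toLinearMap b := by
  change D.opTensorAct (a * b) = _
  rw [map_mul]; rfl

theorem opTensor_mul₂ (a b : (Op H ⊗[k] H) ⊗[k] (Op H ⊗[k] H)) :
    tensorAct D.opTensorAct.toLinearMap D.opTensorAct.toLinearMap (a * b)
      = tensorAct D.opTensorAct.toLinearMap D.opTensorAct.toLinearMap a
        ∘ₗ tensorAct D.opTensorAct.toLinearMap D.opTensorAct.toLinearMap b :=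
  tensorAct_mul _ _ D.opTensor_mul₁ D.opTensor_mul₁ a b

theorem act₂_inl (t : H ⊗[k] H) :
    tensorAct D.opTensorAct.toLinearMap D.opTensorAct.toLinearMap
        (lift₂ (inl k (Op H) H) (lift₂ (opL k H) t)) = tensorAct D.ract D.ract t := by
  rw [lift₂, lift₂, tensorAct_map, tensorAct_map, LinearMap.comp_assoc, opTensorAct_comp_inl]

theorem act₂_inr (t : H ⊗[k] H) :
    tensorAct D.opTensorAct.toLinearMap D.opTensorAct.toLinearMap
        (lift₂ (inr k (Op H) H) t) = tensorAct D.lact.toLinearMap D.lact.toLinearMap t := by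
  rw [lift₂, tensorAct_map, opTensorAct_comp_inr]

theorem act₃_inl (t : H ⊗[k] (H ⊗[k] H)) :
    tensorAct D.opTensorAct.toLinearMap
        (tensorAct D.opTensorAct.toLinearMap D.opTensorAct.toLinearMap)
        (lift₃ (inl k (Op H) H) (lift₃ (opL k H) t))
      = tensorAct D.ract (tensorAct D.ract D.ract) t := by
  rw [lift₃, lift₃, tensorAct_map, tensorAct_map, LinearMap.comp_assoc, opTensorAct_comp_inl]
  congr 2
  exact LinearMap.ext fun s => D.act₂_inl s

theorem act₃_inr (t : H ⊗[k] (H ⊗[k] H)) :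
    tensorAct D.opTensorAct.toLinearMap
        (tensorAct D.opTensorAct.toLinearMap D.opTensorAct.toLinearMap)
        (lift₃ (inr k (Op H) H) t)
      = tensorAct D.lact.toLinearMap (tensorAct D.lact.toLinearMap D.lact.toLinearMap) t := by
  rw [lift₃, tensorAct_map, opTensorAct_comp_inr]
  congr 2
  exact LinearMap.ext fun s => D.act₂_inr s

/-- An `H`-bimodule coalgebra, viewed as a left `H^op ⊗ H`-module coalgebra through
`(h ⊗ h') · c = h' · c · h`. -/
noncomputable def toOpTensor : LeftModuleCoalgebra (Q.op.tensor Q) C where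
  act := D.opTensorAct
  Δ := D.Δ
  ε := D.ε
  coassoc := by
    intro c
    change tensorAct _ _ (lift₃ (inl k (Op H) H) (lift₃ (opL k H)
      (↑Q.Φ⁻¹ : H ⊗[k] (H ⊗[k] H))) * lift₃ (inr k (Op H) H) (Q.Φ : H ⊗[k] (H ⊗[k] H))) _ = _
    rw [tensorAct_mul _ _ D.opTensor_mul₁ D.opTensor_mul₂, act₃_inl, act₃_inr]
    have h1 : ∀ (a b : H), D.ract a ∘ₗ D.lact.toLinearMap b
        = D.lact.toLinearMap b ∘ₗ D.ract a := fun a b => D.bimod b _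
    rw [tensorAct_comm _ _ _ _ h1 (tensorAct_comm _ _ _ _ h1 h1)]
    exact D.coassoc c
  Δ_act := by
    intro t
    induction t using op_tensor_ind (k := k) with
    | h0 => intro c; simp
    | ha a b ha hb =>
      intro c
      rw [map_add, map_add, map_add, LinearMap.add_apply, LinearMap.add_apply, map_add, ha, hb]
    | h a b =>
      intro c
      rw [map_mul, map_mul, opTensor_mul₂, opTensorAct_inl, opTensorAct_inr]
      change D.Δ (D.ract a (D.lact b c)) = tensorAct _ _ (tensorComul Q.op.Δ Q.Δ _)
        (tensorAct _ _ (tensorComul Q.op.Δ Q.Δ _) _)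
      rw [tensorComul_inl, tensorComul_inr]
      have e : Q.op.Δ (opL k H a) = lift₂ (opL k H) (Q.Δ a) := rfl
      rw [LinearMap.comp_apply, e, act₂_inl, act₂_inr, ← D.Δ_lact, ← D.Δ_ract]
      rfl
  ε_act := by
    intro t
    induction t using op_tensor_ind (k := k) with
    | h0 => intro c; simp
    | ha a b ha hb =>
      intro c
      rw [map_add, map_add, LinearMap.add_apply, map_add, ha, hb, add_mul]
    | h a b =>
      intro c
      rw [map_mul, map_mul, opTensorAct_inl, opTensorAct_inr]
      change D.ε (D.ractOp (toOp k H a) (D.lact b c)) = _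
      rw [D.ε_ract, D.ε_lact]
      have h1 : (Q.op.tensor Q).ε (inl k (Op H) H (opL k H a)) = Q.ε a := by
        change Q.ε a * Q.ε 1 = _
        rw [map_one, mul_one]
      have h2 : (Q.op.tensor Q).ε (inr k (Op H) H b) = Q.ε b := by
        change Q.ε 1 * Q.ε b = _
        rw [map_one, one_mul]
      rw [h1, h2]
      ring
  counit_left := D.counit_left
  counit_right := D.counit_right

end BimoduleCoalgebra

end Coalgebra

/-! ### The elements `p̃_λ` and `q̃_λ`, and the comodule algebra `A²` -/

section Data

variable {k H A : Type*} [Field k] [Ring H] [Algebra k H] [Ring A] [Algebra k A]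
variable (Q : QuasiHopfAlgebra k H)

/-- `x ⊗ y ↦ y S⁻¹(x b)`. -/
noncomputable def QuasiHopfAlgebra.sandInv (b : H) : H ⊗[k] H →ₗ[k] H :=
  LinearMap.mul' k H ∘ₗ (TensorProduct.comm k H H).toLinearMap ∘ₗ
    TensorProduct.map (Q.S.symm.toLinearMap ∘ₗ LinearMap.mulRight k b) LinearMap.id

variable (𝔸 : BicomoduleAlgebra Q.toQuasiBialgebra A)

/-- `p̃_λ = X² S⁻¹(X¹ β) ⊗ X³`, where `Φ_λ = X¹ ⊗ X² ⊗ X³`. -/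
noncomputable def pTilde : H ⊗[k] A :=
  TensorProduct.map (Q.sandInv Q.β) LinearMap.id
    ((TensorProduct.assoc k H H A).symm (𝔸.left.Φlam : H ⊗[k] (H ⊗[k] A)))

/-- `q̃_λ = S(x¹) α x² ⊗ x³`, where `Φ_λ⁻¹ = x¹ ⊗ x² ⊗ x³`. -/
noncomputable def qTilde : H ⊗[k] A :=
  TensorProduct.map (sandL Q.S.toLinearMap Q.α) LinearMap.id
    ((TensorProduct.assoc k H H A).symm (↑𝔸.left.Φlam⁻¹ : H ⊗[k] (H ⊗[k] A)))

/-- The right `H^op ⊗ H`-coaction `u ↦ u_[0]<0> ⊗ (S⁻¹(u_[-1]) ⊗ u_[0]<1>)` of `A²`. -/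
noncomputable def rhoTwo : A →ₐ[k] A ⊗[k] (Op H ⊗[k] H) :=
  (Algebra.TensorProduct.leftComm k (Op H) A H).toAlgHom.comp
    ((Algebra.TensorProduct.map Q.SinvOp 𝔸.right.ρ).comp 𝔸.left.lam)

/-- `a ⊗ b ⊗ u ⊗ c ⊗ d ↦ u ⊗ (S⁻¹(b) ⊗ c) ⊗ (S⁻¹(a) ⊗ d)`. -/
noncomputable def reorder : H ⊗[k] (H ⊗[k] (A ⊗[k] (H ⊗[k] H))) →ₗ[k]
    A ⊗[k] ((Op H ⊗[k] H) ⊗[k] (Op H ⊗[k] H)) :=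
  TensorProduct.map LinearMap.id
      (TensorProduct.tensorTensorTensorComm k (Op H) (Op H) H H).toLinearMap ∘ₗ
    (TensorProduct.leftComm k (Op H ⊗[k] Op H) A (H ⊗[k] H)).toLinearMap ∘ₗ
    TensorProduct.map
      (TensorProduct.map Q.SinvOp.toLinearMap Q.SinvOp.toLinearMap ∘ₗ
        (TensorProduct.comm k H H).toLinearMap) LinearMap.id ∘ₗ
    (TensorProduct.assoc k H H (A ⊗[k] (H ⊗[k] H))).symm.toLinearMap

/-- The reassociator of `A²`: with `Φ_λ⁻¹ = x¹ ⊗ x² ⊗ x³`, `Φ_ρ = Y¹ ⊗ Y² ⊗ Y³`,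
`Φ_{λ,ρ} = Θ¹ ⊗ Θ² ⊗ Θ³` and the Drinfeld twist `f = f¹ ⊗ f²`, it is
`x³_<0> Y¹ Θ²_<0> ⊗ (S⁻¹(f² x² Θ¹) ⊗ (x³_<1>)₁ Y² Θ²_<1>) ⊗ (S⁻¹(f¹ x¹) ⊗ (x³_<1>)₂ Y³ Θ³)`. -/
noncomputable def PhiRhoTwo : A ⊗[k] ((Op H ⊗[k] H) ⊗[k] (Op H ⊗[k] H)) :=
  reorder Q
    (TensorProduct.assoc k H H (A ⊗[k] (H ⊗[k] H)) (Q.drinfeldTwist ⊗ₜ 1)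
      * onSnd H (onSnd H ((onSnd A Q.Δ).comp 𝔸.right.ρ))
          (↑𝔸.left.Φlam⁻¹ : H ⊗[k] (H ⊗[k] A))
      * padLeft H (padLeft H (𝔸.right.Φρ : A ⊗[k] (H ⊗[k] H)))
      * padLeft H (onSnd H (splitFst H 𝔸.right.ρ) (𝔸.Θ : H ⊗[k] (A ⊗[k] H))))

end Data

/-! ### Doi-Hopf modules and generalized Yetter-Drinfeld modules -/

section Modules

variable {k H A C M : Type*} [Field k] [Ring H] [Algebra k H] [Ring A] [Algebra k A]
variable [AddCommGroup C] [Module k C] [AddCommGroup M] [Module k M]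

/-- Left-right Doi-Hopf modules: for a quasi-bialgebra `H`, a right coaction
`ρ : A → A ⊗ H` with reassociator `Φρ`, and a left `H`-module coalgebra `C`, the conditions on
a left `A`-module `M` with a coaction `m ↦ m₀ ⊗ m₁ : M → M ⊗ C`. -/
structure IsDoiHopfModule {Q : QuasiBialgebra k H} (ρ : A →ₐ[k] A ⊗[k] H)
    (Φρ : A ⊗[k] (H ⊗[k] H)) (D : LeftModuleCoalgebra Q C)
    (act : A →ₐ[k] Module.End k M) (coact : M →ₗ[k] M ⊗[k] C) : Prop where
  /-- `ε(m₁) m₀ = m` -/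
  counit : ∀ m : M, TensorProduct.rid k M (TensorProduct.map LinearMap.id D.ε (coact m)) = m
  /-- `Φ_ρ · (ρ_M ⊗ id)(ρ_M(m)) = (id ⊗ Δ)(ρ_M(m))` -/
  coassoc : ∀ m : M,
    tensorAct act.toLinearMap (tensorAct D.act.toLinearMap D.act.toLinearMap) Φρ
        (splitFstLin C coact (coact m))
      = TensorProduct.map LinearMap.id D.Δ (coact m)
  /-- `ρ_M(u · m) = u_<0> · m₀ ⊗ u_<1> · m₁` -/
  coact_act : ∀ (u : A) (m : M),
    coact (act u m) = tensorAct act.toLinearMap D.act.toLinearMap (ρ u) (coact m)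

variable {Q : QuasiBialgebra k H}

/-- `h ⊗ u ↦ (m ↦ (u · m)₀ ⊗ (u · m)₁ · h)`. -/
noncomputable def twistMap (D : BimoduleCoalgebra Q C) (act : A →ₐ[k] Module.End k M)
    (coact : M →ₗ[k] M ⊗[k] C) : H ⊗[k] A →ₗ[k] (M →ₗ[k] M ⊗[k] C) :=
  conjAct (LinearMap.lTensorHom M ∘ₗ D.ract) coact act.toLinearMap

/-- `(h ⊗ h') ⊗ u ↦ (m ↦ (u · m)₀ ⊗ ((u · m)₁)₁ · h ⊗ ((u · m)₁)₂ · h')`. -/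
noncomputable def twistMap₂ (D : BimoduleCoalgebra Q C) (act : A →ₐ[k] Module.End k M)
    (coact : M →ₗ[k] M ⊗[k] C) :
    (H ⊗[k] H) ⊗[k] A →ₗ[k] (M →ₗ[k] M ⊗[k] (C ⊗[k] C)) :=
  conjAct (LinearMap.lTensorHom M ∘ₗ tensorAct D.ract D.ract)
    (TensorProduct.map LinearMap.id D.Δ ∘ₗ coact) act.toLinearMap

/-- Left-right generalized Yetter-Drinfeld modules: the conditions on a left `A`-module `M` with
a coaction `m ↦ m₀ ⊗ m₁ : M → M ⊗ C`. -/
structure IsYetterDrinfeldModule (𝔸 : BicomoduleAlgebra Q A) (D : BimoduleCoalgebra Q C)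
    (act : A →ₐ[k] Module.End k M) (coact : M →ₗ[k] M ⊗[k] C) : Prop where
  /-- `ε(m₁) m₀ = m` -/
  counit : ∀ m : M, TensorProduct.rid k M (TensorProduct.map LinearMap.id D.ε (coact m)) = m
  /-- With `Φ_{λ,ρ}⁻¹ = θ¹ ⊗ θ² ⊗ θ³`, `Φ_λ⁻¹ = x¹ ⊗ x² ⊗ x³` and `Φ_ρ⁻¹ = y¹ ⊗ y² ⊗ y³`:
  `(θ² · m₀)₀ ⊗ (θ² · m₀)₁ · θ¹ ⊗ θ³ · m₁
    = y¹ · (x³ · m)₀ ⊗ y² · ((x³ · m)₁)₁ · x¹ ⊗ y³ · ((x³ · m)₁)₂ · x²` -/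
  coassoc : ∀ m : M,
    TensorProduct.assoc k M C C
        (tensorAct (twistMap D act coact) D.lact.toLinearMap
          ((TensorProduct.assoc k H A H).symm (↑𝔸.Θ⁻¹ : H ⊗[k] (A ⊗[k] H))) (coact m))
      = tensorAct act.toLinearMap (tensorAct D.lact.toLinearMap D.lact.toLinearMap)
          (↑𝔸.right.Φρ⁻¹ : A ⊗[k] (H ⊗[k] H))
          (twistMap₂ D act coact
            ((TensorProduct.assoc k H H A).symm (↑𝔸.left.Φlam⁻¹ : H ⊗[k] (H ⊗[k] A))) m)
  /-- `u_<0> · m₀ ⊗ u_<1> · m₁ = (u_[0] · m)₀ ⊗ (u_[0] · m)₁ · u_[-1]` -/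
  compat : ∀ (u : A) (m : M),
    tensorAct act.toLinearMap D.lact.toLinearMap (𝔸.right.ρ u) (coact m)
      = twistMap D act coact (𝔸.left.lam u) m

end Modules

/-! ### The two categories -/

/-- A left `A`-module with a linear map `M → M ⊗ C`. -/
structure CoactModule (k A C : Type u) [Field k] [Ring A] [Algebra k A] [AddCommGroup C]
    [Module k C] where
  carrier : Type u
  [addCommGroup : AddCommGroup carrier]
  [module : Module k carrier]
  act : A →ₐ[k] Module.End k carrier
  coact : carrier →ₗ[k] carrier ⊗[k] C

attribute [instance] CoactModule.addCommGroup CoactModule.module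

section Categories

variable {k H A C : Type u} [Field k] [Ring H] [Algebra k H] [Ring A] [Algebra k A]
  [AddCommGroup C] [Module k C]

/-- `A`-linear maps that are compatible with the coactions. -/
@[ext] structure CoactModule.Hom (M N : CoactModule k A C) where
  toLin : M.carrier →ₗ[k] N.carrier
  map_act : ∀ (u : A) (m : M.carrier), toLin (M.act u m) = N.act u (toLin m)
  map_coact : ∀ m : M.carrier,
    N.coact (toLin m) = TensorProduct.map toLin LinearMap.id (M.coact m)

/-- The identity. -/
def CoactModule.Hom.refl (M : CoactModule k A C) : CoactModule.Hom M M where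
  toLin := LinearMap.id
  map_act _ _ := rfl
  map_coact m := by rw [TensorProduct.map_id]; rfl

/-- Composition of maps. -/
def CoactModule.Hom.trans {M N P : CoactModule k A C} (f : CoactModule.Hom M N)
    (g : CoactModule.Hom N P) : CoactModule.Hom M P where
  toLin := g.toLin ∘ₗ f.toLin
  map_act u m := by
    rw [LinearMap.comp_apply, f.map_act, g.map_act]; rfl
  map_coact m := by
    rw [LinearMap.comp_apply, g.map_coact, f.map_coact, ← LinearMap.comp_apply,
      ← TensorProduct.map_comp, LinearMap.id_comp]

variable (Q : QuasiHopfAlgebra k H) (𝔸 : BicomoduleAlgebra Q.toQuasiBialgebra A)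
  (D : BimoduleCoalgebra Q.toQuasiBialgebra C)

/-- The objects of the category `_A YD(H)^C`. -/
structure YetterDrinfeldModule extends CoactModule k A C where
  isYetterDrinfeld : IsYetterDrinfeldModule 𝔸 D act coact

/-- The objects of the category `_{A²} M(H^op ⊗ H)^C`. -/
structure DoiHopfModule extends CoactModule k A C where
  isDoiHopf : IsDoiHopfModule (rhoTwo Q 𝔸) (PhiRhoTwo Q 𝔸) D.toOpTensor act coact

instance : Category.{u} (YetterDrinfeldModule Q 𝔸 D) where
  Hom M N := CoactModule.Hom M.toCoactModule N.toCoactModule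
  id M := CoactModule.Hom.refl M.toCoactModule
  comp f g := f.trans g

instance : Category.{u} (DoiHopfModule Q 𝔸 D) where
  Hom M N := CoactModule.Hom M.toCoactModule N.toCoactModule
  id M := CoactModule.Hom.refl M.toCoactModule
  comp f g := f.trans g

/-- `m ↦ (p̃² · m)₀ ⊗ (p̃² · m)₁ · p̃¹`. -/
noncomputable def twistP (M : CoactModule k A C) : M.carrier →ₗ[k] M.carrier ⊗[k] C :=
  twistMap D M.act M.coact (pTilde Q 𝔸)

/-- `m ↦ q̃²_<0> · m₀ ⊗ q̃²_<1> · m₁ · S⁻¹(q̃¹)`. -/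
noncomputable def twistQ (M : CoactModule k A C) : M.carrier →ₗ[k] M.carrier ⊗[k] C :=
  conjAct (LinearMap.lTensorHom M.carrier ∘ₗ D.ract ∘ₗ Q.S.symm.toLinearMap) LinearMap.id
    (tensorAct M.act.toLinearMap D.lact.toLinearMap ∘ₗ 𝔸.right.ρ.toLinearMap) (qTilde Q 𝔸)
    ∘ₗ M.coact

theorem twistP_natural {M N : CoactModule k A C} (f : CoactModule.Hom M N) (m : M.carrier) :
    twistP Q 𝔸 D N (f.toLin m)
      = TensorProduct.map f.toLin LinearMap.id (twistP Q 𝔸 D M m) := by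
  unfold twistP
  induction pTilde Q 𝔸 with
  | zero => simp
  | add x y hx hy => simp only [map_add, LinearMap.add_apply, hx, hy]
  | tmul h u =>
    change LinearMap.lTensor N.carrier (D.ract h) (N.coact (N.act u (f.toLin m)))
      = TensorProduct.map f.toLin LinearMap.id
        (LinearMap.lTensor M.carrier (D.ract h) (M.coact (M.act u m)))
    rw [← f.map_act, f.map_coact]
    induction M.coact (M.act u m) with
    | zero => simp only [map_zero]
    | add x y hx hy => simp only [map_add, hx, hy]
    | tmul x c => rfl

theorem twistQ_natural {M N : CoactModule k A C} (f : CoactModule.Hom M N) (m : M.carrier) :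
    twistQ Q 𝔸 D N (f.toLin m)
      = TensorProduct.map f.toLin LinearMap.id (twistQ Q 𝔸 D M m) := by
  unfold twistQ
  rw [LinearMap.comp_apply, LinearMap.comp_apply, f.map_coact]
  induction qTilde Q 𝔸 with
  | zero => simp
  | add x y hx hy => simp only [map_add, LinearMap.add_apply, hx, hy]
  | tmul h u =>
    change LinearMap.lTensor N.carrier (D.ract (Q.S.symm h))
        (tensorAct N.act.toLinearMap D.lact.toLinearMap (𝔸.right.ρ u) _)
      = TensorProduct.map f.toLin LinearMap.id
        (LinearMap.lTensor M.carrier (D.ract (Q.S.symm h))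
          (tensorAct M.act.toLinearMap D.lact.toLinearMap (𝔸.right.ρ u) _))
    induction 𝔸.right.ρ u with
    | zero => simp only [map_zero, LinearMap.zero_apply]
    | add x y hx hy => simp only [map_add, LinearMap.add_apply, hx, hy]
    | tmul a b =>
      induction M.coact m with
      | zero => simp only [map_zero]
      | add x y hx hy => simp only [map_add, hx, hy]
      | tmul x c =>
        change N.act a (f.toLin x) ⊗ₜ[k] _ = f.toLin (M.act a x) ⊗ₜ[k] _
        rw [f.map_act]
        rfl

variable {Q 𝔸 D}

/-- The functor `(M, ρ_M) ↦ (M, ρ'_M)`, `ρ'_M(m) = (p̃² · m)₀ ⊗ (p̃² · m)₁ · p̃¹`, which leaves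
the `A`-action and the morphisms unchanged. -/
noncomputable def functorF
    (hF : ∀ M : YetterDrinfeldModule Q 𝔸 D, IsDoiHopfModule (rhoTwo Q 𝔸) (PhiRhoTwo Q 𝔸)
      D.toOpTensor M.act (twistP Q 𝔸 D M.toCoactModule)) :
    YetterDrinfeldModule Q 𝔸 D ⥤ DoiHopfModule Q 𝔸 D where
  obj M :=
    { carrier := M.carrier
      act := M.act
      coact := twistP Q 𝔸 D M.toCoactModule
      isDoiHopf := hF M }
  map {M N} (f : CoactModule.Hom M.toCoactModule N.toCoactModule) :=
    { toLin := f.toLin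
      map_act := f.map_act
      map_coact := twistP_natural Q 𝔸 D f }

/-- The functor `(M, ρ_M) ↦ (M, ρ̄_M)`,
`ρ̄_M(m) = q̃²_<0> · m₀ ⊗ q̃²_<1> · m₁ · S⁻¹(q̃¹)`, which leaves the `A`-action and the morphisms
unchanged. -/
noncomputable def functorG
    (hG : ∀ M : DoiHopfModule Q 𝔸 D,
      IsYetterDrinfeldModule 𝔸 D M.act (twistQ Q 𝔸 D M.toCoactModule)) :
    DoiHopfModule Q 𝔸 D ⥤ YetterDrinfeldModule Q 𝔸 D where
  obj M :=
    { carrier := M.carrier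
      act := M.act
      coact := twistQ Q 𝔸 D M.toCoactModule
      isYetterDrinfeld := hG M }
  map {M N} (f : CoactModule.Hom M.toCoactModule N.toCoactModule) :=
    { toLin := f.toLin
      map_act := f.map_act
      map_coact := twistQ_natural Q 𝔸 D f }

end Categories

end QHopf

/-! Let `O` be an action of H ⊗ A ⊗ H on a space V, let M be an A-module and τ : M → V a linear map.
Two kinds of covariance occur. Doi-Hopf covariance says that τ(u · m) is obtained from τ(m) by the
action of u_[-1] ⊗ u_[0]<0> ⊗ u_[0]<1>. Yetter-Drinfeld covariance says that 1 ⊗ ρ(u) applied to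
τ(m) equals S(u_[-1]) applied to τ(u_[0] · m). When V = M ⊗ C and h ⊗ u ⊗ h' sends m ⊗ c to u · m ⊗
h' · c · S⁻¹(h), these are the linearity conditions of the two categories.

The elements q̃ and (S ⊗ id)(p̃) = X¹ β S(X²) ⊗ X³ satisfy two commutation relations (`sandS_qEl`,
`sandSR_pEl`) and two inversion relations (`sandw_qEl_pEl`, `sandSR_pEl_qEl`). Each is a
coassociativity or pentagon identity for Φ_λ in which the antipode axioms collapse all factors but
one. Consequently, for every `O`, applying (id ⊗ ρ)(q̃) and twisting by p̃ are mutually inverse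
bijections between the two kinds of covariant maps. This gives the linearity conditions and both
identities of functors; the counit conditions come from ε(α) = ε(β) = 1.

The remaining point is coassociativity, `coassoc_iff`. Let τ be Doi-Hopf covariant and σ its
q̃-twist. Both sides of Doi-Hopf coassociativity are maps M → M ⊗ C ⊗ C that are covariant for the
diagonal action of H^op ⊗ H on C ⊗ C, so by the same bijection, now with C ⊗ C in place of C, they
agree exactly when their q̃-twists agree. The side containing the comultiplication of C becomes that
comultiplication applied to σ. On the other side, q̃ passes the Drinfeld twist because (S ⊗
S)(Δ^cop(h)) f = f Δ(S(h)) (`SSop_mul_drinfeldTwist`), and `drinfeldTwist_mul_qEl`, which also needs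
f Δ(α) = γ, trades f, Δ(q̃¹) and Φ_λ⁻¹ for two copies of q̃ and Φ_λ. Two copies of q̃ are what
applying σ twice produces, up to Θ⁻¹, which `sandS_qEl_Θ` accounts for. Moving the invertible Φ_λ
and Φ_ρ across leaves Yetter-Drinfeld coassociativity.

For the Grothendieck property, choose a basis I of C. An A-action with a map M → M ⊗ C is the same
as a representation of the free algebra on A ⊔ I in which A acts as an algebra and, at each m, only
finitely many operators from I are nonzero. The Yetter-Drinfeld conditions are natural linear
equations, so they and the finiteness pass to submodules and to sums of images. A full subcategory
of modules over a ring closed in these two ways is abelian with exact filtered colimits, and its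
cyclic objects generate it. Enough injectives follow. -/

namespace QHopf

/-! ### Two-sided multiplications on tensor products. -/

section Sandw

variable {k : Type*} [Field k]

/-- Zero is the pure tensor `0 ⊗ₜ 0`, so no zero case is needed. -/
theorem tensor_ind {X Y : Type*} [AddCommGroup X] [Module k X] [AddCommGroup Y] [Module k Y]
    {P : X ⊗[k] Y → Prop} (tmul : ∀ a b, P (a ⊗ₜ b)) (add : ∀ a b, P a → P b → P (a + b))
    (t : X ⊗[k] Y) : P t := by
  induction t with
  | zero => simpa using tmul 0 0
  | tmul a b => exact tmul a b
  | add a b ha hb => exact add a b ha hb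

variable {X Y R : Type*} [Ring X] [Algebra k X] [Ring Y] [Algebra k Y] [Ring R] [Algebra k R]

/-- `x ⊗ y ↦ s(x) w g(y)`. -/
noncomputable def sandw (s : X →ₗ[k] R) (g : Y →ₗ[k] R) (w : R) : X ⊗[k] Y →ₗ[k] R :=
  LinearMap.mul' k R ∘ₗ TensorProduct.map (LinearMap.mulRight k w ∘ₗ s) g

@[simp] theorem sandw_tmul (s : X →ₗ[k] R) (g : Y →ₗ[k] R) (w : R) (x : X) (y : Y) :
    sandw s g w (x ⊗ₜ y) = s x * w * g y := rfl

theorem sandw_smul (s : X →ₗ[k] R) (g : Y →ₗ[k] R) (c : k) (w : R) (t : X ⊗[k] Y) :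
    sandw s g (c • w) t = c • sandw s g w t := by
  induction t using tensor_ind with
  | tmul a b => simp
  | add a b ha hb => simp only [map_add, smul_add, ha, hb]

/-- Because `s` reverses products and `g` preserves them, the sandwich is a right action of the
tensor algebra on `R`. The leftmost factor therefore meets `w` first, and products can be absorbed
factor by factor. With the roles exchanged, as in `sandw_mul'`, it is a left action. -/
theorem sandw_mul (s : X →ₗ[k] R) (g : Y →ₗ[k] R) (hs : ∀ a b, s (a * b) = s b * s a)
    (hg : ∀ a b, g (a * b) = g a * g b) (w : R) (t u : X ⊗[k] Y) :
    sandw s g w (t * u) = sandw s g (sandw s g w t) u := by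
  induction u using tensor_ind with
  | add a b ha hb => simp only [map_add, mul_add, ha, hb]
  | tmul c d =>
    induction t using tensor_ind with
    | add a b ha hb => simp only [map_add, add_mul, ha, hb, sandw_tmul, mul_add]
    | tmul a b => simp [hs, hg, mul_assoc]

theorem sandw_mul' (s : X →ₗ[k] R) (g : Y →ₗ[k] R) (hs : ∀ a b, s (a * b) = s a * s b)
    (hg : ∀ a b, g (a * b) = g b * g a) (w : R) (t u : X ⊗[k] Y) :
    sandw s g w (t * u) = sandw s g (sandw s g w u) t := by
  induction t using tensor_ind with
  | add a b ha hb => simp only [map_add, add_mul, ha, hb]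
  | tmul c d =>
    induction u using tensor_ind with
    | add a b ha hb => simp only [map_add, mul_add, add_mul, ha, hb, sandw_tmul]
    | tmul a b => simp [hs, hg, mul_assoc]

theorem mul_sandw (s : X →ₗ[k] R) (g : Y →ₗ[k] R) (c w : R) (hc : ∀ a, s a * c = c * s a)
    (t : X ⊗[k] Y) : sandw s g (c * w) t = c * sandw s g w t := by
  induction t using tensor_ind with
  | add a b ha hb => simp only [map_add, mul_add, ha, hb]
  | tmul a b => simp only [sandw_tmul, ← mul_assoc, hc]

@[simp] theorem sandw_one (s : X →ₗ[k] R) (g : Y →ₗ[k] R) (hs : s 1 = 1) (hg : g 1 = 1) (w : R) :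
    sandw s g w 1 = w := by
  rw [Algebra.TensorProduct.one_def, sandw_tmul, hs, hg, one_mul, mul_one]

@[simp] theorem splitFst_tmul {Z W : Type*} [Ring Z] [Algebra k Z] [Ring W] [Algebra k W]
    (f : X →ₐ[k] Y ⊗[k] Z) (x : X) (w : W) :
    splitFst W f (x ⊗ₜ w) = TensorProduct.assoc k Y Z W (f x ⊗ₜ w) := rfl

@[simp] theorem dropFst_tmul {W : Type*} [Ring W] [Algebra k W]
    (f : X →ₐ[k] k) (x : X) (w : W) : dropFst W f (x ⊗ₜ w) = f x • w := rfl

@[simp] theorem dropSnd_tmul {W : Type*} [Ring W] [Algebra k W]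
    (f : X →ₐ[k] k) (x : X) (w : W) : dropSnd W f (w ⊗ₜ x) = f x • w := rfl

@[simp] theorem padRight_tmul {Z W : Type*} [Ring Z] [Algebra k Z] [Ring W] [Algebra k W]
    (x : X) (y : Y) (z : Z) :
    padRight W (x ⊗ₜ[k] (y ⊗ₜ[k] z)) = x ⊗ₜ (y ⊗ₜ (z ⊗ₜ 1)) := rfl

theorem assoc_mul {Z : Type*} [Ring Z] [Algebra k Z]
    (a b : (X ⊗[k] Y) ⊗[k] Z) : TensorProduct.assoc k X Y Z (a * b)
      = TensorProduct.assoc k X Y Z a * TensorProduct.assoc k X Y Z b :=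
  map_mul (Algebra.TensorProduct.assoc k k k X Y Z) a b

end Sandw

/-! ### Collapsing comultiplied factors with S and α. -/

namespace QuasiHopfAlgebra

variable {k H : Type*} [Field k] [Ring H] [Algebra k H] (Q : QuasiHopfAlgebra k H)

-- Apply ε to S(h₁) α h₂ = ε(h) α: since ε(α) = 1 the left side is ε(S(h₁)) ε(h₂) = ε(S(h)) by
-- counitality.
@[simp] theorem ε_S (h : H) : Q.ε (Q.S h) = Q.ε h := by
  have key : ∀ y : H ⊗[k] H, Q.ε (sandL Q.S.toLinearMap Q.α y)
      = Q.ε (Q.S (dropSnd H Q.ε y)) := by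
    intro y
    induction y using tensor_ind with
    | add a b ha hb => simp only [map_add, ha, hb]
    | tmul a b =>
      change Q.ε (Q.S a * Q.α * b) = Q.ε (Q.S (Q.ε b • a))
      simp [Q.ε_α, mul_comm]
  have := key (Q.Δ h)
  rw [Q.antipode_left, Q.counit_right] at this
  simpa [Q.ε_α] using this.symm

section Kap

variable (B : Type*) [Ring B] [Algebra k B]

/-- `a ⊗ y ↦ S(a) w y`. -/
noncomputable def sandS (w : H ⊗[k] B) : H ⊗[k] (H ⊗[k] B) →ₗ[k] H ⊗[k] B :=
  sandw (inl k H B ∘ₗ Q.S.toLinearMap) LinearMap.id w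

variable {B}

@[simp] theorem sandS_tmul (w : H ⊗[k] B) (a : H) (y : H ⊗[k] B) :
    Q.sandS B w (a ⊗ₜ y) = (Q.S a ⊗ₜ 1) * w * y := rfl

theorem sandS_mul (w : H ⊗[k] B) (t u : H ⊗[k] (H ⊗[k] B)) :
    Q.sandS B w (t * u) = Q.sandS B (Q.sandS B w t) u :=
  sandw_mul _ _ (fun a b => by simp [Q.S_mul]) (fun _ _ => rfl) _ _ _

theorem mul_sandS (b : B) (w : H ⊗[k] B) (t : H ⊗[k] (H ⊗[k] B)) :
    Q.sandS B ((1 ⊗ₜ b) * w) t = (1 ⊗ₜ b) * Q.sandS B w t :=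
  mul_sandw _ _ _ _ (fun a => by simp) _

/-- `a ⊗ b ⊗ c ↦ S(a) α b ⊗ c`. -/
noncomputable def kap (B : Type*) [Ring B] [Algebra k B] : H ⊗[k] (H ⊗[k] B) →ₗ[k] H ⊗[k] B :=
  Q.sandS B (Q.α ⊗ₜ 1)

@[simp] theorem kap_tmul (a b : H) (c : B) :
    Q.kap B (a ⊗ₜ (b ⊗ₜ c)) = (Q.S a * Q.α * b) ⊗ₜ c := by simp [kap]

theorem kap_mul (t u : H ⊗[k] (H ⊗[k] B)) : Q.kap B (t * u) = Q.sandS B (Q.kap B t) u :=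
  Q.sandS_mul _ _ _

theorem kap_one_tmul_mul (t : H ⊗[k] (H ⊗[k] B)) (y : H ⊗[k] B) :
    Q.kap B (t * (1 ⊗ₜ y)) = Q.kap B t * y := by
  rw [kap_mul, sandS_tmul, Q.S_one, ← Algebra.TensorProduct.one_def, one_mul]

theorem kap_eq (t : H ⊗[k] (H ⊗[k] B)) :
    TensorProduct.map (sandL Q.S.toLinearMap Q.α) LinearMap.id
      ((TensorProduct.assoc k H H B).symm t) = Q.kap B t := by
  induction t using tensor_ind with
  | add a b ha hb => simp only [map_add, ha, hb]
  | tmul a b =>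
    induction b using tensor_ind with
    | add b c hb hc => simp only [map_add, TensorProduct.tmul_add, hb, hc]
    | tmul b c => rw [kap_tmul]; rfl

theorem kap_splitFst (y : H ⊗[k] B) :
    Q.kap B (splitFst B Q.Δ y) = (1 ⊗ₜ dropFst B Q.ε y) * (Q.α ⊗ₜ 1) := by
  rw [← kap_eq]
  induction y using tensor_ind with
  | add a b ha hb => simp only [map_add, TensorProduct.tmul_add, add_mul, ha, hb]
  | tmul a b =>
    rw [splitFst_tmul, LinearEquiv.symm_apply_apply, TensorProduct.map_tmul, Q.antipode_left]
    simp [TensorProduct.smul_tmul]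

/-- The leftmost factor is the one adjacent to α, and there S(h₁) α h₂ = ε(h) α. This is the device
by which `kap`, applied to a pentagon identity, removes one of its factors. -/
theorem kap_splitFst_mul (y : H ⊗[k] B) (t : H ⊗[k] (H ⊗[k] B)) :
    Q.kap B (splitFst B Q.Δ y * t) = (1 ⊗ₜ dropFst B Q.ε y) * Q.kap B t := by
  rw [kap_mul, kap_splitFst, mul_sandS, kap]

theorem kap_natural {B' : Type*} [Ring B'] [Algebra k B'] (g : B →ₐ[k] B')
    (t : H ⊗[k] (H ⊗[k] B)) :
    Q.kap B' (onSnd H (onSnd H g) t) = onSnd H g (Q.kap B t) := by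
  induction t using tensor_ind with
  | add a b ha hb => simp only [map_add, ha, hb]
  | tmul a b =>
    induction b using tensor_ind with
    | add b c hb hc => simp only [map_add, TensorProduct.tmul_add, hb, hc]
    | tmul b c => simp

/-- `a ⊗ b ⊗ c ⊗ d ↦ S(b) α c ⊗ a ⊗ d`. -/
noncomputable def kapMid (B : Type*) [Ring B] [Algebra k B] :
    H ⊗[k] (H ⊗[k] (H ⊗[k] B)) →ₗ[k] H ⊗[k] (H ⊗[k] B) :=
  (TensorProduct.leftComm k H H B).toLinearMap ∘ₗ TensorProduct.map LinearMap.id (Q.kap B)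

@[simp] theorem kapMid_tmul (a b c : H) (d : B) :
    Q.kapMid B (a ⊗ₜ (b ⊗ₜ (c ⊗ₜ d))) = (Q.S b * Q.α * c) ⊗ₜ (a ⊗ₜ d) := by
  simp [kapMid]

theorem leftComm_mul (h : H) (b : B) (m : H ⊗[k] (H ⊗[k] B)) :
    TensorProduct.leftComm k H H B ((h ⊗ₜ (1 ⊗ₜ b)) * m)
      = (1 ⊗ₜ (h ⊗ₜ b)) * TensorProduct.leftComm k H H B m := by
  induction m using tensor_ind with
  | add a b ha hb => simp only [map_add, mul_add, ha, hb]
  | tmul a m =>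
    induction m using tensor_ind with
    | add b c hb hc => simp only [map_add, TensorProduct.tmul_add, mul_add, hb, hc]
    | tmul b c => simp

/-- The same collapse in the second and third legs; the first and last legs of `y` survive. -/
theorem kapMid_splitFst_mul (y : H ⊗[k] (H ⊗[k] B)) (t : H ⊗[k] (H ⊗[k] (H ⊗[k] B))) :
    Q.kapMid B (onSnd H (splitFst B Q.Δ) y * t)
      = (1 ⊗ₜ onSnd H (dropFst B Q.ε) y) * Q.kapMid B t := by
  induction y using tensor_ind with
  | add a b ha hb => simp only [map_add, TensorProduct.tmul_add, add_mul, ha, hb]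
  | tmul h z =>
    induction t using tensor_ind with
    | add b c hb hc => simp only [map_add, mul_add, hb, hc]
    | tmul a t =>
      simp only [Algebra.TensorProduct.map_tmul, AlgHom.coe_id, id_eq,
        Algebra.TensorProduct.tmul_mul_tmul, kapMid, LinearMap.comp_apply,
        TensorProduct.map_tmul, LinearMap.id_apply, kap_splitFst_mul, LinearEquiv.coe_coe]
      rw [← leftComm_mul, Algebra.TensorProduct.tmul_mul_tmul]

end Kap

end QuasiHopfAlgebra

/-! ### The element γ and the intertwining property of the Drinfeld twist. -/

namespace QuasiHopfAlgebra

variable {k H : Type*} [Field k] [Ring H] [Algebra k H] (Q : QuasiHopfAlgebra k H)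

/-- `x ⊗ y ↦ S(y) ⊗ S(x)`. -/
noncomputable def SSop : H ⊗[k] H →ₗ[k] H ⊗[k] H :=
  TensorProduct.map Q.S.toLinearMap Q.S.toLinearMap ∘ₗ (TensorProduct.comm k H H).toLinearMap

@[simp] theorem SSop_tmul (a b : H) : Q.SSop (a ⊗ₜ b) = Q.S b ⊗ₜ Q.S a := rfl

theorem SSop_mul (a b : H ⊗[k] H) : Q.SSop (a * b) = Q.SSop b * Q.SSop a := by
  change TensorProduct.map _ _ (Algebra.TensorProduct.comm k H H (a * b)) = _
  rw [map_mul]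
  exact map_antimul _ _ Q.S_mul Q.S_mul _ _

theorem SSop_one : Q.SSop 1 = 1 := by
  rw [Algebra.TensorProduct.one_def, SSop_tmul, Q.S_one]

/-- `x ⊗ y ↦ (S ⊗ S)(Δ^cop(x)) w Δ(y)`. -/
noncomputable def sandΔ (w : H ⊗[k] H) : H ⊗[k] H →ₗ[k] H ⊗[k] H :=
  sandw (Q.SSop ∘ₗ Q.Δ.toLinearMap) Q.Δ.toLinearMap w

@[simp] theorem sandΔ_tmul (w : H ⊗[k] H) (a b : H) :
    Q.sandΔ w (a ⊗ₜ b) = Q.SSop (Q.Δ a) * w * Q.Δ b := rfl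

theorem sandΔ_mul (w t u : H ⊗[k] H) : Q.sandΔ w (t * u) = Q.sandΔ (Q.sandΔ w t) u :=
  sandw_mul _ _ (fun a b => by simp [SSop_mul]) (fun a b => by simp) _ _ _

theorem sandΔ_one (w : H ⊗[k] H) : Q.sandΔ w 1 = w :=
  sandw_one _ _ (by simp [SSop_one]) (by simp) _

theorem gammaMap_tmul (a b c d : H) :
    Q.gammaMap (a ⊗ₜ (b ⊗ₜ (c ⊗ₜ d))) = (Q.S b * Q.α * c) ⊗ₜ (Q.S a * Q.α * d) := rfl

/-- The map defining γ is two nested collapses, legs 2 and 3 and then legs 1 and 4, so the antipode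
axiom can be used twice in succession. -/
theorem gammaMap_eq (t : H ⊗[k] (H ⊗[k] (H ⊗[k] H))) :
    Q.gammaMap t = TensorProduct.map LinearMap.id (sandL Q.S.toLinearMap Q.α) (Q.kapMid H t) := by
  induction t using tensor_ind with
  | add a b ha hb => simp only [map_add, ha, hb]
  | tmul a t =>
    induction t using tensor_ind with
    | add a b ha hb => simp only [map_add, TensorProduct.tmul_add, ha, hb]
    | tmul b t =>
      induction t using tensor_ind with
      | add a b ha hb => simp only [map_add, TensorProduct.tmul_add, ha, hb]
      | tmul c d => rw [kapMid_tmul]; rfl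

/-- `a ⊗ b ⊗ c ⊗ d ⊗ e ↦ S(b) α c ⊗ S(a) α d ⊗ e`. -/
noncomputable def gam (B : Type*) [Ring B] [Algebra k B] :
    H ⊗[k] (H ⊗[k] (H ⊗[k] (H ⊗[k] B))) →ₗ[k] H ⊗[k] (H ⊗[k] B) :=
  TensorProduct.map LinearMap.id (Q.kap B) ∘ₗ Q.kapMid (H ⊗[k] B)

section gam

variable {B : Type*} [Ring B] [Algebra k B]

@[simp] theorem gam_tmul (a b c d : H) (e : B) :
    Q.gam B (a ⊗ₜ (b ⊗ₜ (c ⊗ₜ (d ⊗ₜ e))))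
      = (Q.S b * Q.α * c) ⊗ₜ ((Q.S a * Q.α * d) ⊗ₜ e) := by
  simp [gam]

theorem gam_mul_right (t : H ⊗[k] (H ⊗[k] (H ⊗[k] (H ⊗[k] B)))) (y : H ⊗[k] (H ⊗[k] B)) :
    Q.gam B (t * (1 ⊗ₜ (1 ⊗ₜ y))) = Q.gam B t * y := by
  induction y using tensor_ind with
  | add a b ha hb => simp only [map_add, TensorProduct.tmul_add, mul_add, ha, hb]
  | tmul y1 y =>
  induction y using tensor_ind with
  | add a b ha hb => simp only [map_add, TensorProduct.tmul_add, mul_add, ha, hb]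
  | tmul y2 y3 =>
  induction t using tensor_ind with
  | add a b ha hb => simp only [map_add, add_mul, ha, hb]
  | tmul a t =>
  induction t using tensor_ind with
  | add a b ha hb => simp only [map_add, TensorProduct.tmul_add, add_mul, ha, hb]
  | tmul b t =>
  induction t using tensor_ind with
  | add a b ha hb => simp only [map_add, TensorProduct.tmul_add, add_mul, ha, hb]
  | tmul c t =>
  induction t using tensor_ind with
  | add a b ha hb => simp only [map_add, TensorProduct.tmul_add, add_mul, ha, hb]
  | tmul d e => simp [mul_assoc]

theorem gam_pad_mul (t : H ⊗[k] (H ⊗[k] (H ⊗[k] H))) (e e' : H ⊗[k] H) (b : B) :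
    Q.gam B (onSnd H (padRight B) t
        * TensorProduct.assoc k H H _ (e ⊗ₜ TensorProduct.assoc k H H B (e' ⊗ₜ b)))
      = TensorProduct.assoc k H H B ((Q.SSop e * Q.gammaMap t * e') ⊗ₜ b) := by
  induction e using tensor_ind with
  | add a b ha hb => simp only [map_add, TensorProduct.add_tmul, mul_add, add_mul, ha, hb]
  | tmul e1 e2 =>
  induction e' using tensor_ind with
  | add a b ha hb =>
    simp only [map_add, TensorProduct.add_tmul, TensorProduct.tmul_add, mul_add, ha, hb]
  | tmul e3 e4 =>
  induction t using tensor_ind with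
  | add a b ha hb =>
    simp only [map_add, TensorProduct.add_tmul, mul_add, add_mul, ha, hb]
  | tmul a t =>
  induction t using tensor_ind with
  | add a b ha hb =>
    simp only [map_add, TensorProduct.add_tmul, TensorProduct.tmul_add, mul_add, add_mul, ha, hb]
  | tmul b t =>
  induction t using tensor_ind with
  | add a b ha hb =>
    simp only [map_add, TensorProduct.add_tmul, TensorProduct.tmul_add, mul_add, add_mul, ha, hb]
  | tmul c d => simp [gammaMap_tmul, Q.S_mul, mul_assoc]

end gam

theorem gammaMap_mul (t : H ⊗[k] (H ⊗[k] (H ⊗[k] H))) (e e' : H ⊗[k] H) :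
    Q.gammaMap (t * TensorProduct.assoc k H H _ (e ⊗ₜ e'))
      = Q.SSop e * Q.gammaMap t * e' := by
  induction e using tensor_ind with
  | add a b ha hb => simp only [map_add, TensorProduct.add_tmul, mul_add, add_mul, ha, hb]
  | tmul e1 e2 =>
  induction e' using tensor_ind with
  | add a b ha hb =>
    simp only [map_add, TensorProduct.tmul_add, mul_add, ha, hb]
  | tmul e3 e4 =>
  induction t using tensor_ind with
  | add a b ha hb =>
    simp only [map_add, mul_add, add_mul, ha, hb]
  | tmul a t =>
  induction t using tensor_ind with
  | add a b ha hb =>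
    simp only [map_add, TensorProduct.tmul_add, mul_add, add_mul, ha, hb]
  | tmul b t =>
  induction t using tensor_ind with
  | add a b ha hb =>
    simp only [map_add, TensorProduct.tmul_add, mul_add, add_mul, ha, hb]
  | tmul c d => simp [gammaMap_tmul, Q.S_mul, mul_assoc]

/-- S reverses products, so the outer factors of the sandwich become right multiplication by (Δ ⊗
Δ)(y) inside the four legs, where quasi-coassociativity applies. -/
theorem sandΔ_gammaMap (t : H ⊗[k] (H ⊗[k] (H ⊗[k] H))) (y : H ⊗[k] H) :
    Q.sandΔ (Q.gammaMap t) y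
      = Q.gammaMap (t * splitFst (H ⊗[k] H) Q.Δ (onSnd H Q.Δ y)) := by
  induction y using tensor_ind with
  | add a b ha hb => simp only [map_add, mul_add, ha, hb]
  | tmul a b =>
    simp only [sandΔ_tmul, Algebra.TensorProduct.map_tmul, splitFst_tmul, gammaMap_mul]
    rfl

section coassoc

variable (B : Type*) [Ring B] [Algebra k B]

theorem splitFst_assoc (e : H ⊗[k] H) (b : B) :
    splitFst (H ⊗[k] B) Q.Δ (TensorProduct.assoc k H H B (e ⊗ₜ b))
      = padRight B (splitFst H Q.Δ e) * (1 ⊗ₜ (1 ⊗ₜ (1 ⊗ₜ b))) := by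
  induction e using tensor_ind with
  | add a b ha hb => simp only [map_add, TensorProduct.add_tmul, add_mul, ha, hb]
  | tmul e1 e2 =>
    simp only [TensorProduct.assoc_tmul, splitFst_tmul]
    induction Q.Δ e1 using tensor_ind with
    | add a b ha hb => simp only [map_add, TensorProduct.add_tmul, add_mul, ha, hb]
    | tmul e1 e2 => simp

theorem onSnd_assoc (e : H ⊗[k] H) (b : B) :
    onSnd H (splitFst B Q.Δ) (TensorProduct.assoc k H H B (e ⊗ₜ b))
      = padRight B (onSnd H Q.Δ e) * (1 ⊗ₜ (1 ⊗ₜ (1 ⊗ₜ b))) := by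
  induction e using tensor_ind with
  | add a b ha hb => simp only [map_add, TensorProduct.add_tmul, add_mul, ha, hb]
  | tmul e1 e2 =>
    simp only [TensorProduct.assoc_tmul, Algebra.TensorProduct.map_tmul, splitFst_tmul]
    induction Q.Δ e2 using tensor_ind with
    | add a b ha hb =>
      simp only [map_add, TensorProduct.add_tmul, TensorProduct.tmul_add, add_mul, ha, hb]
    | tmul e1 e2 => simp

theorem padRight_comm (t : H ⊗[k] (H ⊗[k] H)) (b : B) :
    (1 ⊗ₜ (1 ⊗ₜ (1 ⊗ₜ b))) * padRight B t = padRight B t * (1 ⊗ₜ (1 ⊗ₜ (1 ⊗ₜ b))) := by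
  induction t using tensor_ind with
  | add a b ha hb => simp only [map_add, add_mul, mul_add, ha, hb]
  | tmul a t =>
  induction t using tensor_ind with
  | add a b ha hb => simp only [map_add, TensorProduct.tmul_add, add_mul, mul_add, ha, hb]
  | tmul b c => simp

/-- Quasi-coassociativity in the first leg of `y`, with the second leg as a spectator. -/
theorem padRight_coassoc (y : H ⊗[k] B) :
    padRight B (Q.Φ : H ⊗[k] (H ⊗[k] H)) * splitFst (H ⊗[k] B) Q.Δ (splitFst B Q.Δ y)
      = onSnd H (splitFst B Q.Δ) (splitFst B Q.Δ y) * padRight B (Q.Φ : H ⊗[k] (H ⊗[k] H)) := by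
  induction y using tensor_ind with
  | add a b ha hb => simp only [map_add, mul_add, add_mul, ha, hb]
  | tmul a b =>
    rw [splitFst_tmul, splitFst_assoc, onSnd_assoc, mul_assoc, padRight_comm, ← mul_assoc,
      ← mul_assoc, ← map_mul, ← map_mul, Q.coassoc, mul_assoc _ _ (Q.Φ : H ⊗[k] (H ⊗[k] H)),
      Units.inv_mul, mul_one]

theorem onSnd_dropFst_splitFst (y : H ⊗[k] B) :
    onSnd H (dropFst B Q.ε) (splitFst B Q.Δ y) = y := by
  induction y using tensor_ind with
  | add a b ha hb => simp only [map_add, ha, hb]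
  | tmul a b =>
    have h : ∀ e : H ⊗[k] H, onSnd H (dropFst B Q.ε) (TensorProduct.assoc k H H B (e ⊗ₜ b))
        = dropSnd H Q.ε e ⊗ₜ b := by
      intro e
      induction e using tensor_ind with
      | add a b ha hb => simp only [map_add, TensorProduct.add_tmul, ha, hb]
      | tmul a b => simp [TensorProduct.smul_tmul]
    rw [splitFst_tmul, h, Q.counit_right]

end coassoc

theorem sandL_Δ_mul (h : H) (t : H ⊗[k] H) :
    sandL Q.S.toLinearMap Q.α (Q.Δ h * t) = Q.ε h • sandL Q.S.toLinearMap Q.α t := by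
  have := sandw_mul (k := k) Q.S.toLinearMap LinearMap.id Q.S_mul (fun _ _ => rfl) Q.α (Q.Δ h) t
  have e := Q.antipode_left h
  change sandw Q.S.toLinearMap LinearMap.id Q.α (Q.Δ h) = _ at e
  rw [e, sandw_smul] at this
  exact this

theorem sandR_mul_Δ (h : H) (t : H ⊗[k] H) :
    sandR Q.S.toLinearMap Q.β (t * Q.Δ h) = Q.ε h • sandR Q.S.toLinearMap Q.β t := by
  have := sandw_mul' (k := k) LinearMap.id Q.S.toLinearMap (fun _ _ => rfl) Q.S_mul Q.β t (Q.Δ h)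
  have e := Q.antipode_right h
  change sandw LinearMap.id Q.S.toLinearMap Q.β (Q.Δ h) = _ at e
  rw [e, sandw_smul] at this
  exact this

/-- `(S ⊗ S)(Δ^cop(h₁)) γ Δ(h₂) = ε(h) γ`. -/
theorem sandΔ_gamma_Δ (h : H) : Q.sandΔ Q.gamma (Q.Δ h) = Q.ε h • Q.gamma := by
  have e : (↑Q.Φ⁻¹ : H ⊗[k] (H ⊗[k] H)) * onSnd H Q.Δ (Q.Δ h)
      = splitFst H Q.Δ (Q.Δ h) * (↑Q.Φ⁻¹ : H ⊗[k] (H ⊗[k] H)) := by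
    rw [Q.coassoc, mul_assoc, Units.inv_mul_cancel_left]
  have kill : ∀ t : H ⊗[k] (H ⊗[k] H), TensorProduct.map LinearMap.id
      (sandL Q.S.toLinearMap Q.α) ((1 ⊗ₜ Q.Δ h) * t)
        = Q.ε h • TensorProduct.map LinearMap.id (sandL Q.S.toLinearMap Q.α) t := by
    intro t
    induction t using tensor_ind with
    | add a b ha hb => simp only [map_add, mul_add, smul_add, ha, hb]
    | tmul a b =>
      rw [Algebra.TensorProduct.tmul_mul_tmul, TensorProduct.map_tmul, sandL_Δ_mul, one_mul,
        TensorProduct.tmul_smul, TensorProduct.map_tmul]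
  unfold gamma
  -- Quasi-coassociativity is used twice, past Φ⁻¹ and past Φ, to bring the iterated
  -- comultiplication of h to the far left. There the inner pair of legs collapses and leaves Δ(h)
  -- in the outer pair, which `kill` collapses to ε(h).
  rw [sandΔ_gammaMap, mul_assoc, ← map_mul (splitFst _ _), e, map_mul (splitFst _ _), ← mul_assoc,
    padRight_coassoc, mul_assoc,
    gammaMap_eq, kapMid_splitFst_mul, onSnd_dropFst_splitFst, kill, ← gammaMap_eq]

theorem drinfeldTwist_eq : Q.drinfeldTwist = Q.sandΔ Q.gamma
    (TensorProduct.map LinearMap.id (sandR Q.S.toLinearMap Q.β)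
      (↑Q.Φ⁻¹ : H ⊗[k] (H ⊗[k] H))) := by
  unfold drinfeldTwist
  induction (↑Q.Φ⁻¹ : H ⊗[k] (H ⊗[k] H)) using tensor_ind with
  | add a b ha hb => simp only [map_add, ha, hb]
  | tmul a b => rfl

/-- `(S ⊗ S)(Δ^cop(h)) f = f Δ(S(h))`. -/
theorem SSop_mul_drinfeldTwist (h : H) :
    Q.SSop (Q.Δ h) * Q.drinfeldTwist = Q.drinfeldTwist * Q.Δ (Q.S h) := by
  -- The map `N` sends a ⊗ b ⊗ c to a ⊗ b β S(c), so f is the γ-sandwich of `N` at Φ⁻¹. The two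
  -- sides of Φ⁻¹ (id ⊗ Δ)Δ(h) = (Δ ⊗ id)Δ(h) Φ⁻¹ are evaluated this way. On one side β absorbs
  -- Δ(h₂) and (S ⊗ S)(Δ^cop(h)) remains on the left; on the other γ absorbs Δ(h₁) by
  -- `sandΔ_gamma_Δ` and Δ(S(h)) remains on the right.
  set N := TensorProduct.map (LinearMap.id : H →ₗ[k] H) (sandR Q.S.toLinearMap Q.β) with hN
  have h1 : ∀ (e : H ⊗[k] H) (c : H) (t : H ⊗[k] (H ⊗[k] H)),
      N (TensorProduct.assoc k H H H (e ⊗ₜ c) * t) = e * N t * (1 ⊗ₜ Q.S c) := by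
    intro e c t
    induction e using tensor_ind with
    | add a b ha hb => simp only [map_add, TensorProduct.add_tmul, add_mul, ha, hb]
    | tmul e1 e2 =>
    induction t using tensor_ind with
    | add a b ha hb => simp only [map_add, add_mul, mul_add, ha, hb]
    | tmul a t =>
    induction t using tensor_ind with
    | add a b ha hb => simp only [map_add, TensorProduct.tmul_add, add_mul, mul_add, ha, hb]
    | tmul b d => simp [hN, sandR, Q.S_mul, mul_assoc]
  have h2 : ∀ (y : H ⊗[k] H) (t : H ⊗[k] (H ⊗[k] H)),
      N (t * onSnd H Q.Δ y) = N t * (dropSnd H Q.ε y ⊗ₜ 1) := by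
    intro y t
    induction y using tensor_ind with
    | add a b ha hb => simp only [map_add, TensorProduct.add_tmul, mul_add, ha, hb]
    | tmul y1 y2 =>
    induction t using tensor_ind with
    | add a b ha hb => simp only [map_add, add_mul, ha, hb]
    | tmul a t =>
      rw [Algebra.TensorProduct.map_tmul, Algebra.TensorProduct.tmul_mul_tmul, hN,
        TensorProduct.map_tmul, sandR_mul_Δ, TensorProduct.map_tmul,
        Algebra.TensorProduct.tmul_mul_tmul, dropSnd_tmul]
      simp [TensorProduct.smul_tmul]
  have h3 : ∀ (y : H ⊗[k] H) (t : H ⊗[k] (H ⊗[k] H)),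
      Q.sandΔ Q.gamma (N (splitFst H Q.Δ y * t))
        = Q.sandΔ Q.gamma (N t) * Q.Δ (Q.S (dropFst H Q.ε y)) := by
    intro y t
    induction y using tensor_ind with
    | add a b ha hb => simp only [map_add, mul_add, add_mul, ha, hb]
    | tmul a b =>
      have e : ∀ w : H ⊗[k] H, Q.sandΔ w (1 ⊗ₜ Q.S b) = w * Q.Δ (Q.S b) := by
        intro w
        rw [sandΔ_tmul, map_one, SSop_one, one_mul]
      rw [splitFst_tmul, h1, sandΔ_mul, sandΔ_mul, sandΔ_gamma_Δ, e, dropFst_tmul]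
      simp [sandΔ, sandw_smul]
  have h4 : ∀ w : H ⊗[k] H, Q.sandΔ w (h ⊗ₜ 1) = Q.SSop (Q.Δ h) * w := by
    intro w
    rw [sandΔ_tmul, map_one, mul_one]
  have e : (↑Q.Φ⁻¹ : H ⊗[k] (H ⊗[k] H)) * onSnd H Q.Δ (Q.Δ h)
      = splitFst H Q.Δ (Q.Δ h) * (↑Q.Φ⁻¹ : H ⊗[k] (H ⊗[k] H)) := by
    rw [Q.coassoc, mul_assoc, Units.inv_mul_cancel_left]
  have h5 := h2 (Q.Δ h) (↑Q.Φ⁻¹ : H ⊗[k] (H ⊗[k] H))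
  rw [e, Q.counit_right] at h5
  have h6 := h3 (Q.Δ h) (↑Q.Φ⁻¹ : H ⊗[k] (H ⊗[k] H))
  rw [h5, sandΔ_mul, h4, ← drinfeldTwist_eq, Q.counit_left] at h6
  exact h6

end QuasiHopfAlgebra

/-! ### Counit normalizations of Φ that follow from the middle one. -/

section Counit

variable {k H : Type*} [Field k] [Ring H] [Algebra k H]

theorem one_tmul_injective {R S : Type*} [Ring R] [Algebra k R] [Ring S] [Algebra k S]
    (e : R →ₐ[k] k) {x y : S} (h : (1 : R) ⊗ₜ[k] x = 1 ⊗ₜ y) : x = y := by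
  simpa using congrArg (dropFst S e) h

theorem tmul_one_injective {R S : Type*} [Ring R] [Algebra k R] [Ring S] [Algebra k S]
    (e : R →ₐ[k] k) {x y : S} (h : x ⊗ₜ[k] (1 : R) = y ⊗ₜ 1) : x = y := by
  simpa using congrArg (dropSnd S e) h

theorem onSnd_comp_apply {X Y Y' Y'' : Type*} [Ring X] [Algebra k X] [Ring Y] [Algebra k Y]
    [Ring Y'] [Algebra k Y'] [Ring Y''] [Algebra k Y''] (f : Y →ₐ[k] Y') (g : Y' →ₐ[k] Y'')
    (t : X ⊗[k] Y) : onSnd X g (onSnd X f t) = onSnd X (g.comp f) t := by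
  induction t using tensor_ind with
  | add a b ha hb => simp only [map_add, ha, hb]
  | tmul a b => rfl

namespace QuasiBialgebra

variable (Q : QuasiBialgebra k H)

/-- Applying ε to the second leg of the pentagon kills Φ ⊗ 1 and (id ⊗ id ⊗ Δ)(Φ), by the middle
normalization, and leaves (1 ⊗ (ε ⊗ id ⊗ id)(Φ)) Φ = Φ. Cancel Φ. -/
theorem Φ_counit_left : dropFst (H ⊗[k] H) Q.ε (Q.Φ : H ⊗[k] (H ⊗[k] H)) = 1 := by
  have h := congrArg (onSnd H (dropFst (H ⊗[k] H) Q.ε)) Q.pentagon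
  have e1 : ∀ t : H ⊗[k] (H ⊗[k] H), onSnd H (dropFst (H ⊗[k] H) Q.ε) (padLeft H t)
      = 1 ⊗ₜ dropFst (H ⊗[k] H) Q.ε t := by
    intro t; simp
  have e2 : ∀ y : H ⊗[k] H, dropFst (H ⊗[k] H) Q.ε (splitFst H Q.Δ y) = y := by
    intro y
    induction y using tensor_ind with
    | add a b ha hb => simp only [map_add, ha, hb]
    | tmul a b =>
      have h : ∀ e : H ⊗[k] H, dropFst (H ⊗[k] H) Q.ε (TensorProduct.assoc k H H H (e ⊗ₜ b))
          = dropFst H Q.ε e ⊗ₜ b := by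
        intro e
        induction e using tensor_ind with
        | add a b ha hb => simp only [map_add, TensorProduct.add_tmul, ha, hb]
        | tmul a b => simp [← TensorProduct.smul_tmul']
      rw [splitFst_tmul, h, Q.counit_left]
  have e2' : ∀ t : H ⊗[k] (H ⊗[k] H),
      onSnd H (dropFst (H ⊗[k] H) Q.ε) (onSnd H (splitFst H Q.Δ) t) = t := by
    intro t
    induction t using tensor_ind with
    | add a b ha hb => simp only [map_add, ha, hb]
    | tmul a b => simp [e2, -splitFst_tmul]
  have e3 : ∀ t : H ⊗[k] (H ⊗[k] H), onSnd H (dropFst (H ⊗[k] H) Q.ε) (padRight H t)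
      = onSnd H Algebra.TensorProduct.includeLeft (onSnd H (dropFst H Q.ε) t) := by
    intro t
    induction t using tensor_ind with
    | add a b ha hb => simp only [map_add, ha, hb]
    | tmul a b =>
      induction b using tensor_ind with
      | add b c hb hc => simp only [map_add, TensorProduct.tmul_add, hb, hc]
      | tmul b c => simp [TensorProduct.tmul_smul]
  have e4 : ∀ t : H ⊗[k] (H ⊗[k] H), onSnd H (dropFst (H ⊗[k] H) Q.ε) (onSnd H (onSnd H Q.Δ) t)
      = onSnd H Q.Δ (onSnd H (dropFst H Q.ε) t) := by
    intro t
    induction t using tensor_ind with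
    | add a b ha hb => simp only [map_add, ha, hb]
    | tmul a b =>
      induction b using tensor_ind with
      | add b c hb hc => simp only [map_add, TensorProduct.tmul_add, hb, hc]
      | tmul b c => simp
  have e5 : ∀ t : H ⊗[k] (H ⊗[k] H),
      onSnd H (dropFst (H ⊗[k] H) Q.ε) (splitFst (H ⊗[k] H) Q.Δ t) = t := by
    intro t
    induction t using tensor_ind with
    | add a b ha hb => simp only [map_add, ha, hb]
    | tmul a b =>
      have h : ∀ e : H ⊗[k] H, onSnd H (dropFst (H ⊗[k] H) Q.ε)
          (TensorProduct.assoc k H H _ (e ⊗ₜ b)) = dropSnd H Q.ε e ⊗ₜ b := by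
        intro e
        induction e using tensor_ind with
        | add a b ha hb => simp only [map_add, TensorProduct.add_tmul, ha, hb]
        | tmul a b => simp [TensorProduct.smul_tmul]
      rw [splitFst_tmul, h, Q.counit_right]
  rw [map_mul, map_mul, map_mul, e1, e2', e3, e4, e5, Q.Φ_counit, map_one, map_one, mul_one,
    one_mul] at h
  have h' := congrArg (· * (↑Q.Φ⁻¹ : H ⊗[k] (H ⊗[k] H))) h
  simp only [mul_assoc, Units.mul_inv, mul_one] at h'
  exact one_tmul_injective Q.ε (h'.trans Algebra.TensorProduct.one_def)

/-- The mirror argument, with ε in the third leg of the pentagon. -/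
theorem Φ_counit_right : onSnd H (dropSnd H Q.ε) (Q.Φ : H ⊗[k] (H ⊗[k] H)) = 1 := by
  have h := congrArg (onSnd H (onSnd H (dropFst H Q.ε))) Q.pentagon
  have e1 : ∀ t : H ⊗[k] (H ⊗[k] H), onSnd H (onSnd H (dropFst H Q.ε)) (padLeft H t)
      = 1 ⊗ₜ onSnd H (dropFst H Q.ε) t := by
    intro t; simp
  have e2 : ∀ y : H ⊗[k] H, onSnd H (dropFst H Q.ε) (splitFst H Q.Δ y) = y := by
    intro y
    induction y using tensor_ind with
    | add a b ha hb => simp only [map_add, ha, hb]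
    | tmul a b =>
      have h : ∀ e : H ⊗[k] H, onSnd H (dropFst H Q.ε) (TensorProduct.assoc k H H H (e ⊗ₜ b))
          = dropSnd H Q.ε e ⊗ₜ b := by
        intro e
        induction e using tensor_ind with
        | add a b ha hb => simp only [map_add, TensorProduct.add_tmul, ha, hb]
        | tmul a b => simp [TensorProduct.smul_tmul]
      rw [splitFst_tmul, h, Q.counit_right]
  have e2' : ∀ t : H ⊗[k] (H ⊗[k] H),
      onSnd H (onSnd H (dropFst H Q.ε)) (onSnd H (splitFst H Q.Δ) t) = t := by
    intro t
    induction t using tensor_ind with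
    | add a b ha hb => simp only [map_add, ha, hb]
    | tmul a b =>
      rw [Algebra.TensorProduct.map_tmul, Algebra.TensorProduct.map_tmul, e2]; rfl
  have e3 : ∀ t : H ⊗[k] (H ⊗[k] H), onSnd H (onSnd H (dropFst H Q.ε)) (padRight H t)
      = TensorProduct.assoc k H H H (onSnd H (dropSnd H Q.ε) t ⊗ₜ 1) := by
    intro t
    induction t using tensor_ind with
    | add a b ha hb => simp only [map_add, TensorProduct.add_tmul, ha, hb]
    | tmul a b =>
      induction b using tensor_ind with
      | add b c hb hc =>
        simp only [map_add, TensorProduct.tmul_add, TensorProduct.add_tmul, hb, hc]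
      | tmul b c => simp [TensorProduct.tmul_smul, ← TensorProduct.smul_tmul']
  have e4 : ∀ t : H ⊗[k] (H ⊗[k] H), onSnd H (onSnd H (dropFst H Q.ε)) (onSnd H (onSnd H Q.Δ) t)
      = t := by
    intro t
    induction t using tensor_ind with
    | add a b ha hb => simp only [map_add, ha, hb]
    | tmul a b =>
      induction b using tensor_ind with
      | add b c hb hc => simp only [map_add, TensorProduct.tmul_add, hb, hc]
      | tmul b c => simp [Q.counit_left]
  have e5 : ∀ t : H ⊗[k] (H ⊗[k] H),
      onSnd H (onSnd H (dropFst H Q.ε)) (splitFst (H ⊗[k] H) Q.Δ t)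
        = splitFst H Q.Δ (onSnd H (dropFst H Q.ε) t) := by
    intro t
    induction t using tensor_ind with
    | add a b ha hb => simp only [map_add, ha, hb]
    | tmul a b =>
      have h : ∀ e : H ⊗[k] H, onSnd H (onSnd H (dropFst H Q.ε))
          (TensorProduct.assoc k H H _ (e ⊗ₜ b))
            = TensorProduct.assoc k H H H (e ⊗ₜ dropFst H Q.ε b) := by
        intro e
        induction e using tensor_ind with
        | add a b ha hb => simp only [map_add, TensorProduct.add_tmul, ha, hb]
        | tmul a b => simp
      rw [splitFst_tmul, h, Algebra.TensorProduct.map_tmul, splitFst_tmul]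
      rfl
  rw [map_mul, map_mul, map_mul, e1, e2', e3, e4, e5, Q.Φ_counit, map_one,
    ← Algebra.TensorProduct.one_def, one_mul] at h
  have h' := congrArg ((↑Q.Φ⁻¹ : H ⊗[k] (H ⊗[k] H)) * ·) h
  simp only [Units.inv_mul_cancel_left, Units.inv_mul, mul_one] at h'
  have h'' := congrArg (TensorProduct.assoc k H H H).symm h'
  rw [LinearEquiv.symm_apply_apply] at h''
  exact tmul_one_injective Q.ε h''

theorem inv_eq_one {R S : Type*} [Ring R] [Ring S] [Algebra k R] [Algebra k S] (f : R →ₐ[k] S)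
    (x : Rˣ) (h : f x = 1) : f ↑x⁻¹ = 1 := by
  have := congrArg f x.mul_inv
  rwa [map_mul, h, one_mul, map_one] at this

theorem map_inv_mul_map {R S : Type*} [Ring R] [Ring S] [Algebra k R] [Algebra k S]
    (f : R →ₐ[k] S) (x : Rˣ) : f ↑x⁻¹ * f ↑x = 1 := by
  rw [← map_mul, x.inv_mul, map_one]

theorem map_mul_map_inv {R S : Type*} [Ring R] [Ring S] [Algebra k R] [Algebra k S]
    (f : R →ₐ[k] S) (x : Rˣ) : f ↑x * f ↑x⁻¹ = 1 := by
  rw [← map_mul, x.mul_inv, map_one]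

end QuasiBialgebra

end Counit

/-! ### The value of the Drinfeld twist on Δ(α). -/

namespace QuasiHopfAlgebra

variable {k H : Type*} [Field k] [Ring H] [Algebra k H] (Q : QuasiHopfAlgebra k H)

/-- `f Δ(α) = γ`. -/
theorem drinfeldTwist_mul_Δ_α : Q.drinfeldTwist * Q.Δ Q.α = Q.gamma := by
  -- The map `M` sends a ⊗ b ⊗ c ⊗ d to a ⊗ b β S(c) α d. Evaluated at Φ⁻¹ ⊗ 1 it supplies the extra
  -- α, so f Δ(α) is the γ-sandwich of that value. In it γ, α and β each absorb a comultiplied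
  -- factor: γ on the left in `k1`, α on the left in `k2`, β on the right in `k3`.
  set M := TensorProduct.map (LinearMap.id : H →ₗ[k] H) (sandRL Q.S.toLinearMap Q.β Q.α) with hM
  have hRL : ∀ b c d : H, sandRL Q.S.toLinearMap Q.β Q.α (b ⊗ₜ (c ⊗ₜ d))
      = b * Q.β * (Q.S c * Q.α * d) := fun _ _ _ => rfl
  have pad : ∀ t : H ⊗[k] (H ⊗[k] H), M (padRight H t)
      = TensorProduct.map LinearMap.id (sandR Q.S.toLinearMap Q.β) t * (1 ⊗ₜ Q.α) := by
    intro t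
    induction t using tensor_ind with
    | add a b ha hb => simp only [map_add, add_mul, ha, hb]
    | tmul a t =>
    induction t using tensor_ind with
    | add a b ha hb => simp only [map_add, TensorProduct.tmul_add, add_mul, ha, hb]
    | tmul b d => simp [hM, sandR, hRL, mul_assoc]
  have h1 : ∀ (e y : H ⊗[k] H) (t : H ⊗[k] (H ⊗[k] (H ⊗[k] H))),
      M (TensorProduct.assoc k H H (H ⊗[k] H) (e ⊗ₜ y) * t)
        = e * M ((1 ⊗ₜ (1 ⊗ₜ y)) * t) := by
    intro e y t
    induction e using tensor_ind with
    | add a b ha hb => simp only [map_add, TensorProduct.add_tmul, add_mul, ha, hb]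
    | tmul e1 e2 =>
    induction y using tensor_ind with
    | add a b ha hb => simp only [map_add, TensorProduct.tmul_add, mul_add, add_mul, ha, hb]
    | tmul y1 y2 =>
    induction t using tensor_ind with
    | add a b ha hb => simp only [map_add, mul_add, ha, hb]
    | tmul a t =>
    induction t using tensor_ind with
    | add a b ha hb => simp only [map_add, TensorProduct.tmul_add, mul_add, ha, hb]
    | tmul b t =>
    induction t using tensor_ind with
    | add a b ha hb => simp only [map_add, TensorProduct.tmul_add, mul_add, ha, hb]
    | tmul c d => simp [hM, hRL, Q.S_mul, mul_assoc]
  have k1 : ∀ (y : H ⊗[k] (H ⊗[k] H)) (t : H ⊗[k] (H ⊗[k] (H ⊗[k] H))),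
      Q.sandΔ Q.gamma (M (splitFst (H ⊗[k] H) Q.Δ y * t))
        = Q.sandΔ Q.gamma (M ((1 ⊗ₜ (1 ⊗ₜ dropFst (H ⊗[k] H) Q.ε y)) * t)) := by
    intro y t
    induction y using tensor_ind with
    | add a b ha hb => simp only [map_add, TensorProduct.tmul_add, add_mul, ha, hb]
    | tmul h y =>
      rw [splitFst_tmul, h1, sandΔ_mul, sandΔ_gamma_Δ, dropFst_tmul]
      simp [sandΔ, sandw_smul]
  have k2 : ∀ (y : H ⊗[k] (H ⊗[k] H)) (t : H ⊗[k] (H ⊗[k] (H ⊗[k] H))),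
      M (onSnd H (onSnd H Q.Δ) y * t)
        = M (onSnd H (onSnd H Algebra.TensorProduct.includeLeft)
          (onSnd H (onSnd H (Algebra.ofId k H)) (onSnd H (onSnd H Q.ε) y)) * t) := by
    intro y t
    induction y using tensor_ind with
    | add a b ha hb => simp only [map_add, add_mul, ha, hb]
    | tmul y1 y =>
    induction y using tensor_ind with
    | add a b ha hb => simp only [map_add, TensorProduct.tmul_add, add_mul, ha, hb]
    | tmul y2 y3 =>
    induction t using tensor_ind with
    | add a b ha hb => simp only [map_add, mul_add, ha, hb]
    | tmul a t =>
    induction t using tensor_ind with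
    | add a b ha hb => simp only [map_add, TensorProduct.tmul_add, mul_add, ha, hb]
    | tmul b t =>
      simp only [Algebra.TensorProduct.map_tmul, Algebra.TensorProduct.tmul_mul_tmul, hM,
        TensorProduct.map_tmul]
      simp [sandRL, sandL_Δ_mul, Algebra.ofId_apply, Algebra.algebraMap_eq_smul_one,
        TensorProduct.tmul_smul,
        ← Algebra.TensorProduct.one_def]
  have k3 : ∀ (y : H ⊗[k] (H ⊗[k] H)) (t : H ⊗[k] (H ⊗[k] (H ⊗[k] H))),
      M (t * onSnd H (splitFst H Q.Δ) y)
        = M (t * onSnd H ((padLeft H).comp (padLeft H)) (onSnd H (dropFst H Q.ε) y)) := by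
    intro y t
    induction y using tensor_ind with
    | add a b ha hb => simp only [map_add, mul_add, ha, hb]
    | tmul y1 y =>
    induction y using tensor_ind with
    | add a b ha hb => simp only [map_add, TensorProduct.tmul_add, mul_add, ha, hb]
    | tmul y2 y3 =>
    induction t using tensor_ind with
    | add a b ha hb => simp only [map_add, add_mul, ha, hb]
    | tmul a t =>
    induction t using tensor_ind with
    | add a b ha hb => simp only [map_add, TensorProduct.tmul_add, add_mul, ha, hb]
    | tmul b t =>
    induction t using tensor_ind with
    | add a b ha hb => simp only [map_add, TensorProduct.tmul_add, add_mul, ha, hb]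
    | tmul c d =>
      have h : ∀ e : H ⊗[k] H, sandRL Q.S.toLinearMap Q.β Q.α
          ((b ⊗ₜ (c ⊗ₜ d)) * TensorProduct.assoc k H H H (e ⊗ₜ y3))
          = sandR Q.S.toLinearMap Q.β ((b ⊗ₜ c) * e) * (Q.α * (d * y3)) := by
        intro e
        induction e using tensor_ind with
        | add a b ha hb => simp only [map_add, TensorProduct.add_tmul, mul_add, add_mul, ha, hb]
        | tmul e1 e2 => simp [hRL, sandR, mul_assoc, Q.S_mul]
      simp only [Algebra.TensorProduct.map_tmul, Algebra.TensorProduct.tmul_mul_tmul, hM,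
        TensorProduct.map_tmul, splitFst_tmul]
      rw [h, sandR_mul_Δ]
      simp [hRL, sandR, mul_assoc]
  -- The inverse pentagon solved for Φ⁻¹ ⊗ 1. Of its four factors the three containing Δ are removed
  -- by `k1`, `k2` and `k3`; the factor 1 ⊗ Φ gives X¹ β S(X²) α X³ = 1.
  have p : padRight H (↑Q.Φ⁻¹ : H ⊗[k] (H ⊗[k] H))
      = splitFst (H ⊗[k] H) Q.Δ (↑Q.Φ⁻¹ : H ⊗[k] (H ⊗[k] H)) *
        (onSnd H (onSnd H Q.Δ) (↑Q.Φ⁻¹ : H ⊗[k] (H ⊗[k] H))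
          * (padLeft H (Q.Φ : H ⊗[k] (H ⊗[k] H))
            * onSnd H (splitFst H Q.Δ) (Q.Φ : H ⊗[k] (H ⊗[k] H)))) := by
    rw [← mul_assoc, ← Q.pentagon_inv]
    simp only [mul_assoc]
    rw [← mul_assoc (padLeft H _) (padLeft H _), QuasiBialgebra.map_inv_mul_map, one_mul,
      QuasiBialgebra.map_inv_mul_map, mul_one]
  have c1 : dropFst (H ⊗[k] H) Q.ε (↑Q.Φ⁻¹ : H ⊗[k] (H ⊗[k] H)) = 1 :=
    QuasiBialgebra.inv_eq_one _ _ Q.Φ_counit_left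
  have c2 : onSnd H (onSnd H (Algebra.ofId k H)) (onSnd H (onSnd H Q.ε)
      (↑Q.Φ⁻¹ : H ⊗[k] (H ⊗[k] H))) = 1 := by
    have h := QuasiBialgebra.inv_eq_one _ _ Q.Φ_counit_right
    have e : ∀ t : H ⊗[k] (H ⊗[k] H), onSnd H (onSnd H (Algebra.ofId k H)) (onSnd H (onSnd H Q.ε) t)
        = onSnd H Algebra.TensorProduct.includeLeft (onSnd H (dropSnd H Q.ε) t) := by
      intro t
      induction t using tensor_ind with
      | add a b ha hb => simp only [map_add, ha, hb]
      | tmul a t =>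
      induction t using tensor_ind with
      | add a b ha hb => simp only [map_add, TensorProduct.tmul_add, ha, hb]
      | tmul b d => simp [Algebra.ofId_apply, Algebra.algebraMap_eq_smul_one,
          TensorProduct.tmul_smul]
    rw [e, h, map_one]
  have k4 : M (padLeft H (Q.Φ : H ⊗[k] (H ⊗[k] H))) = 1 := by
    change (1 : H) ⊗ₜ[k] sandRL Q.S.toLinearMap Q.β Q.α (Q.Φ : H ⊗[k] (H ⊗[k] H)) = 1
    rw [Q.antipode_Φ, Algebra.TensorProduct.one_def]
  have h0 : Q.drinfeldTwist * Q.Δ Q.α = Q.sandΔ Q.gamma (M (padRight H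
      (↑Q.Φ⁻¹ : H ⊗[k] (H ⊗[k] H)))) := by
    rw [pad, sandΔ_mul, sandΔ_tmul, map_one, SSop_one, one_mul, drinfeldTwist_eq]
  rw [h0, p, k1, c1, ← Algebra.TensorProduct.one_def, ← Algebra.TensorProduct.one_def, one_mul, k2,
    c2, map_one, one_mul, k3, Q.Φ_counit, map_one, mul_one, k4, sandΔ_one]

end QuasiHopfAlgebra

/-! ### Sandwiches with β, and those containing both α and β. -/

namespace QuasiHopfAlgebra

variable {k H : Type*} [Field k] [Ring H] [Algebra k H] (Q : QuasiHopfAlgebra k H)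

section Pi

variable (B : Type*) [Ring B] [Algebra k B]

/-- `a ⊗ b ⊗ c ↦ (a ⊗ c) w (S(b) ⊗ 1)`. -/
noncomputable def sandSR (w : H ⊗[k] B) : H ⊗[k] (H ⊗[k] B) →ₗ[k] H ⊗[k] B :=
  LinearMap.mul' k (H ⊗[k] B) ∘ₗ TensorProduct.map (inl k H B)
    (sandw (inr k H B) (inl k H B ∘ₗ Q.S.toLinearMap) w ∘ₗ (TensorProduct.comm k H B).toLinearMap)

variable {B}

@[simp] theorem sandSR_tmul (w : H ⊗[k] B) (a b : H) (c : B) :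
    Q.sandSR B w (a ⊗ₜ (b ⊗ₜ c)) = (a ⊗ₜ 1) * ((1 ⊗ₜ c) * w * (Q.S b ⊗ₜ 1)) := rfl

theorem sandSR_mul (w : H ⊗[k] B) (t u : H ⊗[k] (H ⊗[k] B)) :
    Q.sandSR B w (t * u) = Q.sandSR B (Q.sandSR B w u) t := by
  induction t using tensor_ind with
  | add a b ha hb => simp only [map_add, add_mul, ha, hb]
  | tmul t1 t =>
  induction t using tensor_ind with
  | add a b ha hb => simp only [map_add, TensorProduct.tmul_add, add_mul, ha, hb]
  | tmul t2 t3 =>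
  induction u using tensor_ind with
  | add a b ha hb =>
    simp only [map_add, mul_add, ha, hb, sandSR_tmul, add_mul]
  | tmul u1 u =>
  induction u using tensor_ind with
  | add a b ha hb =>
    simp only [map_add, TensorProduct.tmul_add, mul_add, ha, hb, sandSR_tmul, add_mul]
  | tmul u2 u3 =>
  simp only [sandSR_tmul, Algebra.TensorProduct.tmul_mul_tmul]
  induction w using tensor_ind with
  | add a b ha hb => simp only [mul_add, add_mul, ha, hb]
  | tmul a b => simp [Q.S_mul, mul_assoc]

theorem sandSR_mul_right (w : H ⊗[k] B) (c : B) (t : H ⊗[k] (H ⊗[k] B)) :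
    Q.sandSR B (w * (1 ⊗ₜ c)) t = Q.sandSR B w t * (1 ⊗ₜ c) := by
  induction t using tensor_ind with
  | add a b ha hb => simp only [map_add, add_mul, ha, hb]
  | tmul t1 t =>
  induction t using tensor_ind with
  | add a b ha hb => simp only [map_add, TensorProduct.tmul_add, add_mul, ha, hb]
  | tmul t2 t3 =>
  simp only [sandSR_tmul, mul_assoc, Algebra.TensorProduct.tmul_mul_tmul, one_mul, mul_one]

/-- `a ⊗ b ⊗ c ↦ a β S(b) ⊗ c`. -/
noncomputable def piS (B : Type*) [Ring B] [Algebra k B] : H ⊗[k] (H ⊗[k] B) →ₗ[k] H ⊗[k] B :=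
  Q.sandSR B (Q.β ⊗ₜ 1)

@[simp] theorem piS_tmul (a b : H) (c : B) :
    Q.piS B (a ⊗ₜ (b ⊗ₜ c)) = (a * Q.β * Q.S b) ⊗ₜ c := by simp [piS, mul_assoc]

theorem piS_mul (t u : H ⊗[k] (H ⊗[k] B)) : Q.piS B (t * u) = Q.sandSR B (Q.piS B u) t :=
  Q.sandSR_mul _ _ _

theorem piS_eq (t : H ⊗[k] (H ⊗[k] B)) :
    TensorProduct.map (sandR Q.S.toLinearMap Q.β) LinearMap.id
      ((TensorProduct.assoc k H H B).symm t) = Q.piS B t := by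
  induction t using tensor_ind with
  | add a b ha hb => simp only [map_add, ha, hb]
  | tmul a b =>
    induction b using tensor_ind with
    | add b c hb hc => simp only [map_add, TensorProduct.tmul_add, hb, hc]
    | tmul b c => rw [piS_tmul]; rfl

/-- S(y S⁻¹(x β)) = x β S(y). Working with (S ⊗ id)(p̃) removes the inverse antipode from all
computations. -/
theorem map_S_sandInv (t : H ⊗[k] (H ⊗[k] B)) :
    TensorProduct.map Q.S.toLinearMap LinearMap.id (TensorProduct.map (Q.sandInv Q.β) LinearMap.id
      ((TensorProduct.assoc k H H B).symm t)) = Q.piS B t := by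
  induction t using tensor_ind with
  | add a b ha hb => simp only [map_add, ha, hb]
  | tmul a b =>
    induction b using tensor_ind with
    | add b c hb hc => simp only [map_add, TensorProduct.tmul_add, hb, hc]
    | tmul b c =>
      rw [piS_tmul]
      simp [sandInv, Q.S_mul]

theorem piS_mul_splitFst (t : H ⊗[k] (H ⊗[k] B)) (y : H ⊗[k] B) :
    Q.piS B (t * splitFst B Q.Δ y) = Q.piS B t * (1 ⊗ₜ dropFst B Q.ε y) := by
  have h : Q.piS B (splitFst B Q.Δ y) = (Q.β ⊗ₜ 1) * (1 ⊗ₜ dropFst B Q.ε y) := by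
    rw [← piS_eq]
    induction y using tensor_ind with
    | add a b ha hb => simp only [map_add, TensorProduct.tmul_add, mul_add, ha, hb]
    | tmul a b =>
      rw [splitFst_tmul, LinearEquiv.symm_apply_apply, TensorProduct.map_tmul, Q.antipode_right]
      simp [TensorProduct.smul_tmul]
  rw [piS_mul, h, sandSR_mul_right, piS]

/-- `a ⊗ y ↦ (a β ⊗ 1) κ(y)`, that is, `a ⊗ b ⊗ c ⊗ d ↦ a β S(b) α c ⊗ d`. -/
noncomputable def sandRLB (B : Type*) [Ring B] [Algebra k B] :
    H ⊗[k] (H ⊗[k] (H ⊗[k] B)) →ₗ[k] H ⊗[k] B :=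
  LinearMap.mul' k (H ⊗[k] B) ∘ₗ
    TensorProduct.map (inl k H B ∘ₗ LinearMap.mulRight k Q.β) (Q.kap B)

theorem sandRLB_tmul (a : H) (y : H ⊗[k] (H ⊗[k] B)) :
    Q.sandRLB B (a ⊗ₜ y) = ((a * Q.β) ⊗ₜ 1) * Q.kap B y := rfl

/-- This lemma and the next two evaluate the three factors to which the pentagon reduces the product
of q̃ and p̃: α collapses the left one, β the right one, and Φ in the middle gives X¹ β S(X²) α X³.
-/
theorem sandRLB_splitFst_mul (y : H ⊗[k] (H ⊗[k] B)) (t : H ⊗[k] (H ⊗[k] (H ⊗[k] B))) :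
    Q.sandRLB B (onSnd H (splitFst B Q.Δ) y * t)
      = onSnd H (dropFst B Q.ε) y * Q.sandRLB B t := by
  induction y using tensor_ind with
  | add a b ha hb => simp only [map_add, add_mul, ha, hb]
  | tmul h z =>
    induction t using tensor_ind with
    | add b c hb hc => simp only [map_add, mul_add, hb, hc]
    | tmul a t =>
      rw [Algebra.TensorProduct.map_tmul, Algebra.TensorProduct.map_tmul,
        Algebra.TensorProduct.tmul_mul_tmul, sandRLB_tmul, kap_splitFst_mul, sandRLB_tmul]
      simp only [← mul_assoc, Algebra.TensorProduct.tmul_mul_tmul, mul_one, one_mul, AlgHom.coe_id,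
        id_eq]

theorem sandRLB_mul_splitFst (t : H ⊗[k] (H ⊗[k] (H ⊗[k] B))) (y : H ⊗[k] (H ⊗[k] B)) :
    Q.sandRLB B (t * splitFst (H ⊗[k] B) Q.Δ y)
      = Q.sandRLB B t * dropFst (H ⊗[k] B) Q.ε y := by
  induction y using tensor_ind with
  | add a b ha hb => simp only [map_add, mul_add, ha, hb]
  | tmul h z =>
    induction t using tensor_ind with
    | add b c hb hc => simp only [map_add, add_mul, hb, hc]
    | tmul a t =>
    induction t using tensor_ind with
    | add b c hb hc => simp only [map_add, TensorProduct.tmul_add, add_mul, hb, hc]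
    | tmul b t =>
      have key : ∀ e : H ⊗[k] H, Q.sandRLB B ((a ⊗ₜ (b ⊗ₜ t))
          * TensorProduct.assoc k H H (H ⊗[k] B) (e ⊗ₜ z))
          = (sandR Q.S.toLinearMap Q.β ((a ⊗ₜ b) * e) ⊗ₜ 1) * ((Q.α ⊗ₜ 1) * t * z) := by
        intro e
        induction e using tensor_ind with
        | add a b ha hb => simp only [map_add, TensorProduct.add_tmul, mul_add, add_mul, ha, hb]
        | tmul e1 e2 =>
          rw [TensorProduct.assoc_tmul, Algebra.TensorProduct.tmul_mul_tmul,
            Algebra.TensorProduct.tmul_mul_tmul, sandRLB_tmul, kap, sandS_tmul]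
          simp only [← mul_assoc, Algebra.TensorProduct.tmul_mul_tmul, sandR, mul_one,
            LinearMap.comp_apply, TensorProduct.map_tmul, LinearMap.mul'_apply,
            LinearMap.mulRight_apply, LinearEquiv.coe_coe]
      rw [splitFst_tmul, key, sandR_mul_Δ, dropFst_tmul, sandRLB_tmul, kap, sandS_tmul]
      simp only [sandR, LinearMap.comp_apply, TensorProduct.map_tmul, LinearMap.mul'_apply,
        LinearMap.mulRight_apply, LinearEquiv.coe_coe, mul_smul_comm, ← TensorProduct.smul_tmul',
        smul_mul_assoc, ← mul_assoc, Algebra.TensorProduct.tmul_mul_tmul, mul_one]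

theorem sandRLB_padRight (t : H ⊗[k] (H ⊗[k] H)) :
    Q.sandRLB B (padRight B t) = sandRL Q.S.toLinearMap Q.β Q.α t ⊗ₜ 1 := by
  induction t using tensor_ind with
  | add a b ha hb => simp only [map_add, TensorProduct.add_tmul, ha, hb]
  | tmul a t =>
  induction t using tensor_ind with
  | add a b ha hb => simp only [map_add, TensorProduct.tmul_add, TensorProduct.add_tmul, ha, hb]
  | tmul b c => simp [sandRLB_tmul, sandRL, sandL]

/-- `a ⊗ b ⊗ c ⊗ d ↦ S(a) α b β S(c) ⊗ d`. -/
noncomputable def sandLRB (B : Type*) [Ring B] [Algebra k B] :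
    H ⊗[k] (H ⊗[k] (H ⊗[k] B)) →ₗ[k] H ⊗[k] B :=
  LinearMap.mul' k (H ⊗[k] B) ∘ₗ
    TensorProduct.map (inl k H B ∘ₗ LinearMap.mulRight k Q.α ∘ₗ Q.S.toLinearMap) (Q.piS B)

theorem sandLRB_tmul (a : H) (y : H ⊗[k] (H ⊗[k] B)) :
    Q.sandLRB B (a ⊗ₜ y) = ((Q.S a * Q.α) ⊗ₜ 1) * Q.piS B y := rfl

/-- The counterpart with α and β exchanged: α collapses a factor on the left, β one on the right,
and Φ⁻¹ in the middle gives S(x¹) α x² β S(x³). -/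
theorem sandLRB_splitFst_mul (y : H ⊗[k] (H ⊗[k] B)) (t : H ⊗[k] (H ⊗[k] (H ⊗[k] B))) :
    Q.sandLRB B (splitFst (H ⊗[k] B) Q.Δ y * t)
      = Q.sandLRB B ((1 ⊗ₜ (1 ⊗ₜ dropFst (H ⊗[k] B) Q.ε y)) * t) := by
  induction y using tensor_ind with
  | add a b ha hb => simp only [map_add, TensorProduct.tmul_add, add_mul, ha, hb]
  | tmul h y =>
  induction y using tensor_ind with
  | add a b ha hb => simp only [map_add, TensorProduct.tmul_add, add_mul, ha, hb]
  | tmul y1 y2 =>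
  induction t using tensor_ind with
  | add b c hb hc => simp only [map_add, mul_add, hb, hc]
  | tmul a t =>
  induction t using tensor_ind with
  | add b c hb hc => simp only [map_add, TensorProduct.tmul_add, mul_add, hb, hc]
  | tmul b t =>
  induction t using tensor_ind with
  | add b c hb hc => simp only [map_add, TensorProduct.tmul_add, mul_add, hb, hc]
  | tmul c d =>
    have key : ∀ e : H ⊗[k] H, Q.sandLRB B (TensorProduct.assoc k H H (H ⊗[k] B)
        (e ⊗ₜ (y1 ⊗ₜ y2)) * (a ⊗ₜ (b ⊗ₜ (c ⊗ₜ d))))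
        = (sandL Q.S.toLinearMap Q.α (e * (a ⊗ₜ b)) * Q.β * Q.S (y1 * c)) ⊗ₜ (y2 * d) := by
      intro e
      induction e using tensor_ind with
      | add a b ha hb => simp only [map_add, TensorProduct.add_tmul, add_mul, ha, hb]
      | tmul e1 e2 => simp [sandLRB_tmul, sandL, mul_assoc]
    rw [splitFst_tmul, key, sandL_Δ_mul, dropFst_tmul]
    simp [sandLRB_tmul, sandL, TensorProduct.tmul_smul, ← TensorProduct.smul_tmul', mul_assoc]

theorem sandLRB_mul_splitFst (t : H ⊗[k] (H ⊗[k] (H ⊗[k] B))) (y : H ⊗[k] (H ⊗[k] B)) :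
    Q.sandLRB B (t * onSnd H (splitFst B Q.Δ) y)
      = Q.sandLRB B (t * onSnd H ((padLeft H).comp (padLeft H)) (onSnd H (dropFst B Q.ε) y)) := by
  induction y using tensor_ind with
  | add a b ha hb => simp only [map_add, mul_add, ha, hb]
  | tmul h z =>
    induction t using tensor_ind with
    | add b c hb hc => simp only [map_add, add_mul, hb, hc]
    | tmul a t =>
      rw [Algebra.TensorProduct.map_tmul, Algebra.TensorProduct.tmul_mul_tmul, sandLRB_tmul,
        piS_mul_splitFst, Algebra.TensorProduct.map_tmul, Algebra.TensorProduct.map_tmul,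
        Algebra.TensorProduct.tmul_mul_tmul, sandLRB_tmul]
      congr 1
      induction t using tensor_ind with
      | add b c hb hc => simp only [map_add, add_mul, hb, hc]
      | tmul b t =>
      induction t using tensor_ind with
      | add b c hb hc => simp only [map_add, TensorProduct.tmul_add, add_mul, hb, hc]
      | tmul b c => simp

theorem sandLRB_padRight (t : H ⊗[k] (H ⊗[k] H)) :
    Q.sandLRB B (padRight B t) = sandLR Q.S.toLinearMap Q.α Q.β t ⊗ₜ 1 := by
  induction t using tensor_ind with
  | add a b ha hb => simp only [map_add, TensorProduct.add_tmul, ha, hb]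
  | tmul a t =>
  induction t using tensor_ind with
  | add a b ha hb => simp only [map_add, TensorProduct.tmul_add, TensorProduct.add_tmul, ha, hb]
  | tmul b c => simp [sandLRB_tmul, sandLR, sandR]

end Pi

end QuasiHopfAlgebra

/-! ### The relations between p̃ and q̃ in a left comodule algebra. -/

section Left

variable {k H A : Type*} [Field k] [Ring H] [Algebra k H] [Ring A] [Algebra k A]

namespace LeftComoduleAlgebra

variable {Q : QuasiBialgebra k H} (L : LeftComoduleAlgebra Q A)

theorem Φlam_inv_counit_left :
    dropFst (H ⊗[k] A) Q.ε (↑L.Φlam⁻¹ : H ⊗[k] (H ⊗[k] A)) = 1 :=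
  QuasiBialgebra.inv_eq_one _ _ L.Φlam_counit_left

theorem Φlam_inv_counit_mid :
    onSnd H (dropFst A Q.ε) (↑L.Φlam⁻¹ : H ⊗[k] (H ⊗[k] A)) = 1 :=
  QuasiBialgebra.inv_eq_one _ _ L.Φlam_counit_mid

theorem Φlam_inv_coassoc (a : A) :
    (↑L.Φlam⁻¹ : H ⊗[k] (H ⊗[k] A)) * onSnd H L.lam (L.lam a)
      = splitFst A Q.Δ (L.lam a) * (↑L.Φlam⁻¹ : H ⊗[k] (H ⊗[k] A)) := by
  have h := L.coassoc a
  rw [← Units.eq_mul_inv_iff_mul_eq] at h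
  rw [h, mul_assoc, Units.inv_mul_cancel_left]

theorem pentagon_inv :
    padRight A (↑Q.Φ⁻¹ : H ⊗[k] (H ⊗[k] H)) * onSnd H (splitFst A Q.Δ)
        (↑L.Φlam⁻¹ : H ⊗[k] (H ⊗[k] A)) * padLeft H (↑L.Φlam⁻¹ : H ⊗[k] (H ⊗[k] A))
      = splitFst (H ⊗[k] A) Q.Δ (↑L.Φlam⁻¹ : H ⊗[k] (H ⊗[k] A)) *
        onSnd H (onSnd H L.lam) (↑L.Φlam⁻¹ : H ⊗[k] (H ⊗[k] A)) := by
  have h := congrArg Units.inv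
    (show Units.map (padLeft (k := k) H : _ →ₐ[k] _).toMonoidHom L.Φlam
        * Units.map (onSnd H (splitFst A Q.Δ)).toMonoidHom L.Φlam
        * Units.map (padRight A).toMonoidHom Q.Φ
      = Units.map (onSnd H (onSnd H L.lam)).toMonoidHom L.Φlam
        * Units.map (splitFst (H ⊗[k] A) Q.Δ).toMonoidHom L.Φlam from Units.ext L.pentagon)
  simpa [mul_assoc] using h

/-- The left side is the product in which q̃ meets λ of p̃; the pentagon replaces it by factors that
the antipode sandwiches can evaluate. -/
theorem padLeft_inv_mul :
    padLeft H (↑L.Φlam⁻¹ : H ⊗[k] (H ⊗[k] A)) * onSnd H (onSnd H L.lam) (L.Φlam : H ⊗[k] (H ⊗[k] A))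
      = onSnd H (splitFst A Q.Δ) (L.Φlam : H ⊗[k] (H ⊗[k] A))
        * padRight A (Q.Φ : H ⊗[k] (H ⊗[k] H))
        * splitFst (H ⊗[k] A) Q.Δ (↑L.Φlam⁻¹ : H ⊗[k] (H ⊗[k] A)) := by
  have h := L.pentagon
  calc _ = padLeft H (↑L.Φlam⁻¹ : H ⊗[k] (H ⊗[k] A))
        * (onSnd H (onSnd H L.lam) (L.Φlam : H ⊗[k] (H ⊗[k] A))
          * splitFst (H ⊗[k] A) Q.Δ (L.Φlam : H ⊗[k] (H ⊗[k] A)))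
        * splitFst (H ⊗[k] A) Q.Δ (↑L.Φlam⁻¹ : H ⊗[k] (H ⊗[k] A)) := by
        rw [mul_assoc, mul_assoc, QuasiBialgebra.map_mul_map_inv, mul_one]
    _ = _ := by
        rw [← h, ← mul_assoc, ← mul_assoc, QuasiBialgebra.map_inv_mul_map, one_mul]

/-- The same device for the opposite order, where λ of q̃ meets p̃. -/
theorem lam_inv_mul_padLeft :
    onSnd H (onSnd H L.lam) (↑L.Φlam⁻¹ : H ⊗[k] (H ⊗[k] A)) * padLeft H (L.Φlam : H ⊗[k] (H ⊗[k] A))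
      = splitFst (H ⊗[k] A) Q.Δ (L.Φlam : H ⊗[k] (H ⊗[k] A))
        * padRight A (↑Q.Φ⁻¹ : H ⊗[k] (H ⊗[k] H))
        * onSnd H (splitFst A Q.Δ) (↑L.Φlam⁻¹ : H ⊗[k] (H ⊗[k] A)) := by
  have h := L.pentagon_inv
  calc _ = splitFst (H ⊗[k] A) Q.Δ (L.Φlam : H ⊗[k] (H ⊗[k] A))
        * (splitFst (H ⊗[k] A) Q.Δ (↑L.Φlam⁻¹ : H ⊗[k] (H ⊗[k] A)) *
        onSnd H (onSnd H L.lam) (↑L.Φlam⁻¹ : H ⊗[k] (H ⊗[k] A)))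
        * padLeft H (L.Φlam : H ⊗[k] (H ⊗[k] A)) := by
        rw [← mul_assoc, QuasiBialgebra.map_mul_map_inv, one_mul]
    _ = _ := by
        rw [← h, mul_assoc, mul_assoc, mul_assoc, QuasiBialgebra.map_inv_mul_map, mul_one,
          mul_assoc]

end LeftComoduleAlgebra

variable (Q : QuasiHopfAlgebra k H) (L : LeftComoduleAlgebra Q.toQuasiBialgebra A)

/-- `q̃ = S(x¹) α x² ⊗ x³`. -/
noncomputable def qEl : H ⊗[k] A := Q.kap A (↑L.Φlam⁻¹ : H ⊗[k] (H ⊗[k] A))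

/-- `(S ⊗ id)(p̃) = X¹ β S(X²) ⊗ X³`. -/
noncomputable def pEl : H ⊗[k] A := Q.piS A (L.Φlam : H ⊗[k] (H ⊗[k] A))

/-- `S(u_[-1]) q̃¹ u_[0][-1] ⊗ q̃² u_[0][0] = q̃¹ ⊗ u q̃²`. -/
theorem sandS_qEl (u : A) :
    Q.sandS A (qEl Q L) (onSnd H L.lam (L.lam u)) = (1 ⊗ₜ u) * qEl Q L := by
  rw [qEl, ← Q.kap_mul, L.Φlam_inv_coassoc, Q.kap_splitFst_mul, L.counit]

/-- `u_[-1] S(p̃¹) S(u_[0][-1]) ⊗ u_[0][0] p̃² = S(p̃¹) ⊗ p̃² u`. -/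
theorem sandSR_pEl (u : A) :
    Q.sandSR A (pEl Q L) (onSnd H L.lam (L.lam u)) = pEl Q L * (1 ⊗ₜ u) := by
  rw [pEl, ← Q.piS_mul, L.coassoc, Q.piS_mul_splitFst, L.counit]

/-- `S(p̃¹) q̃¹ p̃²_[-1] ⊗ q̃² p̃²_[0] = 1 ⊗ 1`. -/
theorem sandw_qEl_pEl :
    sandw (inl k H A) L.lam.toLinearMap (qEl Q L) (pEl Q L) = 1 := by
  -- Substituting the definitions of q̃ and p̃ turns the expression into one sandwich, a β S(b) α c,
  -- of the element (1 ⊗ Φ_λ⁻¹)(id ⊗ id ⊗ λ)(Φ_λ).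
  have key : ∀ s t : H ⊗[k] (H ⊗[k] A), sandw (inl k H A) L.lam.toLinearMap (Q.kap A s)
      (Q.piS A t) = Q.sandRLB A (padLeft H s * onSnd H (onSnd H L.lam) t) := by
    intro s t
    induction t using tensor_ind with
    | add a b ha hb => simp only [map_add, mul_add, ha, hb]
    | tmul a t =>
    induction t using tensor_ind with
    | add a b ha hb => simp only [map_add, TensorProduct.tmul_add, mul_add, ha, hb]
    | tmul b c =>
      simp [QuasiHopfAlgebra.sandRLB_tmul, QuasiHopfAlgebra.kap_mul, ← mul_assoc]
  rw [qEl, pEl, key, L.padLeft_inv_mul, mul_assoc, Q.sandRLB_splitFst_mul, L.Φlam_counit_mid,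
    one_mul, Q.sandRLB_mul_splitFst, L.Φlam_inv_counit_left, mul_one, Q.sandRLB_padRight,
    Q.antipode_Φ, Algebra.TensorProduct.one_def]

/-- `q̃¹ S(p̃¹) S(q̃²_[-1]) ⊗ q̃²_[0] p̃² = 1 ⊗ 1`. -/
theorem sandSR_pEl_qEl : Q.sandSR A (pEl Q L) (onSnd H L.lam (qEl Q L)) = 1 := by
  -- Here the sandwich is S(a) α b β S(c) and the element is (id ⊗ id ⊗ λ)(Φ_λ⁻¹)(1 ⊗ Φ_λ).
  have key : ∀ s t : H ⊗[k] (H ⊗[k] A), Q.sandSR A (Q.piS A s) (onSnd H L.lam (Q.kap A t))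
      = Q.sandLRB A (onSnd H (onSnd H L.lam) t * padLeft H s) := by
    intro s t
    induction t using tensor_ind with
    | add a b ha hb => simp only [map_add, add_mul, ha, hb]
    | tmul a t =>
    induction t using tensor_ind with
    | add a b ha hb => simp only [map_add, TensorProduct.tmul_add, add_mul, ha, hb]
    | tmul b c =>
      simp only [QuasiHopfAlgebra.kap_tmul, Algebra.TensorProduct.map_tmul, AlgHom.coe_id, id_eq,
        Algebra.TensorProduct.includeRight_apply, Algebra.TensorProduct.tmul_mul_tmul, mul_one,
        QuasiHopfAlgebra.sandLRB_tmul, QuasiHopfAlgebra.piS_mul]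
      induction L.lam c using tensor_ind with
      | add a b ha hb => simp only [map_add, TensorProduct.tmul_add, mul_add, ha, hb]
      | tmul c d =>
        simp only [QuasiHopfAlgebra.sandSR_tmul, ← mul_assoc, Algebra.TensorProduct.tmul_mul_tmul,
          one_mul, mul_one]
  have h1 : ∀ t : H ⊗[k] (H ⊗[k] (H ⊗[k] A)), Q.sandLRB A (splitFst (H ⊗[k] A) Q.Δ
      (L.Φlam : H ⊗[k] (H ⊗[k] A)) * t) = Q.sandLRB A t := by
    intro t
    rw [Q.sandLRB_splitFst_mul, L.Φlam_counit_left, ← Algebra.TensorProduct.one_def,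
      ← Algebra.TensorProduct.one_def, one_mul]
  rw [qEl, pEl, key, L.lam_inv_mul_padLeft, mul_assoc, h1, Q.sandLRB_mul_splitFst,
    L.Φlam_inv_counit_mid, map_one, mul_one, Q.sandLRB_padRight, Q.antipode_Φ_inv,
    Algebra.TensorProduct.one_def]

/-- Uses ε(α) = 1 and ε ∘ S = ε: both H-legs of Φ_λ⁻¹ are then evaluated by ε. Needed for the counit
condition of the q̃-twist; `dropFst_pEl` plays the same role for the p̃-twist. -/
theorem dropFst_qEl : dropFst A Q.ε (qEl Q L) = 1 := by
  have key : ∀ t : H ⊗[k] (H ⊗[k] A), dropFst A Q.ε (Q.kap A t)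
      = dropFst A Q.ε (dropFst (H ⊗[k] A) Q.ε t) := by
    intro t
    induction t using tensor_ind with
    | add a b ha hb => simp only [map_add, ha, hb]
    | tmul a t =>
    induction t using tensor_ind with
    | add a b ha hb => simp only [map_add, TensorProduct.tmul_add, ha, hb]
    | tmul b c => simp [Q.ε_α, mul_smul]
  rw [qEl, key, L.Φlam_inv_counit_left, map_one]

theorem dropFst_pEl : dropFst A Q.ε (pEl Q L) = 1 := by
  have key : ∀ t : H ⊗[k] (H ⊗[k] A), dropFst A Q.ε (Q.piS A t)
      = dropFst A Q.ε (dropFst (H ⊗[k] A) Q.ε t) := by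
    intro t
    induction t using tensor_ind with
    | add a b ha hb => simp only [map_add, ha, hb]
    | tmul a t =>
    induction t using tensor_ind with
    | add a b ha hb => simp only [map_add, TensorProduct.tmul_add, ha, hb]
    | tmul b c => simp [Q.ε_β, mul_smul]
  rw [pEl, key, L.Φlam_counit_left, map_one]

/-- `(1 ⊗ q̃)(id ⊗ λ)(q̃)`. -/
noncomputable def qqEl : H ⊗[k] (H ⊗[k] A) :=
  padLeft H (qEl Q L) * onSnd H L.lam (qEl Q L)

/-- `a ⊗ b ⊗ u ↦ (S(b) ⊗ S(a) ⊗ 1) w (id ⊗ λ)(λ(u))`. -/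
noncomputable def sandSS (w : H ⊗[k] (H ⊗[k] A)) : H ⊗[k] (H ⊗[k] A) →ₗ[k] H ⊗[k] (H ⊗[k] A) :=
  sandw ((TensorProduct.assoc k H H A).toLinearMap ∘ₗ inl k (H ⊗[k] H) A ∘ₗ Q.SSop)
    ((onSnd H L.lam).comp L.lam).toLinearMap w ∘ₗ (TensorProduct.assoc k H H A).symm.toLinearMap

theorem sandSS_tmul (w : H ⊗[k] (H ⊗[k] A)) (a b : H) (u : A) :
    sandSS Q L w (a ⊗ₜ (b ⊗ₜ u))
      = (Q.S b ⊗ₜ (Q.S a ⊗ₜ 1)) * w * onSnd H L.lam (L.lam u) := rfl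

/-- Each collapse forms an S(·) α (·). Since S reverses products, the first two legs of `u` come out
on the far left as S(u²) ⊗ S(u¹), while what remains in between is the product of two elements of
the type of q̃. -/
theorem sandSS_kap (s t u : H ⊗[k] (H ⊗[k] A)) :
    TensorProduct.map LinearMap.id (Q.kap A) ((1 ⊗ₜ s) * Q.kapMid (H ⊗[k] A)
      (padLeft H (onSnd H (onSnd H L.lam) t)
        * onSnd H (onSnd H ((onSnd H L.lam).comp L.lam)) u))
      = sandSS Q L (padLeft H (Q.kap A s) * onSnd H L.lam (Q.kap A t)) u := by
  induction u using tensor_ind with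
  | add a b ha hb => simp only [map_add, mul_add, ha, hb]
  | tmul u1 u =>
  induction u using tensor_ind with
  | add a b ha hb => simp only [map_add, TensorProduct.tmul_add, mul_add, ha, hb]
  | tmul u2 u3 =>
  rw [sandSS_tmul]
  induction t using tensor_ind with
  | add a b ha hb => simp only [map_add, mul_add, add_mul, ha, hb]
  | tmul t1 t =>
  induction t using tensor_ind with
  | add a b ha hb => simp only [map_add, TensorProduct.tmul_add, mul_add, add_mul, ha, hb]
  | tmul t2 t3 =>
  simp only [Algebra.TensorProduct.map_tmul, AlgHom.coe_comp, Function.comp_apply]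
  induction L.lam u3 using tensor_ind with
  | add a b ha hb => simp only [map_add, TensorProduct.tmul_add, mul_add, ha, hb]
  | tmul e1 e2 => simp [QuasiHopfAlgebra.kap_mul, Q.S_mul, mul_assoc]

/-- The intertwining property and f Δ(α) = γ combine to f Δ(S(a) α b) = (S ⊗ S)(Δ^cop(a)) γ Δ(b). -/
theorem drinfeldTwist_mul_kap {B : Type*} [Ring B] [Algebra k B]
    (t' : H ⊗[k] (H ⊗[k] (H ⊗[k] H))) (ht' : Q.gammaMap t' = Q.gamma) (t : H ⊗[k] (H ⊗[k] B)) :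
    TensorProduct.assoc k H H B (Q.drinfeldTwist ⊗ₜ 1) * splitFst B Q.Δ (Q.kap B t)
      = Q.gam B (onSnd H (padRight B) t'
        * splitFst (H ⊗[k] (H ⊗[k] B)) Q.Δ (onSnd H (splitFst B Q.Δ) t)) := by
  induction t using tensor_ind with
  | add a b ha hb => simp only [map_add, mul_add, ha, hb]
  | tmul t1 t =>
  induction t using tensor_ind with
  | add a b ha hb => simp only [map_add, TensorProduct.tmul_add, mul_add, ha, hb]
  | tmul t2 t3 =>
    rw [Algebra.TensorProduct.map_tmul, splitFst_tmul, splitFst_tmul, Q.gam_pad_mul, ht',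
      Q.kap_tmul,
      splitFst_tmul, ← assoc_mul, Algebra.TensorProduct.tmul_mul_tmul, one_mul, map_mul, map_mul,
      ← mul_assoc, ← mul_assoc, ← Q.SSop_mul_drinfeldTwist, mul_assoc _ _ (Q.Δ Q.α),
      Q.drinfeldTwist_mul_Δ_α]
    rfl

end Left

/-! ### Naturality of the operations on legs. -/

section Naturality

variable {k : Type*} [Field k] {X Y Z W W' : Type*} [Ring X] [Algebra k X] [Ring Y] [Algebra k Y]
  [Ring Z] [Algebra k Z] [Ring W] [Algebra k W] [Ring W'] [Algebra k W']

theorem splitFst_natural (f : X →ₐ[k] Y ⊗[k] Z) (g : W →ₐ[k] W') (t : X ⊗[k] W) :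
    splitFst W' f (onSnd X g t) = onSnd Y (onSnd Z g) (splitFst W f t) := by
  induction t using tensor_ind with
  | add a b ha hb => simp only [map_add, ha, hb]
  | tmul a b =>
    have h : ∀ e : Y ⊗[k] Z, TensorProduct.assoc k Y Z W' (e ⊗ₜ g b)
        = onSnd Y (onSnd Z g) (TensorProduct.assoc k Y Z W (e ⊗ₜ b)) := by
      intro e
      induction e using tensor_ind with
      | add a b ha hb => simp only [map_add, TensorProduct.add_tmul, ha, hb]
      | tmul c d => simp
    rw [Algebra.TensorProduct.map_tmul, splitFst_tmul, splitFst_tmul, ← h]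
    rfl

theorem dropFst_natural (e : X →ₐ[k] k) (g : W →ₐ[k] W') (t : X ⊗[k] W) :
    dropFst W' e (onSnd X g t) = g (dropFst W e t) := by
  induction t using tensor_ind with
  | add a b ha hb => simp only [map_add, ha, hb]
  | tmul a b => simp

end Naturality

/-! ### The Drinfeld twist against q̃. -/

section Left

variable {k H A : Type*} [Field k] [Ring H] [Algebra k H] [Ring A] [Algebra k A]
variable (Q : QuasiHopfAlgebra k H) (L : LeftComoduleAlgebra Q.toQuasiBialgebra A)

theorem onSnd_onSnd_lam_counit :
    onSnd H (dropFst (H ⊗[k] A) Q.ε)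
      (onSnd H (onSnd H L.lam) (L.Φlam : H ⊗[k] (H ⊗[k] A))) = 1 := by
  have key : ∀ t : H ⊗[k] (H ⊗[k] A), onSnd H (dropFst (H ⊗[k] A) Q.ε) (onSnd H (onSnd H L.lam) t)
      = onSnd H L.lam (onSnd H (dropFst A Q.ε) t) := by
    intro t
    induction t using tensor_ind with
    | add a b ha hb => simp only [map_add, ha, hb]
    | tmul a t =>
      rw [Algebra.TensorProduct.map_tmul, Algebra.TensorProduct.map_tmul,
        Algebra.TensorProduct.map_tmul, Algebra.TensorProduct.map_tmul, dropFst_natural]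
  rw [key, L.Φlam_counit_mid, map_one]

/-- `padLeft_inv_mul` with λ applied to the last leg throughout; naturality identifies each factor.
-/
theorem padLeft_lam_inv_mul :
    padLeft H (onSnd H (onSnd H L.lam) (↑L.Φlam⁻¹ : H ⊗[k] (H ⊗[k] A)))
        * onSnd H (onSnd H ((onSnd H L.lam).comp L.lam)) (L.Φlam : H ⊗[k] (H ⊗[k] A))
      = onSnd H (splitFst (H ⊗[k] A) Q.Δ) (onSnd H (onSnd H L.lam) (L.Φlam : H ⊗[k] (H ⊗[k] A)))
        * padRight (H ⊗[k] A) (Q.Φ : H ⊗[k] (H ⊗[k] H))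
        * splitFst (H ⊗[k] (H ⊗[k] A)) Q.Δ
          (onSnd H (onSnd H L.lam) (↑L.Φlam⁻¹ : H ⊗[k] (H ⊗[k] A))) := by
  have n := congrArg (onSnd H (onSnd H (onSnd H L.lam))) L.padLeft_inv_mul
  have n1 : ∀ t : H ⊗[k] (H ⊗[k] A), onSnd H (onSnd H (onSnd H L.lam)) (onSnd H (splitFst A Q.Δ) t)
      = onSnd H (splitFst (H ⊗[k] A) Q.Δ) (onSnd H (onSnd H L.lam) t) := by
    intro t
    induction t using tensor_ind with
    | add a b ha hb => simp only [map_add, ha, hb]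
    | tmul a t =>
      rw [Algebra.TensorProduct.map_tmul, Algebra.TensorProduct.map_tmul,
        Algebra.TensorProduct.map_tmul, Algebra.TensorProduct.map_tmul, splitFst_natural]
  have n2 : ∀ t : H ⊗[k] (H ⊗[k] H), onSnd H (onSnd H (onSnd H L.lam)) (padRight A t)
      = padRight (H ⊗[k] A) t := by
    intro t
    induction t using tensor_ind with
    | add a b ha hb => simp only [map_add, ha, hb]
    | tmul a t =>
    induction t using tensor_ind with
    | add a b ha hb => simp only [map_add, TensorProduct.tmul_add, ha, hb]
    | tmul b c => simp
  have n3 : ∀ t : H ⊗[k] (H ⊗[k] A), onSnd H (onSnd H (onSnd H L.lam)) (onSnd H (onSnd H L.lam) t)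
      = onSnd H (onSnd H ((onSnd H L.lam).comp L.lam)) t := by
    intro t
    induction t using tensor_ind with
    | add a b ha hb => simp only [map_add, ha, hb]
    | tmul a t =>
      rw [Algebra.TensorProduct.map_tmul, Algebra.TensorProduct.map_tmul,
        Algebra.TensorProduct.map_tmul, onSnd_comp_apply]
      rfl
  rw [map_mul, map_mul, map_mul, n1, n2, n3, ← splitFst_natural] at n
  exact n

/-- After f has been replaced by γ, the Φ⁻¹ contained in γ stands next to (id ⊗ Δ ⊗ id)(Φ_λ⁻¹) and 1
⊗ Φ_λ⁻¹, one side of the inverse pentagon. Its other side has a doubly comultiplied first leg, which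
quasi-coassociativity moves past Φ and the inner collapse reduces to a single Φ_λ⁻¹. -/
theorem drinfeldTwist_mul_qEl_eq :
    TensorProduct.assoc k H H A (Q.drinfeldTwist ⊗ₜ 1) * splitFst A Q.Δ (qEl Q L)
        * (↑L.Φlam⁻¹ : H ⊗[k] (H ⊗[k] A))
      = TensorProduct.map LinearMap.id (Q.kap A) ((1 ⊗ₜ (↑L.Φlam⁻¹ : H ⊗[k] (H ⊗[k] A)))
        * Q.kapMid (H ⊗[k] A)
        (padRight (H ⊗[k] A) (Q.Φ : H ⊗[k] (H ⊗[k] H))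
          * splitFst (H ⊗[k] (H ⊗[k] A)) Q.Δ
            (onSnd H (onSnd H L.lam) (↑L.Φlam⁻¹ : H ⊗[k] (H ⊗[k] A))))) := by
  set Ψ : H ⊗[k] (H ⊗[k] A) := (↑L.Φlam⁻¹ : H ⊗[k] (H ⊗[k] A)) with hΨ
  set t' := padRight H (Q.Φ : H ⊗[k] (H ⊗[k] H)) *
    splitFst (H ⊗[k] H) Q.Δ (↑Q.Φ⁻¹ : H ⊗[k] (H ⊗[k] H)) with ht'
  have p1 : ∀ t : H ⊗[k] (H ⊗[k] H),
      onSnd H (padRight A) (padRight H t) = padRight (H ⊗[k] A) t := by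
    intro t
    induction t using tensor_ind with
    | add a b ha hb => simp only [map_add, ha, hb]
    | tmul a t =>
    induction t using tensor_ind with
    | add a b ha hb => simp only [map_add, TensorProduct.tmul_add, ha, hb]
    | tmul b c => simp [Algebra.TensorProduct.one_def]
  have p2 : ∀ t : H ⊗[k] (H ⊗[k] H), onSnd H (padRight A) (splitFst (H ⊗[k] H) Q.Δ t)
      = splitFst (H ⊗[k] (H ⊗[k] A)) Q.Δ (padRight A t) := by
    intro t
    unfold padRight
    rw [splitFst_natural]
  have p3 : (1 : H) ⊗ₜ[k] ((1 : H) ⊗ₜ[k] Ψ) = splitFst (H ⊗[k] (H ⊗[k] A)) Q.Δ (padLeft H Ψ) := by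
    rw [Algebra.TensorProduct.includeRight_apply, splitFst_tmul, map_one,
      Algebra.TensorProduct.one_def, TensorProduct.assoc_tmul]
  have p0 : onSnd H (padRight A) t' = padRight (H ⊗[k] A) (Q.Φ : H ⊗[k] (H ⊗[k] H)) *
      splitFst (H ⊗[k] (H ⊗[k] A)) Q.Δ (padRight A (↑Q.Φ⁻¹ : H ⊗[k] (H ⊗[k] H))) := by
    rw [← p1, ← p2, ht', map_mul]
  rw [qEl, drinfeldTwist_mul_kap Q t' rfl, ← Q.gam_mul_right, p3, p0, mul_assoc,
      mul_assoc, ← map_mul (splitFst _ _), ← map_mul (splitFst _ _), ← mul_assoc (padRight A _), hΨ,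
      L.pentagon_inv, map_mul (splitFst _ _),
      ← mul_assoc, Q.padRight_coassoc, mul_assoc]
  unfold QuasiHopfAlgebra.gam
  rw [LinearMap.comp_apply, Q.kapMid_splitFst_mul, Q.onSnd_dropFst_splitFst]

/-- Both sides reduce to the same nested collapse. For the right side, the pentagon produces a
leftmost factor (id ⊗ Δ ⊗ id)(Φ_λ), with λ applied, whose collapse is 1 by the counit normalization.
The formula is the reason why the twist f belongs in the reassociator of A². -/
theorem drinfeldTwist_mul_qEl :
    TensorProduct.assoc k H H A (Q.drinfeldTwist ⊗ₜ 1) * splitFst A Q.Δ (qEl Q L)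
        * (↑L.Φlam⁻¹ : H ⊗[k] (H ⊗[k] A))
      = sandSS Q L (qqEl Q L) (L.Φlam : H ⊗[k] (H ⊗[k] A)) := by
  rw [drinfeldTwist_mul_qEl_eq, qqEl, qEl, ← sandSS_kap, padLeft_lam_inv_mul, mul_assoc,
    Q.kapMid_splitFst_mul, onSnd_onSnd_lam_counit, ← Algebra.TensorProduct.one_def, one_mul]

end Left

/-! ### The mixed reassociator Θ against q̃. -/

section Bi

variable {k H A : Type*} [Field k] [Ring H] [Algebra k H] [Ring A] [Algebra k A]

/-- Not an axiom: applying ε to the second leg of the left pentagon leaves (1 ⊗ (ε ⊗ id ⊗ id)(Θ)) Θ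
= Θ, because both factors coming from Φ_λ become 1. -/
theorem BicomoduleAlgebra.Θ_counit_left {Q : QuasiBialgebra k H} (𝔸 : BicomoduleAlgebra Q A) :
    dropFst (A ⊗[k] H) Q.ε (𝔸.Θ : H ⊗[k] (A ⊗[k] H)) = 1 := by
  have h := congrArg (onSnd H (dropFst (A ⊗[k] H) Q.ε)) 𝔸.pentagon_left
  have e1 : ∀ t : H ⊗[k] (A ⊗[k] H), onSnd H (dropFst (A ⊗[k] H) Q.ε) (padLeft H t)
      = 1 ⊗ₜ dropFst (A ⊗[k] H) Q.ε t := by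
    intro t; simp
  have e2 : ∀ y : A ⊗[k] H, dropFst (A ⊗[k] H) Q.ε (splitFst H 𝔸.left.lam y) = y := by
    intro y
    induction y using tensor_ind with
    | add a b ha hb => simp only [map_add, ha, hb]
    | tmul a b =>
      have h : ∀ e : H ⊗[k] A, dropFst (A ⊗[k] H) Q.ε (TensorProduct.assoc k H A H (e ⊗ₜ b))
          = dropFst A Q.ε e ⊗ₜ b := by
        intro e
        induction e using tensor_ind with
        | add a b ha hb => simp only [map_add, TensorProduct.add_tmul, ha, hb]
        | tmul a b => simp [TensorProduct.smul_tmul']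
      rw [splitFst_tmul, h, 𝔸.left.counit]
  have e2' : ∀ t : H ⊗[k] (A ⊗[k] H),
      onSnd H (dropFst (A ⊗[k] H) Q.ε) (onSnd H (splitFst H 𝔸.left.lam) t) = t := by
    intro t
    induction t using tensor_ind with
    | add a b ha hb => simp only [map_add, ha, hb]
    | tmul a b => simp [e2, -splitFst_tmul]
  have e3 : ∀ t : H ⊗[k] (H ⊗[k] A), onSnd H (dropFst (A ⊗[k] H) Q.ε) (padRight H t)
      = onSnd H Algebra.TensorProduct.includeLeft (onSnd H (dropFst A Q.ε) t) := by
    intro t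
    unfold padRight
    rw [onSnd_comp_apply, onSnd_comp_apply]
    congr 1
    congr 1
    exact AlgHom.ext fun y => dropFst_natural _ _ y
  have e4 : ∀ t : H ⊗[k] (H ⊗[k] A),
      onSnd H (dropFst (A ⊗[k] H) Q.ε) (onSnd H (onSnd H 𝔸.right.ρ) t)
      = onSnd H 𝔸.right.ρ (onSnd H (dropFst A Q.ε) t) := by
    intro t
    rw [onSnd_comp_apply, onSnd_comp_apply]
    congr 1
    congr 1
    exact AlgHom.ext fun y => dropFst_natural _ _ y
  have e5 : ∀ t : H ⊗[k] (A ⊗[k] H),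
      onSnd H (dropFst (A ⊗[k] H) Q.ε) (splitFst (A ⊗[k] H) Q.Δ t) = t := by
    intro t
    induction t using tensor_ind with
    | add a b ha hb => simp only [map_add, ha, hb]
    | tmul a b =>
      have h : ∀ e : H ⊗[k] H, onSnd H (dropFst (A ⊗[k] H) Q.ε)
          (TensorProduct.assoc k H H _ (e ⊗ₜ b)) = dropSnd H Q.ε e ⊗ₜ b := by
        intro e
        induction e using tensor_ind with
        | add a b ha hb => simp only [map_add, TensorProduct.add_tmul, ha, hb]
        | tmul a b => simp [TensorProduct.smul_tmul]
      rw [splitFst_tmul, h, Q.counit_right]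
  rw [map_mul, map_mul, map_mul, e1, e2', e3, e4, e5, 𝔸.left.Φlam_counit_mid, map_one, map_one,
    mul_one, one_mul] at h
  have h' := congrArg (· * (↑𝔸.Θ⁻¹ : H ⊗[k] (A ⊗[k] H))) h
  simp only [mul_assoc, Units.mul_inv, mul_one] at h'
  exact one_tmul_injective Q.ε (h'.trans Algebra.TensorProduct.one_def)

theorem BicomoduleAlgebra.pentagon_left_inv {Q : QuasiBialgebra k H} (𝔸 : BicomoduleAlgebra Q A) :
    padRight H (↑𝔸.left.Φlam⁻¹ : H ⊗[k] (H ⊗[k] A)) * (onSnd H (splitFst H 𝔸.left.lam)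
        (↑𝔸.Θ⁻¹ : H ⊗[k] (A ⊗[k] H)) * padLeft H (↑𝔸.Θ⁻¹ : H ⊗[k] (A ⊗[k] H)))
      = splitFst (A ⊗[k] H) Q.Δ (↑𝔸.Θ⁻¹ : H ⊗[k] (A ⊗[k] H)) *
        onSnd H (onSnd H 𝔸.right.ρ) (↑𝔸.left.Φlam⁻¹ : H ⊗[k] (H ⊗[k] A)) := by
  have h := congrArg Units.inv
    (show Units.map (padLeft (k := k) H : _ →ₐ[k] _).toMonoidHom 𝔸.Θ
        * Units.map (onSnd H (splitFst H 𝔸.left.lam)).toMonoidHom 𝔸.Θ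
        * Units.map (padRight H).toMonoidHom 𝔸.left.Φlam
      = Units.map (onSnd H (onSnd H 𝔸.right.ρ)).toMonoidHom 𝔸.left.Φlam
        * Units.map (splitFst (A ⊗[k] H) Q.Δ).toMonoidHom 𝔸.Θ from Units.ext 𝔸.pentagon_left)
  simpa [mul_assoc] using h

/-- `S(θ¹) q̃¹ θ²_[-1] ⊗ q̃² θ²_[0] ⊗ θ³ = q̃¹ Θ¹ ⊗ q̃²_<0> Θ² ⊗ q̃²_<1> Θ³`. -/
theorem sandS_qEl_Θ (Q : QuasiHopfAlgebra k H) (𝔸 : BicomoduleAlgebra Q.toQuasiBialgebra A) :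
    Q.sandS (A ⊗[k] H) (onSnd H Algebra.TensorProduct.includeLeft (qEl Q 𝔸.left))
        (onSnd H (splitFst H 𝔸.left.lam) (↑𝔸.Θ⁻¹ : H ⊗[k] (A ⊗[k] H)))
      = onSnd H 𝔸.right.ρ (qEl Q 𝔸.left) * (𝔸.Θ : H ⊗[k] (A ⊗[k] H)) := by
  -- Collapse the first two legs of the inverse left pentagon. The factor (Δ ⊗ id ⊗ id)(Θ⁻¹) becomes
  -- 1, and 1 ⊗ Θ⁻¹ comes out on the right, to be cancelled against Θ.
  have h := congrArg (Q.kap (A ⊗[k] H)) 𝔸.pentagon_left_inv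
  have p : ∀ t : H ⊗[k] (H ⊗[k] A), Q.kap (A ⊗[k] H) (padRight H t)
      = onSnd H Algebra.TensorProduct.includeLeft (Q.kap A t) := fun t => Q.kap_natural _ t
  rw [Q.kap_splitFst_mul, QuasiBialgebra.inv_eq_one _ _ 𝔸.Θ_counit_left,
    ← Algebra.TensorProduct.one_def, one_mul, Q.kap_natural, ← mul_assoc,
    Algebra.TensorProduct.includeRight_apply, Q.kap_one_tmul_mul, Q.kap_mul, p] at h
  unfold qEl
  rw [← h, mul_assoc, Units.inv_mul, mul_one]

end Bi

/-! ### How Φ_ρ and Θ intertwine iterated coactions. -/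

section BicomoduleElements

variable {k H A : Type*} [Field k] [Ring H] [Algebra k H] [Ring A] [Algebra k A]

section

variable {Q : QuasiBialgebra k H} (𝔸 : BicomoduleAlgebra Q A)

namespace BicomoduleAlgebra

/-- `a ⊗ h ↦ a_[-1] ⊗ a_[0]<0> ⊗ a_[0]<1> ⊗ h`. -/
noncomputable def lamRho : A ⊗[k] H →ₐ[k] H ⊗[k] (A ⊗[k] (H ⊗[k] H)) :=
  (onSnd H (splitFst H 𝔸.right.ρ)).comp (splitFst H 𝔸.left.lam)

/-- `a ↦ a_<0> ⊗ (a_<1>)₁ ⊗ (a_<1>)₂`. -/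
noncomputable def rhoΔ : A →ₐ[k] A ⊗[k] (H ⊗[k] H) := (onSnd A Q.Δ).comp 𝔸.right.ρ

/-- `a ↦ a_<0><0> ⊗ a_<0><1> ⊗ a_<1>`. -/
noncomputable def rhoRho : A →ₐ[k] A ⊗[k] (H ⊗[k] H) :=
  (splitFst H 𝔸.right.ρ).comp 𝔸.right.ρ

/-- `(1 ⊗ 1 ⊗ Φ_ρ)(1 ⊗ (id ⊗ ρ ⊗ id)(Φ_{λ,ρ}))`. -/
noncomputable def ΦρΘ : H ⊗[k] (H ⊗[k] (A ⊗[k] (H ⊗[k] H))) :=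
  padLeft H (padLeft H (𝔸.right.Φρ : A ⊗[k] (H ⊗[k] H)))
    * padLeft H (onSnd H (splitFst H 𝔸.right.ρ) (𝔸.Θ : H ⊗[k] (A ⊗[k] H)))

theorem Φρ_mul_rhoRho (u : A) :
    (𝔸.right.Φρ : A ⊗[k] (H ⊗[k] H)) * 𝔸.rhoRho u
      = 𝔸.rhoΔ u * (𝔸.right.Φρ : A ⊗[k] (H ⊗[k] H)) := 𝔸.right.coassoc u

theorem Φρ_mul_onSnd_rhoRho (y : H ⊗[k] A) :
    padLeft H (𝔸.right.Φρ : A ⊗[k] (H ⊗[k] H)) * onSnd H 𝔸.rhoRho y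
      = onSnd H 𝔸.rhoΔ y * padLeft H (𝔸.right.Φρ : A ⊗[k] (H ⊗[k] H)) := by
  induction y using tensor_ind with
  | add a b ha hb => simp only [map_add, mul_add, add_mul, ha, hb]
  | tmul a b => simp [Φρ_mul_rhoRho]

theorem Φρ_mul_onSnd_onSnd_rhoRho (y : H ⊗[k] (H ⊗[k] A)) :
    padLeft H (padLeft H (𝔸.right.Φρ : A ⊗[k] (H ⊗[k] H))) * onSnd H (onSnd H 𝔸.rhoRho) y
      = onSnd H (onSnd H 𝔸.rhoΔ) y
        * padLeft H (padLeft H (𝔸.right.Φρ : A ⊗[k] (H ⊗[k] H))) := by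
  induction y using tensor_ind with
  | add a b ha hb => simp only [map_add, mul_add, add_mul, ha, hb]
  | tmul a b =>
    rw [Algebra.TensorProduct.map_tmul, Algebra.TensorProduct.map_tmul,
      Algebra.TensorProduct.includeRight_apply (b := padLeft H _),
      Algebra.TensorProduct.tmul_mul_tmul, Algebra.TensorProduct.tmul_mul_tmul,
      Φρ_mul_onSnd_rhoRho, one_mul, mul_one]

theorem onSnd_splitFst_Θ_mul (u : A) :
    onSnd H (splitFst H 𝔸.right.ρ) (𝔸.Θ : H ⊗[k] (A ⊗[k] H)) * 𝔸.lamRho (𝔸.right.ρ u)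
      = onSnd H 𝔸.rhoRho (𝔸.left.lam u)
        * onSnd H (splitFst H 𝔸.right.ρ) (𝔸.Θ : H ⊗[k] (A ⊗[k] H)) := by
  rw [lamRho, AlgHom.comp_apply, ← map_mul, 𝔸.compat, map_mul, onSnd_comp_apply]
  rfl

/-- Θ exchanges the order of λ and ρ, then Φ_ρ turns the iterated ρ into ρ followed by Δ. -/
theorem ΦρΘ_mul (y : H ⊗[k] A) :
    𝔸.ΦρΘ * onSnd H 𝔸.lamRho (onSnd H 𝔸.right.ρ y)
      = onSnd H (onSnd H 𝔸.rhoΔ) (onSnd H 𝔸.left.lam y) * 𝔸.ΦρΘ := by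
  have key : padLeft H (onSnd H (splitFst H 𝔸.right.ρ) (𝔸.Θ : H ⊗[k] (A ⊗[k] H)))
        * onSnd H 𝔸.lamRho (onSnd H 𝔸.right.ρ y)
      = onSnd H (onSnd H 𝔸.rhoRho) (onSnd H 𝔸.left.lam y)
        * padLeft H (onSnd H (splitFst H 𝔸.right.ρ) (𝔸.Θ : H ⊗[k] (A ⊗[k] H))) := by
    induction y using tensor_ind with
    | add a b ha hb => simp only [map_add, mul_add, add_mul, ha, hb]
    | tmul a b =>
      rw [Algebra.TensorProduct.map_tmul, Algebra.TensorProduct.map_tmul,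
        Algebra.TensorProduct.map_tmul, Algebra.TensorProduct.map_tmul,
        Algebra.TensorProduct.includeRight_apply,
        Algebra.TensorProduct.tmul_mul_tmul, Algebra.TensorProduct.tmul_mul_tmul,
        onSnd_splitFst_Θ_mul, one_mul, mul_one]
  rw [ΦρΘ, mul_assoc, key, ← mul_assoc, Φρ_mul_onSnd_onSnd_rhoRho, mul_assoc]

end BicomoduleAlgebra

end

variable (Q : QuasiHopfAlgebra k H) (𝔸 : BicomoduleAlgebra Q.toQuasiBialgebra A)

/-- Φ_λ⁻¹ further turns the iterated λ into λ followed by Δ. So the reassociator of A², up to f,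
intertwines the twofold coaction with the comultiplied one. -/
theorem splitFst_lam_mul (u : A) :
    splitFst (A ⊗[k] (H ⊗[k] H)) Q.Δ (onSnd H 𝔸.rhoΔ (𝔸.left.lam u))
        * (onSnd H (onSnd H 𝔸.rhoΔ) (↑𝔸.left.Φlam⁻¹ : H ⊗[k] (H ⊗[k] A)) * 𝔸.ΦρΘ)
      = onSnd H (onSnd H 𝔸.rhoΔ) (↑𝔸.left.Φlam⁻¹ : H ⊗[k] (H ⊗[k] A)) * 𝔸.ΦρΘ
        * onSnd H 𝔸.lamRho (onSnd H 𝔸.right.ρ (𝔸.left.lam u)) := by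
  rw [mul_assoc, 𝔸.ΦρΘ_mul, splitFst_natural, ← mul_assoc, ← mul_assoc, ← map_mul, ← map_mul,
    𝔸.left.Φlam_inv_coassoc]

/-- The element on the left arises from applying a q̃-twisted coaction twice and then Φ_ρ. Both
copies of q̃ are moved to the left, the first past Φ_ρ alone and the second past Φ_ρ and Θ together.
-/
theorem ΦρΘ_qEl :
    padLeft H (padLeft H (𝔸.right.Φρ : A ⊗[k] (H ⊗[k] H)))
        * (padLeft H (onSnd H (splitFst H 𝔸.right.ρ)
            (onSnd H 𝔸.right.ρ (qEl Q 𝔸.left) * (𝔸.Θ : H ⊗[k] (A ⊗[k] H))))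
          * onSnd H 𝔸.lamRho (onSnd H 𝔸.right.ρ (qEl Q 𝔸.left)))
      = onSnd H (onSnd H 𝔸.rhoΔ) (qqEl Q 𝔸.left) * 𝔸.ΦρΘ := by
  have e : onSnd H (splitFst H 𝔸.right.ρ) (onSnd H 𝔸.right.ρ (qEl Q 𝔸.left))
      = onSnd H 𝔸.rhoRho (qEl Q 𝔸.left) := onSnd_comp_apply _ _ _
  have e' : onSnd H (onSnd H 𝔸.rhoΔ) (padLeft H (qEl Q 𝔸.left))
      = padLeft H (onSnd H 𝔸.rhoΔ (qEl Q 𝔸.left)) := by simp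
  rw [map_mul, map_mul, e, ← mul_assoc, ← mul_assoc, ← map_mul, 𝔸.Φρ_mul_onSnd_rhoRho, map_mul,
    mul_assoc (padLeft H _), mul_assoc (padLeft H _), qqEl, map_mul, e', mul_assoc _ _ 𝔸.ΦρΘ,
    ← 𝔸.ΦρΘ_mul,
    BicomoduleAlgebra.ΦρΘ, mul_assoc (padLeft H (padLeft H _))]

end BicomoduleElements

/-! ### The bijection between the two kinds of covariant maps. -/

section AbstractTwist

variable {k H A M V : Type*} [Field k] [Ring H] [Algebra k H] [Ring A] [Algebra k A]
variable [AddCommGroup M] [Module k M] [AddCommGroup V] [Module k V]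
variable (Q : QuasiHopfAlgebra k H) (𝔸 : BicomoduleAlgebra Q.toQuasiBialgebra A)
variable (O : H ⊗[k] (A ⊗[k] H) →ₐ[k] Module.End k V) (act : A →ₐ[k] Module.End k M)

/-- `h ⊗ u ↦ (m ↦ O(h ⊗ 1 ⊗ 1)(τ(u · m)))`. -/
noncomputable def leftTwist (τ : M →ₗ[k] V) : H ⊗[k] A →ₗ[k] (M →ₗ[k] V) :=
  conjAct (O.toLinearMap ∘ₗ inl k H (A ⊗[k] H)) τ act.toLinearMap

@[simp] theorem leftTwist_tmul (τ : M →ₗ[k] V) (h : H) (u : A) (m : M) :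
    leftTwist O act τ (h ⊗ₜ u) m = O (h ⊗ₜ 1) (τ (act u m)) := rfl

theorem leftTwist_one (τ : M →ₗ[k] V) : leftTwist O act τ 1 = τ := by
  ext m
  rw [Algebra.TensorProduct.one_def, leftTwist_tmul, ← Algebra.TensorProduct.one_def, map_one,
    map_one]
  rfl

theorem leftTwist_mul_right (τ : M →ₗ[k] V) (t : H ⊗[k] A) (u : A) (m : M) :
    leftTwist O act τ (t * (1 ⊗ₜ u)) m = leftTwist O act τ t (act u m) := by
  induction t using tensor_ind with
  | add a b ha hb => simp only [map_add, add_mul, LinearMap.add_apply, ha, hb]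
  | tmul a b => simp

variable {Q 𝔸 O act} {τ : M →ₗ[k] V}

theorem leftTwist_antipode
    (hτ : ∀ u m, τ (act u m) = O (onSnd H 𝔸.right.ρ (𝔸.left.lam u)) (τ m))
    (w : H ⊗[k] (A ⊗[k] H)) (t : H ⊗[k] A) (m : M) :
    leftTwist O act (O w ∘ₗ τ) (TensorProduct.map Q.S.toLinearMap LinearMap.id t) m
      = O (Q.sandS (A ⊗[k] H) w (onSnd H (onSnd H 𝔸.right.ρ) (onSnd H 𝔸.left.lam t))) (τ m) := by
  induction t using tensor_ind with
  | add a b ha hb => simp only [map_add, LinearMap.add_apply, ha, hb]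
  | tmul a b =>
    simp [hτ]

theorem sandS_natural {B B' : Type*} [Ring B] [Algebra k B] [Ring B'] [Algebra k B']
    (g : B →ₐ[k] B') (w : H ⊗[k] B) (t : H ⊗[k] (H ⊗[k] B)) :
    onSnd H g (Q.sandS B w t) = Q.sandS B' (onSnd H g w) (onSnd H (onSnd H g) t) := by
  induction t using tensor_ind with
  | add a b ha hb => simp only [map_add, ha, hb]
  | tmul a b => simp

/-- `τ ↦ O((id ⊗ ρ)(q̃)) ∘ τ` turns a Doi-Hopf coaction into a Yetter-Drinfeld one. -/
theorem compat_of_coact_act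
    (hτ : ∀ u m, τ (act u m) = O (onSnd H 𝔸.right.ρ (𝔸.left.lam u)) (τ m)) (u : A) (m : M) :
    O (1 ⊗ₜ 𝔸.right.ρ u) (O (onSnd H 𝔸.right.ρ (qEl Q 𝔸.left)) (τ m))
      = leftTwist O act (O (onSnd H 𝔸.right.ρ (qEl Q 𝔸.left)) ∘ₗ τ)
        (TensorProduct.map Q.S.toLinearMap LinearMap.id (𝔸.left.lam u)) m := by
  rw [leftTwist_antipode hτ, ← sandS_natural, sandS_qEl, map_mul, map_mul,
    Algebra.TensorProduct.map_tmul]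
  rfl

/-- Yetter-Drinfeld covariance moves ρ(u) through τ at the price of a factor S(u_[-1]) beside p. The
result is again a twist of τ, so that identities about p̃ and q̃ become identities about maps. -/
theorem apply_leftTwist
    (hτ : ∀ u m, O (1 ⊗ₜ 𝔸.right.ρ u) (τ m)
      = leftTwist O act τ (TensorProduct.map Q.S.toLinearMap LinearMap.id (𝔸.left.lam u)) m)
    (w p : H ⊗[k] A) (m : M) :
    O (onSnd H 𝔸.right.ρ w) (leftTwist O act τ p m)
      = leftTwist O act τ (Q.sandSR A p (onSnd H 𝔸.left.lam w)) m := by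
  induction w using tensor_ind with
  | add a b ha hb => simp only [map_add, LinearMap.add_apply, ha, hb]
  | tmul h u =>
  induction p using tensor_ind with
  | add a b ha hb =>
    have e : Q.sandSR A (a + b) = Q.sandSR A a + Q.sandSR A b := by
      refine LinearMap.ext fun t => ?_
      induction t using tensor_ind with
      | add a b ha hb => simp only [map_add, ha, hb]
      | tmul x t =>
      induction t using tensor_ind with
      | add a b ha hb => simp only [map_add, TensorProduct.tmul_add, ha, hb]
      | tmul y z =>
        rw [LinearMap.add_apply]
        simp only [QuasiHopfAlgebra.sandSR_tmul, mul_add, add_mul]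
    simp only [map_add, LinearMap.add_apply, ha, hb, e]
  | tmul p1 p2 =>
    have h1 : O (onSnd H 𝔸.right.ρ (h ⊗ₜ u)) (O (p1 ⊗ₜ 1) (τ (act p2 m)))
        = O ((h * p1) ⊗ₜ 1) (O (1 ⊗ₜ 𝔸.right.ρ u) (τ (act p2 m))) := by
      rw [← Module.End.mul_apply, ← Module.End.mul_apply, ← map_mul, ← map_mul]
      simp
    rw [leftTwist_tmul, h1, hτ, Algebra.TensorProduct.map_tmul]
    induction 𝔸.left.lam u using tensor_ind with
    | add a b ha hb =>
      simp only [map_add, LinearMap.add_apply, ha, hb, TensorProduct.tmul_add]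
    | tmul a b =>
      have h2 : O ((h * p1) ⊗ₜ 1) (O (Q.S a ⊗ₜ 1) (τ (act b (act p2 m))))
        = O ((h * p1 * Q.S a) ⊗ₜ 1) (τ (act b (act p2 m))) := by
        rw [← Module.End.mul_apply, ← map_mul]
        simp
      rw [TensorProduct.map_tmul, leftTwist_tmul]
      refine h2.trans ?_
      simp [mul_assoc]

/-- By `sandSR_pEl`, the action of λ(u) changes the twisting element p̃ into p̃(1 ⊗ u), and that
twist is the p̃-twist at u · m. -/
theorem coact_act_of_compat
    (hτ : ∀ u m, O (1 ⊗ₜ 𝔸.right.ρ u) (τ m)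
      = leftTwist O act τ (TensorProduct.map Q.S.toLinearMap LinearMap.id (𝔸.left.lam u)) m)
    (u : A) (m : M) :
    leftTwist O act τ (pEl Q 𝔸.left) (act u m)
      = O (onSnd H 𝔸.right.ρ (𝔸.left.lam u)) (leftTwist O act τ (pEl Q 𝔸.left) m) := by
  rw [apply_leftTwist hτ, sandSR_pEl, leftTwist_mul_right]

/-- By `sandSR_pEl_qEl` the resulting twisting element is 1. -/
theorem leftTwist_qEl_pEl
    (hτ : ∀ u m, O (1 ⊗ₜ 𝔸.right.ρ u) (τ m)
      = leftTwist O act τ (TensorProduct.map Q.S.toLinearMap LinearMap.id (𝔸.left.lam u)) m)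
    (m : M) :
    O (onSnd H 𝔸.right.ρ (qEl Q 𝔸.left)) (leftTwist O act τ (pEl Q 𝔸.left) m) = τ m := by
  rw [apply_leftTwist hτ, sandSR_pEl_qEl, leftTwist_one]

/-- Doi-Hopf covariance takes p̃² out of τ as λ(p̃²) to the right of q̃, where `sandw_qEl_pEl`
applies. In particular, q̃ acts injectively on such maps for any V; this is used for the coaction
and for maps to M ⊗ C ⊗ C. -/
theorem leftTwist_pEl_qEl
    (hτ : ∀ u m, τ (act u m) = O (onSnd H 𝔸.right.ρ (𝔸.left.lam u)) (τ m)) (m : M) :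
    leftTwist O act (O (onSnd H 𝔸.right.ρ (qEl Q 𝔸.left)) ∘ₗ τ) (pEl Q 𝔸.left) m = τ m := by
  have key : ∀ q p : H ⊗[k] A, leftTwist O act (O (onSnd H 𝔸.right.ρ q) ∘ₗ τ) p m
      = O (onSnd H 𝔸.right.ρ (sandw (inl k H A) 𝔸.left.lam.toLinearMap q p)) (τ m) := by
    intro q p
    induction p using tensor_ind with
    | add a b ha hb => simp only [map_add, LinearMap.add_apply, ha, hb]
    | tmul a b => simp [hτ]
  rw [key, sandw_qEl_pEl, map_one, map_one]
  rfl

end AbstractTwist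

/-! ### The action of H ⊗ A ⊗ H on M ⊗ V, and the two twists in terms of it. -/

section Operators

variable {k H A M C V : Type*} [Field k] [Ring H] [Algebra k H] [Ring A] [Algebra k A]
variable [AddCommGroup M] [Module k M] [AddCommGroup C] [Module k C]
variable [AddCommGroup V] [Module k V]
variable (Q : QuasiHopfAlgebra k H) (act : A →ₐ[k] Module.End k M)

/-- The action of `H ⊗ A ⊗ H` on `M ⊗ V` with
`(h ⊗ u ⊗ h') · (m ⊗ v) = u · m ⊗ (S⁻¹(h) ⊗ h') · v`, for an `H^op ⊗ H`-module `V`. -/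
noncomputable def tripleAct (P : Op H ⊗[k] H →ₐ[k] Module.End k V) :
    H ⊗[k] (A ⊗[k] H) →ₐ[k] Module.End k (M ⊗[k] V) :=
  (Module.endTensorEndAlgHom.comp (Algebra.TensorProduct.map act P)).comp
    ((Algebra.TensorProduct.leftComm k (Op H) A H).toAlgHom.comp
      (Algebra.TensorProduct.map Q.SinvOp (AlgHom.id k (A ⊗[k] H))))

theorem tripleAct_tmul (P : Op H ⊗[k] H →ₐ[k] Module.End k V) (h h' : H) (u : A) :
    tripleAct Q act P (h ⊗ₜ (u ⊗ₜ h'))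
      = TensorProduct.map (act u) (P (Q.SinvOp h ⊗ₜ h')) := rfl

theorem tensorAct_rhoTwo (𝔸 : BicomoduleAlgebra Q.toQuasiBialgebra A)
    (P : Op H ⊗[k] H →ₐ[k] Module.End k V) (u : A) :
    tensorAct act.toLinearMap P.toLinearMap (rhoTwo Q 𝔸 u)
      = tripleAct Q act P (onSnd H 𝔸.right.ρ (𝔸.left.lam u)) := by
  have key : ∀ t : H ⊗[k] A, tensorAct act.toLinearMap P.toLinearMap
      (Algebra.TensorProduct.leftComm k (Op H) A H
        (Algebra.TensorProduct.map Q.SinvOp 𝔸.right.ρ t))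
      = tripleAct Q act P (onSnd H 𝔸.right.ρ t) := by
    intro t
    induction t using tensor_ind with
    | add a b ha hb => simp only [map_add, ha, hb]
    | tmul a b =>
      rw [Algebra.TensorProduct.map_tmul, Algebra.TensorProduct.map_tmul]
      induction 𝔸.right.ρ b using tensor_ind with
      | add a b ha hb => simp only [map_add, TensorProduct.tmul_add, ha, hb]
      | tmul a b => rfl
  exact key _

variable (D : BimoduleCoalgebra Q.toQuasiBialgebra C)

theorem opTensorAct_tmul (x : Op H) (y : H) : D.opTensorAct (x ⊗ₜ y) = D.ractOp x * D.lact y := by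
  simp [BimoduleCoalgebra.opTensorAct]

/-- The S⁻¹ built into the action cancels S. This is why a twist by p̃ is expressed through (S ⊗
id)(p̃). -/
theorem tripleAct_S_tmul_one (h : H) :
    tripleAct Q act D.opTensorAct (Q.S h ⊗ₜ 1) = LinearMap.lTensor M (D.ract h) := by
  rw [Algebra.TensorProduct.one_def, tripleAct_tmul, opTensorAct_tmul, map_one, map_one, mul_one]
  have e : Q.SinvOp (Q.S h) = toOp k H h := by simp [QuasiHopfAlgebra.SinvOp]
  rw [e]
  rfl

theorem tripleAct_one_tmul (t : A ⊗[k] H) :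
    tripleAct Q act D.opTensorAct (1 ⊗ₜ t) = tensorAct act.toLinearMap D.lact.toLinearMap t := by
  induction t using tensor_ind with
  | add a b ha hb => simp only [map_add, TensorProduct.tmul_add, ha, hb]
  | tmul a b =>
    rw [tripleAct_tmul, opTensorAct_tmul, map_one, map_one, one_mul]
    rfl

theorem twistMap_eq (coact : M →ₗ[k] M ⊗[k] C) (t : H ⊗[k] A) :
    twistMap D act coact t = leftTwist (tripleAct Q act D.opTensorAct) act coact
      (TensorProduct.map Q.S.toLinearMap LinearMap.id t) := by
  induction t using tensor_ind with
  | add a b ha hb => simp only [map_add, ha, hb]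
  | tmul a b =>
    refine LinearMap.ext fun m => ?_
    rw [TensorProduct.map_tmul, leftTwist_tmul]
    refine Eq.trans ?_ (LinearMap.congr_fun (tripleAct_S_tmul_one Q act D a).symm _)
    rfl

variable (𝔸 : BicomoduleAlgebra Q.toQuasiBialgebra A)

theorem twistMap_pTilde (coact : M →ₗ[k] M ⊗[k] C) :
    twistMap D act coact (pTilde Q 𝔸)
      = leftTwist (tripleAct Q act D.opTensorAct) act coact (pEl Q 𝔸.left) := by
  rw [twistMap_eq, pTilde, Q.map_S_sandInv, pEl]

theorem conjAct_qTilde (coact : M →ₗ[k] M ⊗[k] C) :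
    conjAct (LinearMap.lTensorHom M ∘ₗ D.ract ∘ₗ Q.S.symm.toLinearMap) LinearMap.id
      (tensorAct act.toLinearMap D.lact.toLinearMap ∘ₗ 𝔸.right.ρ.toLinearMap) (qTilde Q 𝔸)
      ∘ₗ coact
    = tripleAct Q act D.opTensorAct (onSnd H 𝔸.right.ρ (qEl Q 𝔸.left)) ∘ₗ coact := by
  congr 1
  rw [qTilde, Q.kap_eq, qEl]
  induction Q.kap A (↑𝔸.left.Φlam⁻¹ : H ⊗[k] (H ⊗[k] A)) using tensor_ind with
  | add a b ha hb => simp only [map_add, ha, hb]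
  | tmul h u =>
    rw [Algebra.TensorProduct.map_tmul]
    -- Writing h as S(S⁻¹(h)) makes its action the right multiplication by S⁻¹(h) that appears in
    -- `twistQ`.
    have e : (AlgHom.id k H) h ⊗ₜ[k] 𝔸.right.ρ u =
        (Q.S (Q.S.symm h) ⊗ₜ 1) * (1 ⊗ₜ 𝔸.right.ρ u) := by
      simp
    rw [e, map_mul, tripleAct_S_tmul_one, tripleAct_one_tmul]
    rfl

theorem counit_tripleAct (w : H ⊗[k] (A ⊗[k] H)) (z : M ⊗[k] C) :
    TensorProduct.rid k M (TensorProduct.map LinearMap.id D.ε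
        (tripleAct Q act D.opTensorAct w z))
      = act (dropFst A Q.ε (onSnd H (dropSnd A Q.ε) w))
        (TensorProduct.rid k M (TensorProduct.map LinearMap.id D.ε z)) := by
  induction w using tensor_ind with
  | add a b ha hb => simp only [map_add, LinearMap.add_apply, ha, hb]
  | tmul h t =>
  induction t using tensor_ind with
  | add a b ha hb => simp only [map_add, TensorProduct.tmul_add, LinearMap.add_apply, ha, hb]
  | tmul u h' =>
  induction z using tensor_ind with
  | add a b ha hb => simp only [map_add, ha, hb]
  | tmul m c =>
    have e : Q.SinvOp h = toOp k H (Q.S.symm h) := rfl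
    have e' : Q.ε (Q.S.symm h) = Q.ε h := by
      rw [← Q.ε_S, LinearEquiv.apply_symm_apply]
    rw [tripleAct_tmul, opTensorAct_tmul, e]
    simp [D.ε_ract, D.ε_lact, e', smul_smul]
    congr 1
    ring

end Operators

/-! ### Actions on M ⊗ C ⊗ C: leg by leg and diagonal. -/

section PairOperators

variable {k H A M C : Type*} [Field k] [Ring H] [Algebra k H] [Ring A] [Algebra k A]
variable [AddCommGroup M] [Module k M] [AddCommGroup C] [Module k C]
variable (Q : QuasiHopfAlgebra k H) (act : A →ₐ[k] Module.End k M)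

/-- The map `reorder`, as an algebra morphism. -/
noncomputable def reorderHom : H ⊗[k] (H ⊗[k] (A ⊗[k] (H ⊗[k] H))) →ₐ[k]
    A ⊗[k] ((Op H ⊗[k] H) ⊗[k] (Op H ⊗[k] H)) :=
  (Algebra.TensorProduct.map (AlgHom.id k A)
      (Algebra.TensorProduct.tensorTensorTensorComm k k k k (Op H) (Op H) H H).toAlgHom).comp
    ((Algebra.TensorProduct.leftComm k (Op H ⊗[k] Op H) A (H ⊗[k] H)).toAlgHom.comp
      ((Algebra.TensorProduct.map ((Algebra.TensorProduct.map Q.SinvOp Q.SinvOp).comp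
        (Algebra.TensorProduct.comm k H H).toAlgHom) (AlgHom.id k (A ⊗[k] (H ⊗[k] H)))).comp
        (Algebra.TensorProduct.assoc k k k H H (A ⊗[k] (H ⊗[k] H))).symm.toAlgHom))

theorem reorderHom_apply (t : H ⊗[k] (H ⊗[k] (A ⊗[k] (H ⊗[k] H)))) :
    reorderHom Q t = reorder Q t := rfl

variable (D : BimoduleCoalgebra Q.toQuasiBialgebra C)

/-- The action of `H ⊗ H ⊗ A ⊗ H ⊗ H` on `M ⊗ C ⊗ C` with
`(a ⊗ b ⊗ u ⊗ c ⊗ d) · (m ⊗ x ⊗ y) = u · m ⊗ c · x · S⁻¹(b) ⊗ d · y · S⁻¹(a)`. -/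
noncomputable def pairAct :
    H ⊗[k] (H ⊗[k] (A ⊗[k] (H ⊗[k] H))) →ₐ[k] Module.End k (M ⊗[k] (C ⊗[k] C)) :=
  (Module.endTensorEndAlgHom.comp (Algebra.TensorProduct.map act
    (Module.endTensorEndAlgHom.comp
      (Algebra.TensorProduct.map D.opTensorAct D.opTensorAct)))).comp (reorderHom Q)

theorem pairAct_tmul (a b c d : H) (u : A) :
    pairAct Q act D (a ⊗ₜ (b ⊗ₜ (u ⊗ₜ (c ⊗ₜ d)))) = TensorProduct.map (act u)
      (TensorProduct.map (D.opTensorAct (Q.SinvOp b ⊗ₜ c)) (D.opTensorAct (Q.SinvOp a ⊗ₜ d))) :=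
  rfl

/-- The reassociator of A² acts through the five-leg element before S⁻¹ is applied to it, so
products can be computed in H and A rather than in H^op ⊗ H. -/
theorem tensorAct_reorder (t : H ⊗[k] (H ⊗[k] (A ⊗[k] (H ⊗[k] H)))) :
    tensorAct act.toLinearMap
        (tensorAct D.opTensorAct.toLinearMap D.opTensorAct.toLinearMap) (reorder Q t)
      = pairAct Q act D t := by
  rw [← reorderHom_apply]
  change _ = Module.endTensorEndAlgHom (Algebra.TensorProduct.map act
    (Module.endTensorEndAlgHom.comp
      (Algebra.TensorProduct.map D.opTensorAct D.opTensorAct)) (reorderHom Q t))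
  induction reorderHom Q t using tensor_ind with
  | add a b ha hb => simp only [map_add, ha, hb]
  | tmul a b =>
  induction b using tensor_ind with
  | add a b ha hb => simp only [map_add, TensorProduct.tmul_add, ha, hb]
  | tmul b c => rfl

/-- The diagonal action of `H^op ⊗ H` on `C ⊗ C`. -/
noncomputable def diagAct : Op H ⊗[k] H →ₐ[k] Module.End k (C ⊗[k] C) :=
  (Module.endTensorEndAlgHom.comp
    (Algebra.TensorProduct.map D.opTensorAct D.opTensorAct)).comp
      (Q.toQuasiBialgebra.op.tensor Q.toQuasiBialgebra).Δ

theorem diagAct_Δ (t : Op H ⊗[k] H) (c : C) : diagAct Q D t (D.Δ c) = D.Δ (D.opTensorAct t c) := by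
  refine Eq.trans ?_ (D.toOpTensor.Δ_act t c).symm
  change Module.endTensorEndAlgHom (Algebra.TensorProduct.map D.opTensorAct D.opTensorAct
    ((Q.toQuasiBialgebra.op.tensor Q.toQuasiBialgebra).Δ t)) (D.Δ c)
    = tensorAct D.opTensorAct.toLinearMap D.opTensorAct.toLinearMap
      ((Q.toQuasiBialgebra.op.tensor Q.toQuasiBialgebra).Δ t) (D.Δ c)
  congr 1

theorem tripleAct_diagAct_Δ (w : H ⊗[k] (A ⊗[k] H)) (z : M ⊗[k] C) :
    tripleAct Q act (diagAct Q D) w (TensorProduct.map LinearMap.id D.Δ z)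
      = TensorProduct.map LinearMap.id D.Δ (tripleAct Q act D.opTensorAct w z) := by
  induction w using tensor_ind with
  | add a b ha hb => simp only [map_add, LinearMap.add_apply, ha, hb]
  | tmul h t =>
  induction t using tensor_ind with
  | add a b ha hb => simp only [map_add, TensorProduct.tmul_add, LinearMap.add_apply, ha, hb]
  | tmul u h' =>
  induction z using tensor_ind with
  | add a b ha hb => simp only [map_add, ha, hb]
  | tmul m c =>
    rw [tripleAct_tmul, tripleAct_tmul, TensorProduct.map_tmul, TensorProduct.map_tmul,
      TensorProduct.map_tmul, TensorProduct.map_tmul, diagAct_Δ]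
    rfl

/-- The diagonal action comultiplies S⁻¹ of an element, whereas the leg-by-leg action applies S⁻¹ to
swapped legs. On S(h) both are right multiplication by h₁ and h₂, once S(h) is replaced by (S ⊗
S)(Δ^cop(h)). -/
theorem diagAct_tmul (h h' : H) :
    tripleAct Q act (diagAct Q D) (Q.S h ⊗ₜ ((1 : A) ⊗ₜ h'))
      = pairAct Q act D (TensorProduct.assoc k H H _ (Q.SSop (Q.Δ h) ⊗ₜ (1 ⊗ₜ Q.Δ h'))) := by
  have e : (Q.toQuasiBialgebra.op.tensor Q.toQuasiBialgebra).Δ (Q.SinvOp (Q.S h) ⊗ₜ h')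
      = lift₂ (inl k (Op H) H) (lift₂ (opL k H) (Q.Δ h)) * lift₂ (inr k (Op H) H) (Q.Δ h') := by
    have e1 : Q.SinvOp (Q.S h) ⊗ₜ[k] h' = inl k (Op H) H (opL k H h) * inr k (Op H) H h' := by
      simp [QuasiHopfAlgebra.SinvOp]
    rw [e1]
    change tensorComul Q.toQuasiBialgebra.op.Δ Q.Δ _ = _
    rw [map_mul, tensorComul_inl, tensorComul_inr]
    rfl
  rw [tripleAct_tmul, diagAct, AlgHom.comp_apply, e]
  induction Q.Δ h using tensor_ind with
  | add a b ha hb =>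
    simp only [map_add, TensorProduct.add_tmul, add_mul, ← ha, ← hb, TensorProduct.map_add_right]
  | tmul a b =>
  induction Q.Δ h' using tensor_ind with
  | add a b ha hb =>
    simp only [map_add, TensorProduct.tmul_add, mul_add, ← ha, ← hb, TensorProduct.map_add_right]
  | tmul c d =>
    rw [Q.SSop_tmul, TensorProduct.assoc_tmul, pairAct_tmul]
    have ea : Q.SinvOp (Q.S a) = toOp k H a := by simp [QuasiHopfAlgebra.SinvOp]
    have eb : Q.SinvOp (Q.S b) = toOp k H b := by simp [QuasiHopfAlgebra.SinvOp]
    rw [ea, eb]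
    have : lift₂ (inl k (Op H) H) (lift₂ (opL k H) (a ⊗ₜ b)) * lift₂ (inr k (Op H) H) (c ⊗ₜ d)
        = (toOp k H a ⊗ₜ c) ⊗ₜ (toOp k H b ⊗ₜ d) := by
      simp [lift₂]
    rw [this]
    rfl

/-- In passing f, the factor (S ⊗ S)(Δ^cop(h)) of the diagonal action becomes Δ(S(h)): f makes up
for the failure of S to be an anti-coalgebra map. -/
theorem tripleAct_diagAct_drinfeldTwist (w : H ⊗[k] (A ⊗[k] H))
    (t : H ⊗[k] (H ⊗[k] (A ⊗[k] (H ⊗[k] H)))) (z : M ⊗[k] (C ⊗[k] C)) :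
    tripleAct Q act (diagAct Q D) w (pairAct Q act D
        (TensorProduct.assoc k H H _ (Q.drinfeldTwist ⊗ₜ 1) * t) z)
      = pairAct Q act D (TensorProduct.assoc k H H _ (Q.drinfeldTwist ⊗ₜ 1)
        * (splitFst (A ⊗[k] (H ⊗[k] H)) Q.Δ (onSnd H (onSnd A Q.Δ) w) * t)) z := by
  induction w using tensor_ind with
  | add a b ha hb => simp only [map_add, LinearMap.add_apply, add_mul, mul_add, ha, hb]
  | tmul h s =>
  induction s using tensor_ind with
  | add a b ha hb =>
    simp only [map_add, TensorProduct.tmul_add, LinearMap.add_apply, add_mul, mul_add, ha, hb]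
  | tmul u h' =>
    -- The intertwining property of f speaks of S(h), so bijectivity of S is needed to reach every
    -- element.
    obtain ⟨h, rfl⟩ := Q.S.surjective h
    have e1 : tripleAct Q act (diagAct Q D) (Q.S h ⊗ₜ (u ⊗ₜ h'))
        = tripleAct Q act (diagAct Q D) (Q.S h ⊗ₜ ((1 : A) ⊗ₜ h'))
          * tripleAct Q act (diagAct Q D) (1 ⊗ₜ (u ⊗ₜ 1)) := by
      rw [← map_mul]; simp
    have e2 : tripleAct Q act (diagAct Q D) (1 ⊗ₜ (u ⊗ₜ 1))
        = pairAct Q act D (1 ⊗ₜ (1 ⊗ₜ (u ⊗ₜ 1))) := by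
      rw [Algebra.TensorProduct.one_def (A := H), tripleAct_tmul, pairAct_tmul, map_one,
        ← Algebra.TensorProduct.one_def, map_one, map_one, Module.End.one_eq_id,
        Module.End.one_eq_id, TensorProduct.map_id]
    rw [e1, diagAct_tmul, e2, ← map_mul, ← Module.End.mul_apply, ← map_mul, ← mul_assoc,
      ← mul_assoc]
    congr 3
    have e3 : (1 : H) ⊗ₜ[k] ((1 : H) ⊗ₜ[k] (u ⊗ₜ[k] (1 : H ⊗[k] H)))
        = TensorProduct.assoc k H H _ (1 ⊗ₜ (u ⊗ₜ 1)) := by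
      rw [Algebra.TensorProduct.one_def (A := H), TensorProduct.assoc_tmul]
    rw [e3, ← assoc_mul, ← assoc_mul, Algebra.TensorProduct.map_tmul,
      Algebra.TensorProduct.map_tmul, splitFst_tmul, ← assoc_mul]
    simp [Q.SSop_mul_drinfeldTwist]

variable (𝔸 : BicomoduleAlgebra Q.toQuasiBialgebra A)

/-- Only the A-leg of `w` meets the second coaction, and covariance of τ replaces that leg by its
image under λ and ρ. -/
theorem splitFstLin_tripleAct (τ : M →ₗ[k] M ⊗[k] C)
    (hτ : ∀ u m, τ (act u m)
      = tripleAct Q act D.opTensorAct (onSnd H 𝔸.right.ρ (𝔸.left.lam u)) (τ m))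
    (w : H ⊗[k] (A ⊗[k] H)) (z : M ⊗[k] C) :
    splitFstLin C τ (tripleAct Q act D.opTensorAct w z)
      = pairAct Q act D (onSnd H 𝔸.lamRho w) (splitFstLin C τ z) := by
  have key : ∀ (t : H ⊗[k] A) (h h' : H) (x : M ⊗[k] C) (c : C),
      TensorProduct.assoc k M C C (tripleAct Q act D.opTensorAct (onSnd H 𝔸.right.ρ t) x
        ⊗ₜ D.opTensorAct (Q.SinvOp h ⊗ₜ h') c)
      = pairAct Q act D
        (h ⊗ₜ onSnd H (splitFst H 𝔸.right.ρ) (TensorProduct.assoc k H A H (t ⊗ₜ h')))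
        (TensorProduct.assoc k M C C (x ⊗ₜ c)) := by
    intro t h h' x c
    induction t using tensor_ind with
    | add a b ha hb => simp only [map_add, TensorProduct.add_tmul, TensorProduct.tmul_add,
        LinearMap.add_apply, ha, hb]
    | tmul a u =>
    rw [TensorProduct.assoc_tmul, Algebra.TensorProduct.map_tmul, Algebra.TensorProduct.map_tmul,
      splitFst_tmul]
    induction 𝔸.right.ρ u using tensor_ind with
    | add a b ha hb => simp only [map_add, TensorProduct.add_tmul, TensorProduct.tmul_add,
        LinearMap.add_apply, ha, hb]
    | tmul u b =>
    induction x using tensor_ind with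
    | add a b ha hb => simp only [map_add, TensorProduct.add_tmul, ha, hb]
    | tmul m d => rfl
  induction w using tensor_ind with
  | add a b ha hb => simp only [map_add, LinearMap.add_apply, ha, hb]
  | tmul h t =>
  induction t using tensor_ind with
  | add a b ha hb => simp only [map_add, TensorProduct.tmul_add, LinearMap.add_apply, ha, hb]
  | tmul u h' =>
  induction z using tensor_ind with
  | add a b ha hb => simp only [map_add, ha, hb]
  | tmul m c =>
    change TensorProduct.assoc k M C C (τ (act u m) ⊗ₜ D.opTensorAct (Q.SinvOp h ⊗ₜ h') c) = _
    rw [hτ, key]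
    rfl

end PairOperators

/-! ### Equivalence of the two coassociativity conditions. -/

section Coassociativity

variable {k H A M C : Type*} [Field k] [Ring H] [Algebra k H] [Ring A] [Algebra k A]
variable [AddCommGroup M] [Module k M] [AddCommGroup C] [Module k C]
variable (Q : QuasiHopfAlgebra k H) (act : A →ₐ[k] Module.End k M)
variable (D : BimoduleCoalgebra Q.toQuasiBialgebra C)

/-- `a ⊗ b ⊗ u ↦ (m ↦ Λ(u · m) · (a ⊗ b))`. -/
noncomputable def pairTwist (Λ : M →ₗ[k] M ⊗[k] (C ⊗[k] C)) :
    H ⊗[k] (H ⊗[k] A) →ₗ[k] (M →ₗ[k] M ⊗[k] (C ⊗[k] C)) :=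
  conjAct (LinearMap.lTensorHom M ∘ₗ tensorAct D.ract D.ract) Λ act.toLinearMap ∘ₗ
    (TensorProduct.assoc k H H A).symm.toLinearMap

theorem lTensor_tensorAct_ract (a b : H) :
    LinearMap.lTensor M (tensorAct D.ract D.ract (a ⊗ₜ b))
      = pairAct Q act D (Q.S b ⊗ₜ (Q.S a ⊗ₜ 1)) := by
  have ea : Q.SinvOp (Q.S a) = toOp k H a := by simp [QuasiHopfAlgebra.SinvOp]
  have eb : Q.SinvOp (Q.S b) = toOp k H b := by simp [QuasiHopfAlgebra.SinvOp]
  rw [Algebra.TensorProduct.one_def, Algebra.TensorProduct.one_def, pairAct_tmul, ea, eb,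
    opTensorAct_tmul, opTensorAct_tmul, map_one, map_one, mul_one, mul_one]
  rfl

theorem pairTwist_tmul (Λ : M →ₗ[k] M ⊗[k] (C ⊗[k] C)) (a b : H) (u : A) (m : M) :
    pairTwist Q act D Λ (a ⊗ₜ (b ⊗ₜ u)) m
      = pairAct Q act D (Q.S b ⊗ₜ (Q.S a ⊗ₜ 1)) (Λ (act u m)) := by
  rw [← lTensor_tensorAct_ract]
  rfl

theorem pairTwist_one (Λ : M →ₗ[k] M ⊗[k] (C ⊗[k] C)) : pairTwist Q act D Λ 1 = Λ := by
  ext m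
  rw [Algebra.TensorProduct.one_def, Algebra.TensorProduct.one_def, pairTwist_tmul, Q.S_one,
    ← Algebra.TensorProduct.one_def, ← Algebra.TensorProduct.one_def, map_one, map_one]
  rfl

theorem pairTwist_pairTwist (Λ : M →ₗ[k] M ⊗[k] (C ⊗[k] C)) (s t : H ⊗[k] (H ⊗[k] A)) :
    pairTwist Q act D (pairTwist Q act D Λ s) t = pairTwist Q act D Λ (s * t) := by
  induction t using tensor_ind with
  | add a b ha hb => simp only [map_add, mul_add, ha, hb]
  | tmul a t =>
  induction t using tensor_ind with
  | add a b ha hb => simp only [map_add, TensorProduct.tmul_add, mul_add, ha, hb]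
  | tmul b u =>
  refine LinearMap.ext fun m => ?_
  rw [pairTwist_tmul]
  induction s using tensor_ind with
  | add a b ha hb => simp only [map_add, add_mul, LinearMap.add_apply, ha, hb]
  | tmul a' s =>
  induction s using tensor_ind with
  | add a b ha hb => simp only [map_add, TensorProduct.tmul_add, add_mul, LinearMap.add_apply,
      ha, hb]
  | tmul b' u' =>
  rw [Algebra.TensorProduct.tmul_mul_tmul, Algebra.TensorProduct.tmul_mul_tmul, pairTwist_tmul,
    pairTwist_tmul, ← Module.End.mul_apply, ← map_mul, ← Module.End.mul_apply, ← map_mul]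
  simp [Q.S_mul]

/-- Twisting is a right action of H ⊗ H ⊗ A on maps, so an invertible element can be moved to the
other side. In this way Φ_λ⁻¹ enters Yetter-Drinfeld coassociativity. -/
theorem pairTwist_eq_iff (t : (H ⊗[k] (H ⊗[k] A))ˣ) (Λ X : M →ₗ[k] M ⊗[k] (C ⊗[k] C)) :
    pairTwist Q act D Λ (t : H ⊗[k] (H ⊗[k] A)) = X
      ↔ Λ = pairTwist Q act D X (↑t⁻¹ : H ⊗[k] (H ⊗[k] A)) := by
  constructor
  · rintro rfl
    rw [pairTwist_pairTwist, Units.mul_inv, pairTwist_one]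
  · rintro rfl
    rw [pairTwist_pairTwist, Units.inv_mul, pairTwist_one]

variable (𝔸 : BicomoduleAlgebra Q.toQuasiBialgebra A)

theorem tensorAct_lact_lact (t : A ⊗[k] (H ⊗[k] H)) :
    tensorAct act.toLinearMap (tensorAct D.lact.toLinearMap D.lact.toLinearMap) t
      = pairAct Q act D (padLeft H (padLeft H t)) := by
  induction t using tensor_ind with
  | add a b ha hb => simp only [map_add, ha, hb]
  | tmul u t =>
  induction t using tensor_ind with
  | add a b ha hb => simp only [map_add, TensorProduct.tmul_add, ha, hb]
  | tmul c d =>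
    rw [Algebra.TensorProduct.includeRight_apply, Algebra.TensorProduct.includeRight_apply,
      pairAct_tmul, opTensorAct_tmul, opTensorAct_tmul, map_one, map_one, one_mul, one_mul]
    rfl

/-- Covariance writes τ(u · m) as an action on τ(m); `ΦρΘ_mul` carries it to the left, where it is
the right half of the sandwich. The left half, made of S(b) and S(a), acts by right multiplication
with a and b on the two copies of C. -/
theorem pairAct_sandSS {τ : M →ₗ[k] M ⊗[k] C}
    (hτ : ∀ u m, τ (act u m)
      = tripleAct Q act D.opTensorAct (onSnd H 𝔸.right.ρ (𝔸.left.lam u)) (τ m))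
    (w t : H ⊗[k] (H ⊗[k] A)) (m : M) :
    pairAct Q act D (onSnd H (onSnd H 𝔸.rhoΔ) (sandSS Q 𝔸.left w t) * 𝔸.ΦρΘ)
        (splitFstLin C τ (τ m))
      = pairTwist Q act D (pairAct Q act D (onSnd H (onSnd H 𝔸.rhoΔ) w * 𝔸.ΦρΘ)
          ∘ₗ splitFstLin C τ ∘ₗ τ) t m := by
  induction t using tensor_ind with
  | add a b ha hb => simp only [map_add, add_mul, LinearMap.add_apply, ha, hb]
  | tmul a t =>
  induction t using tensor_ind with
  | add a b ha hb => simp only [map_add, TensorProduct.tmul_add, add_mul, LinearMap.add_apply,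
      ha, hb]
  | tmul b u =>
    rw [pairTwist_tmul, LinearMap.comp_apply, LinearMap.comp_apply, hτ,
      splitFstLin_tripleAct Q act D 𝔸 τ hτ, ← Module.End.mul_apply, ← map_mul,
      ← Module.End.mul_apply, ← map_mul, sandSS_tmul,
      map_mul (onSnd H (onSnd H 𝔸.rhoΔ)), map_mul (onSnd H (onSnd H 𝔸.rhoΔ)), mul_assoc, mul_assoc,
      mul_assoc, ← 𝔸.ΦρΘ_mul]
    congr 3
    · simp
    · exact (mul_assoc _ _ _).symm

/-- The diagonal action of q̃ passes f and becomes a comultiplied q̃ next to Φ_λ⁻¹, ready for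
`drinfeldTwist_mul_qEl`. -/
theorem tripleAct_qEl (z : M ⊗[k] (C ⊗[k] C)) :
    tripleAct Q act (diagAct Q D) (onSnd H 𝔸.right.ρ (qEl Q 𝔸.left)) (pairAct Q act D
        (TensorProduct.assoc k H H _ (Q.drinfeldTwist ⊗ₜ 1)
          * (onSnd H (onSnd H 𝔸.rhoΔ) (↑𝔸.left.Φlam⁻¹ : H ⊗[k] (H ⊗[k] A)) * 𝔸.ΦρΘ)) z)
      = pairAct Q act D (onSnd H (onSnd H 𝔸.rhoΔ)
          (sandSS Q 𝔸.left (qqEl Q 𝔸.left) (𝔸.left.Φlam : H ⊗[k] (H ⊗[k] A))) * 𝔸.ΦρΘ) z := by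
  have e : ∀ t : H ⊗[k] H, TensorProduct.assoc k H H _ (t ⊗ₜ 1)
      = onSnd H (onSnd H 𝔸.rhoΔ) (TensorProduct.assoc k H H A (t ⊗ₜ 1)) := by
    intro t
    induction t using tensor_ind with
    | add a b ha hb => simp only [map_add, TensorProduct.add_tmul, ha, hb]
    | tmul a b => simp
  rw [tripleAct_diagAct_drinfeldTwist, onSnd_comp_apply]
  change pairAct Q act D (_ * (splitFst _ Q.Δ (onSnd H 𝔸.rhoΔ _) * _)) z = _
  rw [splitFst_natural, e, ← mul_assoc, ← mul_assoc, ← map_mul, ← map_mul,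
    drinfeldTwist_mul_qEl]

theorem padRight_eq (q : H ⊗[k] A) :
    padRight H (onSnd H 𝔸.right.ρ q)
      = onSnd H (splitFst H 𝔸.right.ρ) (onSnd H Algebra.TensorProduct.includeLeft q) := by
  have key : ∀ t : A ⊗[k] H, onSnd A (Algebra.TensorProduct.includeLeft : H →ₐ[k] H ⊗[k] H) t
      = TensorProduct.assoc k A H H (t ⊗ₜ 1) := by
    intro t
    induction t using tensor_ind with
    | add a b ha hb => simp only [map_add, TensorProduct.add_tmul, ha, hb]
    | tmul a b => simp
  induction q using tensor_ind with
  | add a b ha hb => simp only [map_add, ha, hb]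
  | tmul a b =>
    rw [padRight, Algebra.TensorProduct.map_tmul, Algebra.TensorProduct.map_tmul, key]
    simp

theorem assoc_tripleAct (w : H ⊗[k] (A ⊗[k] H)) (x : M ⊗[k] C) (c : C) :
    TensorProduct.assoc k M C C (tripleAct Q act D.opTensorAct w x ⊗ₜ c)
      = pairAct Q act D (padLeft H (padRight H w)) (TensorProduct.assoc k M C C (x ⊗ₜ c)) := by
  induction w using tensor_ind with
  | add a b ha hb => simp only [map_add, TensorProduct.add_tmul, LinearMap.add_apply, ha, hb]
  | tmul h t =>
  induction t using tensor_ind with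
  | add a b ha hb => simp only [map_add, TensorProduct.tmul_add, TensorProduct.add_tmul,
      LinearMap.add_apply, ha, hb]
  | tmul u b =>
  induction x using tensor_ind with
  | add a b ha hb => simp only [map_add, TensorProduct.add_tmul, ha, hb]
  | tmul m d =>
    rw [padRight_tmul, Algebra.TensorProduct.includeRight_apply, TensorProduct.assoc_tmul,
      pairAct_tmul, tripleAct_tmul, map_one, ← Algebra.TensorProduct.one_def, map_one]
    rfl

/-- Covariance moves the A-leg of `w` out of τ, to the right of q̃, while the first leg enters
through S on its left. At Θ⁻¹ this is the pattern evaluated by `sandS_qEl_Θ`. -/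
theorem tensorAct_twistMap {τ : M →ₗ[k] M ⊗[k] C}
    (hτ : ∀ u m, τ (act u m)
      = tripleAct Q act D.opTensorAct (onSnd H 𝔸.right.ρ (𝔸.left.lam u)) (τ m))
    (w : H ⊗[k] (A ⊗[k] H)) (z : M ⊗[k] C) :
    TensorProduct.assoc k M C C
        (tensorAct (twistMap D act
          (tripleAct Q act D.opTensorAct (onSnd H 𝔸.right.ρ (qEl Q 𝔸.left)) ∘ₗ τ))
          D.lact.toLinearMap ((TensorProduct.assoc k H A H).symm w) z)
      = pairAct Q act D (padLeft H (onSnd H (splitFst H 𝔸.right.ρ)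
          (Q.sandS (A ⊗[k] H) (onSnd H Algebra.TensorProduct.includeLeft (qEl Q 𝔸.left))
            (onSnd H (splitFst H 𝔸.left.lam) w)))) (splitFstLin C τ z) := by
  induction w using tensor_ind with
  | add a b ha hb => simp only [map_add, LinearMap.add_apply, ha, hb]
  | tmul h t =>
  induction t using tensor_ind with
  | add a b ha hb => simp only [map_add, TensorProduct.tmul_add, LinearMap.add_apply, ha, hb]
  | tmul u b =>
  induction z using tensor_ind with
  | add a b ha hb => simp only [map_add, ha, hb]
  | tmul m c =>
    rw [TensorProduct.assoc_symm_tmul, tensorAct_tmul, TensorProduct.map_tmul, twistMap_eq,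
      TensorProduct.map_tmul, leftTwist_tmul, LinearMap.comp_apply, ← Module.End.mul_apply,
      ← map_mul, assoc_tripleAct]
    have e1 : TensorProduct.assoc k M C C (τ (act u m) ⊗ₜ D.lact.toLinearMap b c)
        = splitFstLin C τ (tripleAct Q act D.opTensorAct (1 ⊗ₜ (u ⊗ₜ b)) (m ⊗ₜ c)) := by
      rw [tripleAct_one_tmul]
      rfl
    rw [LinearMap.id_apply, e1, splitFstLin_tripleAct Q act D 𝔸 τ hτ, ← Module.End.mul_apply,
      ← map_mul]
    congr 2
    rw [map_mul (padRight H), padRight_eq, Algebra.TensorProduct.map_tmul,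
      Algebra.TensorProduct.map_tmul, Q.sandS_tmul, map_mul (onSnd H (splitFst H 𝔸.right.ρ)),
      map_mul (onSnd H (splitFst H 𝔸.right.ρ)), Algebra.TensorProduct.includeRight_apply,
      Algebra.TensorProduct.includeRight_apply, Algebra.TensorProduct.tmul_mul_tmul]
    simp [BicomoduleAlgebra.lamRho, Algebra.TensorProduct.one_def]

/-- Both sides of the first condition are covariant for the diagonal action, so they may be compared
after applying q̃; that comparison is the second condition up to invertible Φ_λ and Φ_ρ. The map σ
is a variable so that, when τ is a p̃-twist, it can be replaced by the original coaction. -/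
theorem coassoc_iff {τ : M →ₗ[k] M ⊗[k] C}
    (hτ : ∀ u m, τ (act u m)
      = tripleAct Q act D.opTensorAct (onSnd H 𝔸.right.ρ (𝔸.left.lam u)) (τ m)) :
    (∀ m, tensorAct act.toLinearMap
        (tensorAct D.opTensorAct.toLinearMap D.opTensorAct.toLinearMap) (PhiRhoTwo Q 𝔸)
        (splitFstLin C τ (τ m)) = TensorProduct.map LinearMap.id D.Δ (τ m))
    ↔ ∀ σ, σ = tripleAct Q act D.opTensorAct (onSnd H 𝔸.right.ρ (qEl Q 𝔸.left)) ∘ₗ τ →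
      ∀ m, TensorProduct.assoc k M C C
        (tensorAct (twistMap D act σ) D.lact.toLinearMap
          ((TensorProduct.assoc k H A H).symm (↑𝔸.Θ⁻¹ : H ⊗[k] (A ⊗[k] H))) (σ m))
      = tensorAct act.toLinearMap (tensorAct D.lact.toLinearMap D.lact.toLinearMap)
          (↑𝔸.right.Φρ⁻¹ : A ⊗[k] (H ⊗[k] H))
          (twistMap₂ D act σ
            ((TensorProduct.assoc k H H A).symm (↑𝔸.left.Φlam⁻¹ : H ⊗[k] (H ⊗[k] A))) m) := by
  set F := TensorProduct.assoc k H H (A ⊗[k] (H ⊗[k] H)) (Q.drinfeldTwist ⊗ₜ 1) with hF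
  set Ψ := onSnd H (onSnd H 𝔸.rhoΔ) (↑𝔸.left.Φlam⁻¹ : H ⊗[k] (H ⊗[k] A)) * 𝔸.ΦρΘ with hΨ
  set τ₂ : M →ₗ[k] M ⊗[k] (C ⊗[k] C) := pairAct Q act D (F * Ψ) ∘ₗ splitFstLin C τ ∘ₗ τ with hτ₂
  set τΔ : M →ₗ[k] M ⊗[k] (C ⊗[k] C) := TensorProduct.map LinearMap.id D.Δ ∘ₗ τ with hτΔ
  set G := tripleAct Q act (diagAct Q D) (onSnd H 𝔸.right.ρ (qEl Q 𝔸.left)) with hG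
  set Λ : M →ₗ[k] M ⊗[k] (C ⊗[k] C) := pairAct Q act D
    (onSnd H (onSnd H 𝔸.rhoΔ) (qqEl Q 𝔸.left) * 𝔸.ΦρΘ) ∘ₗ splitFstLin C τ ∘ₗ τ with hΛ
  set X : M →ₗ[k] M ⊗[k] (C ⊗[k] C) := TensorProduct.map LinearMap.id D.Δ ∘ₗ
    tripleAct Q act D.opTensorAct (onSnd H 𝔸.right.ρ (qEl Q 𝔸.left)) ∘ₗ τ with hX
  have ePhi : PhiRhoTwo Q 𝔸 = reorder Q (F * Ψ) := by
    rw [hF, hΨ, BicomoduleAlgebra.ΦρΘ, ← mul_assoc, ← mul_assoc]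
    rfl
  -- Covariance of τ produces a factor to the right of `Ψ`; `splitFst_lam_mul` moves it to the left,
  -- and passing f it becomes the diagonal action.
  have hτ₂' : ∀ u m, τ₂ (act u m)
      = tripleAct Q act (diagAct Q D) (onSnd H 𝔸.right.ρ (𝔸.left.lam u)) (τ₂ m) := by
    intro u m
    have e : onSnd H (onSnd A Q.Δ) (onSnd H 𝔸.right.ρ (𝔸.left.lam u))
        = onSnd H 𝔸.rhoΔ (𝔸.left.lam u) := onSnd_comp_apply _ _ _
    rw [hτ₂, LinearMap.comp_apply, LinearMap.comp_apply, hτ,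
      splitFstLin_tripleAct Q act D 𝔸 τ hτ, ← Module.End.mul_apply, ← map_mul,
      LinearMap.comp_apply, LinearMap.comp_apply, tripleAct_diagAct_drinfeldTwist,
      e, mul_assoc, hΨ, ← splitFst_lam_mul]
  have hτΔ' : ∀ u m, τΔ (act u m)
      = tripleAct Q act (diagAct Q D) (onSnd H 𝔸.right.ρ (𝔸.left.lam u)) (τΔ m) := by
    intro u m
    rw [hτΔ, LinearMap.comp_apply, hτ, LinearMap.comp_apply, tripleAct_diagAct_Δ]
  have eG₂ : G ∘ₗ τ₂ = pairTwist Q act D Λ (𝔸.left.Φlam : H ⊗[k] (H ⊗[k] A)) := by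
    refine LinearMap.ext fun m => ?_
    rw [hΛ, ← pairAct_sandSS Q act D 𝔸 hτ, ← tripleAct_qEl]
    rfl
  have eGΔ : G ∘ₗ τΔ = X := by
    refine LinearMap.ext fun m => ?_
    rw [hX, LinearMap.comp_apply, LinearMap.comp_apply, LinearMap.comp_apply,
      LinearMap.comp_apply, hG, tripleAct_diagAct_Δ]
  have step₁ : (∀ m, tensorAct act.toLinearMap
        (tensorAct D.opTensorAct.toLinearMap D.opTensorAct.toLinearMap) (PhiRhoTwo Q 𝔸)
        (splitFstLin C τ (τ m)) = TensorProduct.map LinearMap.id D.Δ (τ m)) ↔ τ₂ = τΔ := by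
    rw [ePhi, tensorAct_reorder, LinearMap.ext_iff]
    rfl
  -- Applying q̃ has the p̃-twist as left inverse on covariant maps.
  have step₂ : τ₂ = τΔ ↔ G ∘ₗ τ₂ = G ∘ₗ τΔ := by
    refine ⟨fun h => by rw [h], fun h => LinearMap.ext fun m => ?_⟩
    rw [← leftTwist_pEl_qEl hτ₂' m, ← leftTwist_pEl_qEl hτΔ' m, ← hG, h]
  -- `Λ` is Φ_ρ applied to the left side of Yetter-Drinfeld coassociativity for the q̃-twist.
  have eΛ : ∀ m, Λ m = pairAct Q act D (padLeft H (padLeft H (𝔸.right.Φρ : A ⊗[k] (H ⊗[k] H))))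
      (TensorProduct.assoc k M C C (tensorAct (twistMap D act
        (tripleAct Q act D.opTensorAct (onSnd H 𝔸.right.ρ (qEl Q 𝔸.left)) ∘ₗ τ))
          D.lact.toLinearMap ((TensorProduct.assoc k H A H).symm
            (↑𝔸.Θ⁻¹ : H ⊗[k] (A ⊗[k] H)))
        ((tripleAct Q act D.opTensorAct (onSnd H 𝔸.right.ρ (qEl Q 𝔸.left)) ∘ₗ τ) m))) := by
    intro m
    rw [tensorAct_twistMap Q act D 𝔸 hτ, sandS_qEl_Θ,
      LinearMap.comp_apply (tripleAct Q act D.opTensorAct _),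
      splitFstLin_tripleAct Q act D 𝔸 τ hτ, ← Module.End.mul_apply, ← Module.End.mul_apply,
      ← map_mul, ← map_mul, mul_assoc, ΦρΘ_qEl]
    rfl
  rw [step₁, step₂, eG₂, eGΔ, pairTwist_eq_iff, LinearMap.ext_iff, forall_eq]
  refine forall_congr' fun m => ?_
  rw [eΛ, tensorAct_lact_lact]
  have eX : twistMap₂ D act
      (tripleAct Q act D.opTensorAct (onSnd H 𝔸.right.ρ (qEl Q 𝔸.left)) ∘ₗ τ)
      ((TensorProduct.assoc k H H A).symm (↑𝔸.left.Φlam⁻¹ : H ⊗[k] (H ⊗[k] A))) m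
      = pairTwist Q act D X (↑𝔸.left.Φlam⁻¹ : H ⊗[k] (H ⊗[k] A)) m := rfl
  rw [eX]
  constructor
  · intro h
    rw [← h, ← Module.End.mul_apply, ← map_mul, ← map_mul, ← map_mul, Units.inv_mul, map_one,
      map_one, map_one]
    rfl
  · intro h
    rw [h, ← Module.End.mul_apply, ← map_mul, ← map_mul, ← map_mul, Units.mul_inv, map_one,
      map_one, map_one]
    rfl

end Coassociativity

/-! ### The twists exchange the two kinds of modules. -/

section Correspondence

variable {k H A M C : Type*} [Field k] [Ring H] [Algebra k H] [Ring A] [Algebra k A]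
variable [AddCommGroup M] [Module k M] [AddCommGroup C] [Module k C]
variable {Q : QuasiHopfAlgebra k H} {𝔸 : BicomoduleAlgebra Q.toQuasiBialgebra A}
variable {D : BimoduleCoalgebra Q.toQuasiBialgebra C} {act : A →ₐ[k] Module.End k M}
variable {τ : M →ₗ[k] M ⊗[k] C}

theorem IsDoiHopfModule.coact_act_triple
    (h : IsDoiHopfModule (rhoTwo Q 𝔸) (PhiRhoTwo Q 𝔸) D.toOpTensor act τ) (u : A) (m : M) :
    τ (act u m)
      = tripleAct Q act D.opTensorAct (onSnd H 𝔸.right.ρ (𝔸.left.lam u)) (τ m) := by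
  rw [← tensorAct_rhoTwo]
  exact h.coact_act u m

theorem IsYetterDrinfeldModule.compat_triple (h : IsYetterDrinfeldModule 𝔸 D act τ)
    (u : A) (m : M) :
    tripleAct Q act D.opTensorAct (1 ⊗ₜ 𝔸.right.ρ u) (τ m)
      = leftTwist (tripleAct Q act D.opTensorAct) act τ
        (TensorProduct.map Q.S.toLinearMap LinearMap.id (𝔸.left.lam u)) m := by
  rw [tripleAct_one_tmul, ← twistMap_eq]
  exact h.compat u m

theorem counit_onSnd_rho (t : H ⊗[k] A) : onSnd H (dropSnd A Q.ε) (onSnd H 𝔸.right.ρ t) = t := by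
  induction t using tensor_ind with
  | add a b ha hb => simp only [map_add, ha, hb]
  | tmul a b => simp [𝔸.right.counit]

theorem counit_leftTwist (h : ∀ m : M,
      TensorProduct.rid k M (TensorProduct.map LinearMap.id D.ε (τ m)) = m) (t : H ⊗[k] A) (m : M) :
    TensorProduct.rid k M (TensorProduct.map LinearMap.id D.ε
      (leftTwist (tripleAct Q act D.opTensorAct) act τ t m)) = act (dropFst A Q.ε t) m := by
  induction t using tensor_ind with
  | add a b ha hb => simp only [map_add, LinearMap.add_apply, ha, hb]
  | tmul a b =>
    rw [leftTwist_tmul, counit_tripleAct, h, Algebra.TensorProduct.one_def]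
    simp

theorem IsDoiHopfModule.isYetterDrinfeldModule
    (h : IsDoiHopfModule (rhoTwo Q 𝔸) (PhiRhoTwo Q 𝔸) D.toOpTensor act τ) :
    IsYetterDrinfeldModule 𝔸 D act
      (tripleAct Q act D.opTensorAct (onSnd H 𝔸.right.ρ (qEl Q 𝔸.left)) ∘ₗ τ) where
  counit m := by
    have := h.counit m
    rw [LinearMap.comp_apply, counit_tripleAct, counit_onSnd_rho, dropFst_qEl, map_one]
    exact this
  coassoc m := (coassoc_iff Q act D 𝔸 h.coact_act_triple).1 h.coassoc _ rfl m
  compat u m := by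
    rw [twistMap_eq, ← tripleAct_one_tmul]
    exact compat_of_coact_act h.coact_act_triple u m

theorem IsYetterDrinfeldModule.isDoiHopfModule (h : IsYetterDrinfeldModule 𝔸 D act τ) :
    IsDoiHopfModule (rhoTwo Q 𝔸) (PhiRhoTwo Q 𝔸) D.toOpTensor act
      (leftTwist (tripleAct Q act D.opTensorAct) act τ (pEl Q 𝔸.left)) where
  counit m := by
    refine (counit_leftTwist h.counit _ m).trans ?_
    rw [dropFst_pEl, map_one]
    rfl
  coassoc := by
    -- The equivalence is applied to the p̃-twist of τ; its q̃-twist is τ itself, whose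
    -- coassociativity is the hypothesis.
    refine (coassoc_iff Q act D 𝔸 (coact_act_of_compat h.compat_triple)).2 ?_
    rintro σ hσ
    have e : σ = τ := by
      rw [hσ]
      exact LinearMap.ext fun m => leftTwist_qEl_pEl h.compat_triple m
    rw [e]
    exact h.coassoc
  coact_act u m := by
    refine (coact_act_of_compat h.compat_triple u m).trans ?_
    rw [← tensorAct_rhoTwo]
    rfl

end Correspondence

/-! ### The two composites are identity functors. -/

section Functors

variable {k H A C : Type u} [Field k] [Ring H] [Algebra k H] [Ring A] [Algebra k A]
  [AddCommGroup C] [Module k C]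
variable (Q : QuasiHopfAlgebra k H) (𝔸 : BicomoduleAlgebra Q.toQuasiBialgebra A)
  (D : BimoduleCoalgebra Q.toQuasiBialgebra C)

/-- The same module, with another coaction. -/
abbrev CoactModule.withCoact (M : CoactModule k A C) (τ : M.carrier →ₗ[k] M.carrier ⊗[k] C) :
    CoactModule k A C := { M with coact := τ }

theorem twistP_eq (M : CoactModule k A C) : twistP Q 𝔸 D M
    = leftTwist (tripleAct Q M.act D.opTensorAct) M.act M.coact (pEl Q 𝔸.left) :=
  twistMap_pTilde Q M.act D 𝔸 M.coact

theorem twistQ_eq (M : CoactModule k A C) : twistQ Q 𝔸 D M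
    = tripleAct Q M.act D.opTensorAct (onSnd H 𝔸.right.ρ (qEl Q 𝔸.left)) ∘ₗ M.coact :=
  conjAct_qTilde Q M.act D 𝔸 M.coact

variable {Q 𝔸 D}

theorem isDoiHopfModule_twistP (M : YetterDrinfeldModule Q 𝔸 D) :
    IsDoiHopfModule (rhoTwo Q 𝔸) (PhiRhoTwo Q 𝔸) D.toOpTensor M.act
      (twistP Q 𝔸 D M.toCoactModule) := by
  rw [twistP_eq]
  exact M.isYetterDrinfeld.isDoiHopfModule

theorem isYetterDrinfeldModule_twistQ (M : DoiHopfModule Q 𝔸 D) :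
    IsYetterDrinfeldModule 𝔸 D M.act (twistQ Q 𝔸 D M.toCoactModule) := by
  rw [twistQ_eq]
  exact M.isDoiHopf.isYetterDrinfeldModule

theorem YetterDrinfeldModule.ext_coact {M N : YetterDrinfeldModule Q 𝔸 D}
    (h : M.toCoactModule = N.toCoactModule) : M = N := by
  cases M; cases N; cases h; rfl

theorem DoiHopfModule.ext_coact {M N : DoiHopfModule Q 𝔸 D}
    (h : M.toCoactModule = N.toCoactModule) : M = N := by
  cases M; cases N; cases h; rfl

/-- Equality of functors compares morphisms over objects that are equal only propositionally.
Morphisms are determined by their linear maps, so it suffices to compare those. -/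
theorem CoactModule.hom_heq {M M' N N' : CoactModule k A C} (hM : M = M') (hN : N = N')
    {f : CoactModule.Hom M N} {g : CoactModule.Hom M' N'} (h : HEq f.toLin g.toLin) : HEq f g := by
  cases hM; cases hN
  exact heq_of_eq (CoactModule.Hom.ext (eq_of_heq h))

theorem twistQ_twistP (M : YetterDrinfeldModule Q 𝔸 D) :
    twistQ Q 𝔸 D (M.toCoactModule.withCoact (twistP Q 𝔸 D M.toCoactModule)) = M.coact := by
  rw [twistQ_eq, twistP_eq]
  exact LinearMap.ext fun m => leftTwist_qEl_pEl M.isYetterDrinfeld.compat_triple m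

theorem twistP_twistQ (M : DoiHopfModule Q 𝔸 D) :
    twistP Q 𝔸 D (M.toCoactModule.withCoact (twistQ Q 𝔸 D M.toCoactModule)) = M.coact := by
  rw [twistP_eq, twistQ_eq]
  exact LinearMap.ext fun m => leftTwist_pEl_qEl M.isDoiHopf.coact_act_triple m

theorem functorF_comp_functorG :
    functorF (isDoiHopfModule_twistP (Q := Q) (𝔸 := 𝔸) (D := D))
      ⋙ functorG isYetterDrinfeldModule_twistQ = 𝟭 (YetterDrinfeldModule Q 𝔸 D) := by
  have e : ∀ M : YetterDrinfeldModule Q 𝔸 D,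
      M.toCoactModule.withCoact (twistQ Q 𝔸 D
        (M.toCoactModule.withCoact (twistP Q 𝔸 D M.toCoactModule))) = M.toCoactModule := fun M => by
    rw [twistQ_twistP]
  refine Functor.hext (fun M => YetterDrinfeldModule.ext_coact (e M)) fun M N f => ?_
  -- The carriers and the linear map are literally unchanged; only the coactions differ.
  exact CoactModule.hom_heq (e M) (e N) HEq.rfl

theorem functorG_comp_functorF :
    functorG (isYetterDrinfeldModule_twistQ (Q := Q) (𝔸 := 𝔸) (D := D))
      ⋙ functorF isDoiHopfModule_twistP = 𝟭 (DoiHopfModule Q 𝔸 D) := by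
  have e : ∀ M : DoiHopfModule Q 𝔸 D,
      M.toCoactModule.withCoact (twistP Q 𝔸 D
        (M.toCoactModule.withCoact (twistQ Q 𝔸 D M.toCoactModule))) = M.toCoactModule := fun M => by
    rw [twistP_twistQ]
  refine Functor.hext (fun M => DoiHopfModule.ext_coact (e M)) fun M N f => ?_
  exact CoactModule.hom_heq (e M) (e N) HEq.rfl

end Functors

/-! ### Yetter-Drinfeld conditions on submodules and on sums of images. -/

section Naturality

theorem iSup_range_ind {k N : Type*} [Semiring k] [AddCommMonoid N] [Module k N] {ι : Sort*}
    {M : ι → Type*} [∀ j, AddCommMonoid (M j)] [∀ j, Module k (M j)] {f : ∀ j, M j →ₗ[k] N}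
    (hf : ⨆ j, LinearMap.range (f j) = ⊤) {P : N → Prop} (h0 : P 0) (hj : ∀ j m, P (f j m))
    (hadd : ∀ x y, P x → P y → P (x + y)) (x : N) : P x := by
  have hx : x ∈ ⨆ j, LinearMap.range (f j) := hf ▸ Submodule.mem_top
  refine Submodule.iSup_induction (fun j => LinearMap.range (f j)) (motive := P) hx ?_ h0 hadd
  rintro j _ ⟨m, rfl⟩
  exact hj j m

variable {k H A C : Type u} [Field k] [Ring H] [Algebra k H] [Ring A] [Algebra k A]
  [AddCommGroup C] [Module k C]
variable {Q : QuasiBialgebra k H} {𝔸 : BicomoduleAlgebra Q A} {D : BimoduleCoalgebra Q C}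

namespace CoactModule.Hom

variable {M N : CoactModule k A C} (f : CoactModule.Hom M N)

theorem map_counit (e : C →ₗ[k] k) (m : M.carrier) :
    TensorProduct.rid k N.carrier (TensorProduct.map LinearMap.id e (N.coact (f.toLin m)))
      = f.toLin (TensorProduct.rid k M.carrier (TensorProduct.map LinearMap.id e (M.coact m))) := by
  rw [f.map_coact]
  induction M.coact m using tensor_ind with
  | add a b ha hb => simp only [map_add, ha, hb]
  | tmul a b => simp

theorem map_twistMap (t : H ⊗[k] A) (m : M.carrier) :
    twistMap D N.act N.coact t (f.toLin m)
      = TensorProduct.map f.toLin LinearMap.id (twistMap D M.act M.coact t m) := by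
  induction t using tensor_ind with
  | add a b ha hb => simp only [map_add, LinearMap.add_apply, ha, hb]
  | tmul h u =>
    change LinearMap.lTensor N.carrier (D.ract h) (N.coact (N.act u (f.toLin m)))
      = TensorProduct.map f.toLin LinearMap.id
        (LinearMap.lTensor M.carrier (D.ract h) (M.coact (M.act u m)))
    rw [← f.map_act, f.map_coact]
    induction M.coact (M.act u m) using tensor_ind with
    | add x y hx hy => simp only [map_add, hx, hy]
    | tmul x c => rfl

theorem map_twistMap₂ (t : (H ⊗[k] H) ⊗[k] A) (m : M.carrier) :
    twistMap₂ D N.act N.coact t (f.toLin m)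
      = TensorProduct.map f.toLin LinearMap.id (twistMap₂ D M.act M.coact t m) := by
  induction t using tensor_ind with
  | add a b ha hb => simp only [map_add, LinearMap.add_apply, ha, hb]
  | tmul h u =>
    change LinearMap.lTensor N.carrier (tensorAct D.ract D.ract h)
        (TensorProduct.map LinearMap.id D.Δ (N.coact (N.act u (f.toLin m))))
      = TensorProduct.map f.toLin LinearMap.id
        (LinearMap.lTensor M.carrier (tensorAct D.ract D.ract h)
          (TensorProduct.map LinearMap.id D.Δ (M.coact (M.act u m))))
    rw [← f.map_act, f.map_coact]
    induction M.coact (M.act u m) using tensor_ind with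
    | add x y hx hy => simp only [map_add, hx, hy]
    | tmul x c => rfl

theorem map_tensorAct {X V : Type*} [AddCommGroup X] [Module k X] [AddCommGroup V] [Module k V]
    (g : X →ₗ[k] Module.End k V) (t : A ⊗[k] X) (z : M.carrier ⊗[k] V) :
    tensorAct N.act.toLinearMap g t (TensorProduct.map f.toLin LinearMap.id z)
      = TensorProduct.map f.toLin LinearMap.id (tensorAct M.act.toLinearMap g t z) := by
  induction t using tensor_ind with
  | add a b ha hb => simp only [map_add, LinearMap.add_apply, ha, hb]
  | tmul a x =>
  induction z using tensor_ind with
  | add a b ha hb => simp only [map_add, ha, hb]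
  | tmul m v =>
    rw [TensorProduct.map_tmul, tensorAct_tmul, tensorAct_tmul, TensorProduct.map_tmul,
      TensorProduct.map_tmul, TensorProduct.map_tmul]
    exact congrArg₂ _ (f.map_act a m).symm rfl

theorem map_assoc_tensorAct (t : (H ⊗[k] A) ⊗[k] H) (z : M.carrier ⊗[k] C) :
    TensorProduct.assoc k N.carrier C C (tensorAct (twistMap D N.act N.coact) D.lact.toLinearMap t
        (TensorProduct.map f.toLin LinearMap.id z))
      = TensorProduct.map f.toLin LinearMap.id (TensorProduct.assoc k M.carrier C C
        (tensorAct (twistMap D M.act M.coact) D.lact.toLinearMap t z)) := by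
  induction t using tensor_ind with
  | add a b ha hb => simp only [map_add, LinearMap.add_apply, ha, hb]
  | tmul s h =>
  induction z using tensor_ind with
  | add a b ha hb => simp only [map_add, ha, hb]
  | tmul m c =>
    rw [TensorProduct.map_tmul, tensorAct_tmul, tensorAct_tmul, TensorProduct.map_tmul,
      TensorProduct.map_tmul, map_twistMap]
    induction twistMap D M.act M.coact s m using tensor_ind with
    | add a b ha hb => simp only [map_add, TensorProduct.add_tmul, ha, hb]
    | tmul a b => rfl

theorem map_injective (hf : Function.Injective f.toLin) (V : Type*) [AddCommGroup V] [Module k V] :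
    Function.Injective (TensorProduct.map f.toLin (LinearMap.id : V →ₗ[k] V)) :=
  Module.Flat.rTensor_preserves_injective_linearMap (M := V) f.toLin hf

/-- Every condition equates maps natural in the module, with values in the module tensored with a
fixed space. Over a field f ⊗ id stays injective, so the equations hold in the source. -/
theorem isYetterDrinfeldModule_of_injective (hf : Function.Injective f.toLin)
    (h : IsYetterDrinfeldModule 𝔸 D N.act N.coact) :
    IsYetterDrinfeldModule 𝔸 D M.act M.coact where
  counit m := hf (by rw [← f.map_counit, h.counit])
  coassoc m := f.map_injective hf _ (by
    rw [← f.map_assoc_tensorAct, ← f.map_coact, h.coassoc, f.map_twistMap₂, f.map_tensorAct])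
  compat u m := f.map_injective hf _ (by
    rw [← f.map_tensorAct, ← f.map_coact, h.compat, f.map_twistMap])

/-- The conditions are linear in m and transported by morphisms, so it suffices that they hold on
images that together span. -/
theorem isYetterDrinfeldModule_of_iSup_range {ι : Sort*} {M : ι → CoactModule k A C}
    (f : ∀ j, CoactModule.Hom (M j) N) (hf : ⨆ j, LinearMap.range (f j).toLin = ⊤)
    (h : ∀ j, IsYetterDrinfeldModule 𝔸 D (M j).act (M j).coact) :
    IsYetterDrinfeldModule 𝔸 D N.act N.coact := by
  constructor
  · refine iSup_range_ind hf (by simp) (fun j m => ?_)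
      fun x y hx hy => by simp only [map_add, hx, hy]
    rw [(f j).map_counit, (h j).counit]
  · refine iSup_range_ind hf (by simp) (fun j m => ?_)
      fun x y hx hy => by simp only [map_add, hx, hy]
    rw [(f j).map_coact, (f j).map_assoc_tensorAct, (h j).coassoc, (f j).map_twistMap₂,
      (f j).map_tensorAct]
  · intro u
    refine iSup_range_ind hf (by simp) (fun j m => ?_)
      fun x y hx hy => by simp only [map_add, hx, hy]
    rw [(f j).map_coact, (f j).map_tensorAct, (h j).compat, (f j).map_twistMap]

end CoactModule.Hom

end Naturality

/-! ### Coactions as families of operators indexed by a basis of C. -/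

section Coordinates

variable {k A C I : Type u} [Field k] [Ring A] [Algebra k A] [AddCommGroup C] [Module k C]
variable (b : Module.Basis I k C)

open Classical in
/-- The coordinates `M ⊗ C ≃ M^(I)` with respect to a basis of `C`. -/
noncomputable def coords (M : Type*) [AddCommGroup M] [Module k M] : M ⊗[k] C ≃ₗ[k] I →₀ M :=
  TensorProduct.equivFinsuppOfBasisRight b

theorem coords_map {M N : Type*} [AddCommGroup M] [Module k M] [AddCommGroup N] [Module k N]
    (f : M →ₗ[k] N) (z : M ⊗[k] C) (i : I) :
    coords b N (TensorProduct.map f LinearMap.id z) i = f (coords b M z i) := by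
  induction z using tensor_ind with
  | add x y hx hy => simp only [map_add, Finsupp.add_apply, hx, hy]
  | tmul m c => simp [coords]

namespace CoactModule

/-- The operators on a module with coaction given by the action of `A` and by the coordinates of
the coaction. -/
noncomputable def operator (M : CoactModule k A C) : A ⊕ I → Module.End k M.carrier :=
  Sum.elim M.act fun i => Finsupp.lapply i ∘ₗ (coords b M.carrier).toLinearMap ∘ₗ M.coact

/-- The representation of the free algebra by these operators. -/
noncomputable def rep (M : CoactModule k A C) :
    FreeAlgebra k (A ⊕ I) →ₐ[k] Module.End k M.carrier :=
  FreeAlgebra.lift k (M.operator b)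

theorem rep_ι (M : CoactModule k A C) (x : A ⊕ I) :
    M.rep b (FreeAlgebra.ι k x) = M.operator b x := FreeAlgebra.lift_ι_apply _ _

variable {b}

/-- A linear map commuting with the operators is a morphism. -/
def Hom.ofRep {M N : CoactModule k A C} (f : M.carrier →ₗ[k] N.carrier)
    (h : ∀ r m, f (M.rep b r m) = N.rep b r (f m)) : Hom M N where
  toLin := f
  map_act u m := by
    have := h (FreeAlgebra.ι k (Sum.inl u)) m
    rwa [rep_ι, rep_ι] at this
  map_coact m := (coords b N.carrier).injective (Finsupp.ext fun i => by
    have := h (FreeAlgebra.ι k (Sum.inr i)) m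
    rw [rep_ι, rep_ι] at this
    rw [coords_map]
    exact this.symm)

theorem Hom.map_rep {M N : CoactModule k A C} (f : Hom M N) (r : FreeAlgebra k (A ⊕ I))
    (m : M.carrier) : f.toLin (M.rep b r m) = N.rep b r (f.toLin m) := by
  induction r using FreeAlgebra.induction generalizing m with
  | grade0 c => simp
  | grade1 x =>
    rw [rep_ι, rep_ι]
    cases x with
    | inl u => exact f.map_act u m
    | inr i =>
      change f.toLin (coords b M.carrier (M.coact m) i) = coords b N.carrier (N.coact _) i
      rw [f.map_coact, coords_map]
  | mul x y hx hy => rw [map_mul, map_mul, Module.End.mul_apply, hx, hy]; rfl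
  | add x y hx hy => simp only [map_add, LinearMap.add_apply, hx, hy]

end CoactModule

/-- The conditions on a representation of the free algebra to come from an action of `A` and a
coaction. -/
structure IsRational {N : Type u} [AddCommGroup N] [Module k N]
    (ρ : FreeAlgebra k (A ⊕ I) →ₐ[k] Module.End k N) : Prop where
  one : ∀ n, ρ (FreeAlgebra.ι k (Sum.inl 1)) n = n
  mul : ∀ x y n, ρ (FreeAlgebra.ι k (Sum.inl (x * y))) n
    = ρ (FreeAlgebra.ι k (Sum.inl x)) (ρ (FreeAlgebra.ι k (Sum.inl y)) n)
  add : ∀ x y n, ρ (FreeAlgebra.ι k (Sum.inl (x + y))) n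
    = ρ (FreeAlgebra.ι k (Sum.inl x)) n + ρ (FreeAlgebra.ι k (Sum.inl y)) n
  smul : ∀ (c : k) x n, ρ (FreeAlgebra.ι k (Sum.inl (c • x))) n
    = c • ρ (FreeAlgebra.ι k (Sum.inl x)) n
  finite : ∀ n, (Function.support fun i => ρ (FreeAlgebra.ι k (Sum.inr i)) n).Finite

theorem CoactModule.isRational_rep (M : CoactModule k A C) : IsRational (M.rep b) where
  one n := by rw [rep_ι]; simp [operator]
  mul x y n := by rw [rep_ι, rep_ι, rep_ι]; simp [operator]
  add x y n := by rw [rep_ι, rep_ι, rep_ι]; simp [operator]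
  smul c x n := by rw [rep_ι, rep_ι]; simp [operator]
  finite n := by
    refine (coords b M.carrier (M.coact n)).hasFiniteSupport.subset fun i hi => ?_
    rw [Function.mem_support, rep_ι] at hi
    exact hi

section OfRational

variable {N : Type u} [AddCommGroup N] [Module k N]
  {ρ : FreeAlgebra k (A ⊕ I) →ₐ[k] Module.End k N}

/-- The equations pull back along an injection. For finiteness, an operator that kills f n also
kills n, so the support at n lies in the support at f n. -/
theorem IsRational.of_injective {M : CoactModule k A C} (f : N →ₗ[k] M.carrier)
    (hf : Function.Injective f) (h : ∀ r n, f (ρ r n) = M.rep b r (f n)) : IsRational ρ where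
  one n := hf (by rw [h, (M.isRational_rep b).one])
  mul x y n := hf (by rw [h, (M.isRational_rep b).mul, h, h])
  add x y n := hf (by rw [map_add, h, (M.isRational_rep b).add, h, h])
  smul c x n := hf (by rw [map_smul, h, (M.isRational_rep b).smul, h])
  finite n := by
    refine ((M.isRational_rep b).finite (f n)).subset fun i hi => ?_
    rw [Function.mem_support] at hi ⊢
    rw [← h]
    exact fun h0 => hi (hf (h0.trans (map_zero f).symm))

/-- Equations additive in n extend from spanning images; finiteness extends because the support at a
sum lies in the union of the supports. -/
theorem IsRational.of_iSup_range {ι : Sort*} {M : ι → CoactModule k A C}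
    (f : ∀ j, (M j).carrier →ₗ[k] N) (hf : ⨆ j, LinearMap.range (f j) = ⊤)
    (h : ∀ j r m, f j ((M j).rep b r m) = ρ r (f j m)) : IsRational ρ := by
  constructor
  · refine iSup_range_ind hf (by simp) (fun j m => ?_)
      fun x y hx hy => by simp only [map_add, hx, hy]
    rw [← h, ((M j).isRational_rep b).one]
  · intro x y
    refine iSup_range_ind hf (by simp) (fun j m => ?_)
      fun x y hx hy => by simp only [map_add, hx, hy]
    rw [← h, ((M j).isRational_rep b).mul, h, h]
  · intro x y
    refine iSup_range_ind hf (by simp) (fun j m => ?_) fun x y hx hy => by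
      simp only [map_add, hx, hy]; abel
    rw [← h, ((M j).isRational_rep b).add, map_add, h, h]
  · intro c x
    refine iSup_range_ind hf (by simp) (fun j m => ?_)
      fun x y hx hy => by simp only [map_add, smul_add, hx, hy]
    rw [← h, ((M j).isRational_rep b).smul, map_smul, h]
  · refine iSup_range_ind hf (by simp) (fun j m => ?_) fun x y hx hy => ?_
    · refine (((M j).isRational_rep b).finite m).subset fun i hi => ?_
      rw [Function.mem_support] at hi ⊢
      rw [← h] at hi
      exact fun h0 => hi (by rw [h0, map_zero])
    · refine (hx.union hy).subset fun i hi => ?_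
      rw [Function.mem_support, map_add] at hi
      by_contra hc
      simp only [Set.mem_union, Function.mem_support, not_or, not_not] at hc
      exact hi (by rw [hc.1, hc.2, add_zero])

/-- The module with coaction given by a rational representation. -/
noncomputable def IsRational.coactModule (h : IsRational ρ) : CoactModule k A C where
  carrier := N
  act := AlgHom.ofLinearMap
    { toFun := fun a => ρ (FreeAlgebra.ι k (Sum.inl a))
      map_add' := fun x y => LinearMap.ext (h.add x y)
      map_smul' := fun c x => LinearMap.ext (h.smul c x) }
    (LinearMap.ext h.one) fun x y => LinearMap.ext (h.mul x y)
  coact := (coords b N).symm.toLinearMap ∘ₗ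
    { toFun := fun n => Finsupp.ofSupportFinite _ (h.finite n)
      map_add' := fun x y => Finsupp.ext fun _ => map_add (ρ _) x y
      map_smul' := fun c x => Finsupp.ext fun _ => map_smul (ρ _) c x }

theorem IsRational.rep_coactModule (h : IsRational ρ) : (h.coactModule b).rep b = ρ := by
  refine FreeAlgebra.hom_ext (funext fun x => ?_)
  rw [Function.comp_apply, Function.comp_apply, CoactModule.rep_ι]
  cases x with
  | inl a => rfl
  | inr i =>
    refine LinearMap.ext fun n => ?_
    change coords b N ((coords b N).symm (Finsupp.ofSupportFinite _ (h.finite n))) i = _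
    rw [LinearEquiv.apply_symm_apply]
    rfl

end OfRational

end Coordinates

/-! ### Yetter-Drinfeld modules inside the modules over a free algebra. -/

section Representations

open Limits

variable {k H A C I : Type u} [Field k] [Ring H] [Algebra k H] [Ring A] [Algebra k A]
  [AddCommGroup C] [Module k C] (b : Module.Basis I k C)

/-- The module over the free algebra given by a module with coaction. -/
noncomputable def CoactModule.repModule (M : CoactModule k A C) :
    ModuleCat.{u} (FreeAlgebra k (A ⊕ I)) :=
  letI : Module (FreeAlgebra k (A ⊕ I)) M.carrier := Module.compHom M.carrier (M.rep b).toRingHom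
  ModuleCat.of (FreeAlgebra k (A ⊕ I)) M.carrier

/-- The morphism of modules over the free algebra given by a morphism. -/
noncomputable def CoactModule.Hom.repHom {M N : CoactModule k A C} (f : CoactModule.Hom M N) :
    M.repModule b ⟶ N.repModule b :=
  letI : Module (FreeAlgebra k (A ⊕ I)) M.carrier := Module.compHom M.carrier (M.rep b).toRingHom
  letI : Module (FreeAlgebra k (A ⊕ I)) N.carrier := Module.compHom N.carrier (N.rep b).toRingHom
  ModuleCat.ofHom (X := M.carrier) (Y := N.carrier)
    { toFun := f.toLin
      map_add' := f.toLin.map_add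
      map_smul' := f.map_rep }

/-- The `k`-linear structure of a module over the free algebra. -/
@[reducible] noncomputable def scalarModule (X : ModuleCat.{u} (FreeAlgebra k (A ⊕ I))) :
    Module k X :=
  Module.compHom X (algebraMap k (FreeAlgebra k (A ⊕ I)))

/-- The representation on a module over the free algebra. -/
noncomputable def moduleRep (X : ModuleCat.{u} (FreeAlgebra k (A ⊕ I))) :
    letI := scalarModule X
    FreeAlgebra k (A ⊕ I) →ₐ[k] Module.End k X :=
  letI := scalarModule X
  haveI : IsScalarTower k (FreeAlgebra k (A ⊕ I)) X :=
    IsScalarTower.of_algebraMap_smul fun _ _ => rfl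
  Algebra.lsmul k k X

/-- A morphism to the module given by a module with coaction is `k`-linear. -/
noncomputable def toRepModuleLin {X : ModuleCat.{u} (FreeAlgebra k (A ⊕ I))}
    {M : CoactModule k A C} (g : X ⟶ M.repModule b) :
    letI := scalarModule X
    X →ₗ[k] M.carrier :=
  letI := scalarModule X
  { toFun := g.hom
    map_add' := fun x y => map_add g.hom x y
    map_smul' := fun c x => by
      refine (g.hom.map_smul (algebraMap k (FreeAlgebra k (A ⊕ I)) c) x).trans ?_
      change M.rep b (algebraMap k _ c) (g.hom x) = _
      rw [AlgHom.commutes]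
      rfl }

/-- A morphism from the module given by a module with coaction is `k`-linear. -/
noncomputable def ofRepModuleLin {X : ModuleCat.{u} (FreeAlgebra k (A ⊕ I))}
    {M : CoactModule k A C} (g : M.repModule b ⟶ X) :
    letI := scalarModule X
    M.carrier →ₗ[k] X :=
  letI := scalarModule X
  { toFun := g.hom
    map_add' := fun x y => map_add g.hom x y
    map_smul' := fun c x => by
      refine Eq.trans ?_ (g.hom.map_smul (algebraMap k (FreeAlgebra k (A ⊕ I)) c) x)
      change _ = g.hom (M.rep b (algebraMap k _ c) x)
      rw [AlgHom.commutes]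
      rfl }

variable (Q : QuasiHopfAlgebra k H) (𝔸 : BicomoduleAlgebra Q.toQuasiBialgebra A)
  (D : BimoduleCoalgebra Q.toQuasiBialgebra C)

/-- Yetter-Drinfeld modules as modules over the free algebra. -/
noncomputable def repFunctor :
    YetterDrinfeldModule Q 𝔸 D ⥤ ModuleCat.{u} (FreeAlgebra k (A ⊕ I)) where
  obj M := M.toCoactModule.repModule b
  map {M N} (f : CoactModule.Hom M.toCoactModule N.toCoactModule) := f.repHom b

instance : (repFunctor b Q 𝔸 D).Faithful where
  map_injective {M N} f g h := by
    refine CoactModule.Hom.ext (LinearMap.ext fun m => ?_)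
    exact LinearMap.congr_fun (congrArg ModuleCat.Hom.hom h) m

instance : (repFunctor b Q 𝔸 D).Full where
  map_surjective {M N} g := by
    refine ⟨CoactModule.Hom.ofRep (b := b) (M := M.toCoactModule) (N := N.toCoactModule)
      { toFun := g.hom
        map_add' := fun x y => map_add g.hom x y
        map_smul' := fun c x => ?_ } fun r m => g.hom.map_smul r m, rfl⟩
    -- Scalars act through the free algebra, so linearity over it contains k-linearity.
    have h := g.hom.map_smul (algebraMap k (FreeAlgebra k (A ⊕ I)) c) x
    have h₁ : M.rep b (algebraMap k _ c) x = c • x := by rw [AlgHom.commutes]; rfl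
    have h₂ : N.rep b (algebraMap k _ c) (g.hom x) = c • (show N.carrier from g.hom x) := by
      rw [AlgHom.commutes]; rfl
    exact (congrArg g.hom h₁.symm).trans (h.trans h₂)

variable {b Q 𝔸 D}

/-- A rational representation is recovered from the coaction built from it, so the identity of X is
an isomorphism onto an object in the image. -/
theorem essImage_of_isRational {X : ModuleCat.{u} (FreeAlgebra k (A ⊕ I))}
    (h : letI := scalarModule X; IsRational (moduleRep X))
    (hY : letI := scalarModule X; IsYetterDrinfeldModule 𝔸 D (IsRational.coactModule b h).act
      (IsRational.coactModule b h).coact) : (repFunctor b Q 𝔸 D).essImage X := by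
  let _ := scalarModule X
  let M : YetterDrinfeldModule Q 𝔸 D := { IsRational.coactModule b h with isYetterDrinfeld := hY }
  let _ : Module (FreeAlgebra k (A ⊕ I)) M.carrier := Module.compHom M.carrier (M.rep b).toRingHom
  let e : M.carrier ≃ₗ[FreeAlgebra k (A ⊕ I)] X :=
    { toFun := fun x => x
      invFun := fun x => x
      map_add' := fun _ _ => rfl
      left_inv := fun _ => rfl
      right_inv := fun _ => rfl
      map_smul' := fun r x =>
        LinearMap.congr_fun (DFunLike.congr_fun (IsRational.rep_coactModule b h) r) x }
  exact ⟨M, ⟨e.toModuleIso⟩⟩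

theorem essImage_of_injective {X : ModuleCat.{u} (FreeAlgebra k (A ⊕ I))}
    {M : YetterDrinfeldModule Q 𝔸 D} (g : X ⟶ (repFunctor b Q 𝔸 D).obj M)
    (hg : Function.Injective g.hom) : (repFunctor b Q 𝔸 D).essImage X := by
  let _ := scalarModule X
  have hr : IsRational (moduleRep X) :=
    IsRational.of_injective (b := b) (M := M.toCoactModule) (toRepModuleLin b g) hg
      fun r n => g.hom.map_smul r n
  refine essImage_of_isRational hr ?_
  refine (CoactModule.Hom.ofRep (b := b) (M := hr.coactModule b) (N := M.toCoactModule)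
    (toRepModuleLin b g) fun r n => ?_).isYetterDrinfeldModule_of_injective hg M.isYetterDrinfeld
  rw [IsRational.rep_coactModule b hr]
  exact g.hom.map_smul r n

theorem essImage_of_iSup_range {X : ModuleCat.{u} (FreeAlgebra k (A ⊕ I))} {ι : Sort*}
    {M : ι → YetterDrinfeldModule Q 𝔸 D} (g : ∀ j, (repFunctor b Q 𝔸 D).obj (M j) ⟶ X)
    (hg : ⨆ j, LinearMap.range (g j).hom = ⊤) : (repFunctor b Q 𝔸 D).essImage X := by
  let _ := scalarModule X
  have hg' : ⨆ j, LinearMap.range (ofRepModuleLin b (M := (M j).toCoactModule) (g j)) = ⊤ := by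
    refine eq_top_iff.2 fun x _ => ?_
    refine iSup_range_ind hg (P := fun x => x ∈ _) (zero_mem _) (fun j m => ?_)
      (fun _ _ => add_mem) x
    exact Submodule.mem_iSup_of_mem j ⟨m, rfl⟩
  have hr : IsRational (moduleRep X) :=
    IsRational.of_iSup_range (b := b) (M := fun j => (M j).toCoactModule)
      (fun j => ofRepModuleLin b (g j)) hg' fun j r n => (g j).hom.map_smul r n
  refine essImage_of_isRational hr ?_
  refine CoactModule.Hom.isYetterDrinfeldModule_of_iSup_range (N := hr.coactModule b)
    (M := fun j => (M j).toCoactModule)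
    (fun j => CoactModule.Hom.ofRep (b := b) (ofRepModuleLin b (g j)) fun r n => ?_) hg'
      fun j => (M j).isYetterDrinfeld
  rw [IsRational.rep_coactModule b hr]
  exact (g j).hom.map_smul r n

end Representations

/-! ### Closure properties that follow from closure under sums of images. -/

section Closure

open Limits

variable {R : Type u} [Ring R] (P : ObjectProperty (ModuleCat.{u} R))

/-- A property of modules is closed under jointly epimorphic families if every module which is
the sum of images of modules with the property has the property. -/
def IsClosedUnderSums : Prop :=
  ∀ (X : ModuleCat.{u} R) (ι : Type u) (M : ι → ModuleCat.{u} R) (g : ∀ j, M j ⟶ X),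
    (∀ j, P (M j)) → ⨆ j, LinearMap.range (g j).hom = ⊤ → P X

variable {P}

theorem IsClosedUnderSums.isClosedUnderQuotients (h : IsClosedUnderSums P) :
    P.IsClosedUnderQuotients where
  prop_of_epi {X Y} f _ hX := by
    refine h Y PUnit (fun _ => X) (fun _ => f) (fun _ => hX) ?_
    rw [iSup_const]
    exact LinearMap.range_eq_top.2 ((ModuleCat.epi_iff_surjective f).1 inferInstance)

theorem IsClosedUnderSums.isClosedUnderColimitsOfShape (h : IsClosedUnderSums P)
    (J : Type u) [Category.{u} J] : P.IsClosedUnderColimitsOfShape J where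
  colimitsOfShape_le := by
    rintro X ⟨p⟩
    let g : ∀ j, p.diag.obj j ⟶ X := fun j => p.ι.app j
    refine h X J p.diag.obj g p.prop_diag_obj ?_
    set S := ⨆ j, LinearMap.range (g j).hom with hS
    -- The projection modulo the sum of the images vanishes on every coprojection of the colimit,
    -- hence is zero, and the images span.
    have e : ModuleCat.ofHom S.mkQ = 0 := by
      refine p.isColimit.hom_ext fun j => ?_
      ext x
      exact (Submodule.Quotient.mk_eq_zero S).2 (Submodule.mem_iSup_of_mem j ⟨x, rfl⟩)
    refine eq_top_iff.2 fun x _ => (Submodule.Quotient.mk_eq_zero S).1 ?_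
    exact LinearMap.congr_fun (congrArg ModuleCat.Hom.hom e) x

theorem IsClosedUnderSums.containsZero (h : IsClosedUnderSums P) : P.ContainsZero where
  exists_zero := by
    refine ⟨ModuleCat.of R PUnit, ModuleCat.isZero_of_subsingleton _, ?_⟩
    exact h _ PEmpty (fun j => j.elim) (fun j => j.elim) (fun j => j.elim)
      (Subsingleton.elim _ _)

/-- A finite limit is a submodule of a finite product, and a finite product is the sum of its
coordinate submodules. -/
theorem IsClosedUnderSums.isClosedUnderLimitsOfShape (h : IsClosedUnderSums P)
    [P.IsClosedUnderSubobjects] (J : Type) [SmallCategory J] [FinCategory J] :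
    P.IsClosedUnderLimitsOfShape J where
  limitsOfShape_le := by
    rintro X ⟨p⟩
    classical
    have hprod : P (ModuleCat.of R (∀ j, p.diag.obj j)) := by
      refine h _ (ULift.{u} J) (fun j => p.diag.obj j.down)
        (fun j => ModuleCat.ofHom (LinearMap.single R (fun j => p.diag.obj j) j.down))
        (fun j => p.prop_diag_obj j.down) ?_
      rw [← Equiv.ulift.symm.iSup_comp]
      exact LinearMap.iSup_range_single R _
    let f : X ⟶ ModuleCat.of R (∀ j, p.diag.obj j) :=
      ModuleCat.ofHom (LinearMap.pi fun j => (p.π.app j).hom)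
    have : Mono f := by
      refine ⟨fun {Z} g g' e => p.isLimit.hom_ext fun j => ?_⟩
      have := congrArg (fun t => t ≫ ModuleCat.ofHom (LinearMap.proj j)) e
      exact this
    exact P.prop_of_mono f hprod

end Closure

/-! ### The Grothendieck property and enough injectives. -/

section Grothendieck

open Limits

variable {R : Type u} [Ring R] {P : ObjectProperty (ModuleCat.{u} R)}

/-- The abelian structure of a full subcategory of modules which is closed under submodules and
sums of images. -/
@[reducible] noncomputable def IsClosedUnderSums.abelian (h : IsClosedUnderSums P)
    [P.IsClosedUnderSubobjects] : Abelian P.FullSubcategory :=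
  haveI := h.containsZero
  haveI := h.isClosedUnderQuotients
  haveI : P.IsClosedUnderFiniteProducts :=
    ⟨fun J _ => by
      have := Fintype.ofFinite J
      exact h.isClosedUnderLimitsOfShape (Discrete J)⟩
  inferInstance

/-- The quotients of R that lie in `P` form a set. Since `P` is closed under submodules, it contains
the cyclic submodule generated by any element of an object, so these quotients are separating and so
is their coproduct. -/
theorem IsClosedUnderSums.hasSeparator (h : IsClosedUnderSums P) [P.IsClosedUnderSubobjects] :
    HasSeparator P.FullSubcategory := by
  have : ∀ J : Type u, HasCoproductsOfShape J P.FullSubcategory := fun J =>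
    haveI := h.isClosedUnderColimitsOfShape (Discrete J)
    hasColimitsOfShape_of_closedUnderColimits (Discrete J) P
  let f : {J : Submodule R R // P (ModuleCat.of R (R ⧸ J))} → P.FullSubcategory :=
    fun J => ⟨ModuleCat.of R (R ⧸ J.1), J.2⟩
  refine ⟨∐ f, ObjectProperty.IsSeparating.isSeparator_coproduct fun X Y g g' e => ?_⟩
  apply P.ι.map_injective
  ext x
  let t := LinearMap.toSpanSingleton R X.obj x
  let i : ModuleCat.of R (R ⧸ LinearMap.ker t) ⟶ X.obj :=
    ModuleCat.ofHom ((LinearMap.ker t).liftQ t le_rfl)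
  have : Mono i := (ModuleCat.mono_iff_injective i).2
    (LinearMap.ker_eq_bot.1 (Submodule.ker_liftQ_eq_bot _ _ _ le_rfl))
  have hi : P (ModuleCat.of R (R ⧸ LinearMap.ker t)) := P.prop_of_mono i X.property
  -- The two maps agree on the cyclic submodule generated by x; evaluate at the class of 1, which is
  -- sent to x.
  have h₁ := congrArg P.ι.map (e (f ⟨_, hi⟩) (.mk _) (P.homMk i))
  have h₂ := LinearMap.congr_fun (congrArg ModuleCat.Hom.hom h₁) (Submodule.Quotient.mk 1)
  have h₃ : t 1 = x := one_smul R x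
  rw [← h₃]
  exact h₂

/-- By the closure properties, finite limits and small colimits are computed in modules, so
exactness of filtered colimits is inherited along the inclusion. -/
theorem IsClosedUnderSums.isGrothendieckAbelian (h : IsClosedUnderSums P)
    [P.IsClosedUnderSubobjects] :
    letI := h.abelian
    IsGrothendieckAbelian.{u} P.FullSubcategory := by
  let _ := h.abelian
  have hcolim : ∀ (J : Type u) [SmallCategory J], P.IsClosedUnderColimitsOfShape J :=
    fun J _ => h.isClosedUnderColimitsOfShape J
  have hlim : ∀ (J : Type) [SmallCategory J] [FinCategory J], P.IsClosedUnderLimitsOfShape J :=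
    fun J _ _ => h.isClosedUnderLimitsOfShape J
  have : PreservesFiniteLimits P.ι := ⟨fun J _ _ => inferInstance⟩
  have : ReflectsFiniteLimits P.ι := ⟨fun J _ _ => inferInstance⟩
  have hfilt : HasFilteredColimitsOfSize.{u, u} P.FullSubcategory :=
    ⟨fun J _ _ => hasColimitsOfShape_of_closedUnderColimits J P⟩
  exact
    { hasFilteredColimitsOfSize := hfilt
      ab5OfSize := ⟨fun J _ _ => HasExactColimitsOfShape.domain_of_functor J P.ι⟩
      hasSeparator := h.hasSeparator }

variable {k H A C : Type u} [Field k] [Ring H] [Algebra k H] [Ring A] [Algebra k A]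
  [AddCommGroup C] [Module k C]

section

variable {I : Type u} (b : Module.Basis I k C) (Q : QuasiHopfAlgebra k H)
  (𝔸 : BicomoduleAlgebra Q.toQuasiBialgebra A) (D : BimoduleCoalgebra Q.toQuasiBialgebra C)

instance : (repFunctor b Q 𝔸 D).essImage.IsClosedUnderSubobjects where
  prop_of_mono {X Y} g _ hY := by
    obtain ⟨M, ⟨e⟩⟩ := hY
    exact essImage_of_injective (g ≫ e.inv)
      ((ModuleCat.mono_iff_injective (g ≫ e.inv)).1 inferInstance)

theorem isClosedUnderSums_essImage : IsClosedUnderSums (repFunctor b Q 𝔸 D).essImage := by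
  intro X ι M g hM hg
  choose N e using hM
  refine essImage_of_iSup_range (M := N) (fun j => (e j).some.hom ≫ g j) ?_
  rw [← hg]
  refine iSup_congr fun j => ?_
  rw [ModuleCat.hom_comp]
  exact LinearMap.range_comp_of_range_eq_top _ (LinearMap.range_eq_top.2
    ((ModuleCat.epi_iff_surjective (e j).some.hom).1 inferInstance))

end

theorem exists_abelian_isGrothendieckAbelian (Q : QuasiHopfAlgebra k H)
    (𝔸 : BicomoduleAlgebra Q.toQuasiBialgebra A) (D : BimoduleCoalgebra Q.toQuasiBialgebra C) :
    ∃ _ : Abelian (YetterDrinfeldModule Q 𝔸 D),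
      IsGrothendieckAbelian.{u} (YetterDrinfeldModule Q 𝔸 D) := by
  let U := repFunctor (Module.Basis.ofVectorSpace k C) Q 𝔸 D
  have h : IsClosedUnderSums U.essImage := isClosedUnderSums_essImage _ Q 𝔸 D
  have : U.essImage.IsClosedUnderSubobjects :=
    inferInstanceAs
      (repFunctor (Module.Basis.ofVectorSpace k C) Q 𝔸 D).essImage.IsClosedUnderSubobjects
  let _ := h.abelian
  have := h.isGrothendieckAbelian
  have : U.Full := inferInstanceAs (repFunctor (Module.Basis.ofVectorSpace k C) Q 𝔸 D).Full
  have : U.Faithful :=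
    inferInstanceAs (repFunctor (Module.Basis.ofVectorSpace k C) Q 𝔸 D).Faithful
  have : U.toEssImage.IsEquivalence := {}
  let E := U.toEssImage.asEquivalence
  -- The equivalence with the essential image carries back the additive structure first, then finite
  -- products, the abelian structure and the Grothendieck property.
  let _ : Preadditive (YetterDrinfeldModule Q 𝔸 D) :=
    Preadditive.ofFullyFaithful E.fullyFaithfulFunctor
  have : HasFiniteProducts (YetterDrinfeldModule Q 𝔸 D) :=
    ⟨fun _ => Adjunction.hasLimitsOfShape_of_equivalence E.functor⟩
  let a : Abelian (YetterDrinfeldModule Q 𝔸 D) := abelianOfEquivalence E.functor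
  exact ⟨a, IsGrothendieckAbelian.of_equivalence E.symm⟩

theorem enoughInjectives_yetterDrinfeldModule (Q : QuasiHopfAlgebra k H)
    (𝔸 : BicomoduleAlgebra Q.toQuasiBialgebra A) (D : BimoduleCoalgebra Q.toQuasiBialgebra C) :
    EnoughInjectives (YetterDrinfeldModule Q 𝔸 D) := by
  obtain ⟨_, _⟩ := exists_abelian_isGrothendieckAbelian Q 𝔸 D
  exact IsGrothendieckAbelian.enoughInjectives

end Grothendieck

end QHopf

theorem theorem3p8 {k H A C : Type u} [Field k] [Ring H] [Algebra k H] [Ring A] [Algebra k A]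
    [AddCommGroup C] [Module k C] (Q : QHopf.QuasiHopfAlgebra k H)
    (𝔸 : QHopf.BicomoduleAlgebra Q.toQuasiBialgebra A)
    (D : QHopf.BimoduleCoalgebra Q.toQuasiBialgebra C) :
    (∃ (hF : ∀ M : QHopf.YetterDrinfeldModule Q 𝔸 D,
          QHopf.IsDoiHopfModule (QHopf.rhoTwo Q 𝔸) (QHopf.PhiRhoTwo Q 𝔸) D.toOpTensor M.act
            (QHopf.twistP Q 𝔸 D M.toCoactModule))
        (hG : ∀ M : QHopf.DoiHopfModule Q 𝔸 D,
          QHopf.IsYetterDrinfeldModule 𝔸 D M.act (QHopf.twistQ Q 𝔸 D M.toCoactModule)),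
        QHopf.functorF hF ⋙ QHopf.functorG hG = 𝟭 (QHopf.YetterDrinfeldModule Q 𝔸 D) ∧
          QHopf.functorG hG ⋙ QHopf.functorF hF = 𝟭 (QHopf.DoiHopfModule Q 𝔸 D)) ∧
      (∃ _ : Abelian (QHopf.YetterDrinfeldModule Q 𝔸 D),
        IsGrothendieckAbelian.{u} (QHopf.YetterDrinfeldModule Q 𝔸 D)) ∧
      EnoughInjectives (QHopf.YetterDrinfeldModule Q 𝔸 D) := by
  exact ⟨⟨QHopf.isDoiHopfModule_twistP, QHopf.isYetterDrinfeldModule_twistQ,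
    QHopf.functorF_comp_functorG, QHopf.functorG_comp_functorF⟩,
    QHopf.exists_abelian_isGrothendieckAbelian Q 𝔸 D,
    QHopf.enoughInjectives_yetterDrinfeldModule Q 𝔸 D⟩
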